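/- **Lemma (outcome probabilities of FLO circuits along a Cayley path).** For a unitary or orthogonal matrix $g$ put $$F_\theta(g)=\bigl((1-\theta)\mathbb I+(1+\theta)g\bigr)\bigl((1+\theta)\mathbb I+(1-\theta)g\bigr)^{-1},\qquad g_\theta=g_0F_\theta(g),$$ where $\theta\in[0,1]$ if $-1$ is not an eigenvalue of $g$, and $\theta\in(0,1]$ otherwise. *Passive FLO.* Let $d,n\ge 0$ be integers, $g_0,g\in \mathrm U(d)$, $\mathcal H=\bigwedge^n(\mathbb C^d)\subset(\mathbb C^d)^{\otimes n}$, $\Pi(U)=U^{\otimes n}|_{\mathcal H}$. Let $e^{i\phi_1},\dots,e^{i\phi_d}$, with $\phi_j\in(-\pi,\pi]$, be the eigenvalues of $g$ with multiplicity (such phases exist), and put $m=n$. *Active FLO.* Let $d\ge 0$, $g_0,g\in \mathrm{SO}(2d)$, let $\mathcal H$ be the span, in the fermionic Fock space of $\mathbb C^d$, of the Fock states with an even number of particles, and let $\Pi(O)=\exp\bigl(\tfrac14\sum_{i,j=1}^{2d}[\log O]_{ij}\,m_im_j\bigr)$, where $m_{2j-1}=f_j+f_j^\dagger$, $m_{2j}=-i(f_j-f_j^\dagger)$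 are the Majorana operators and $\log O$ is a real antisymmetric logarithm of $O$; one exists for every $O=g_\theta$, and the claims hold for every choice of it. Let $e^{\pm i\phi_1},\dots,e^{\pm i\phi_d}$, with $\phi_j\in(-\pi,\pi]$, be the eigenvalues of $g$ with multiplicity (such phases exist), and put $m=d$. In both cases define $$Q_g(\theta)=\prod_{j:\ \phi_j\neq\pi}\bigl(1+\theta^2\tan^2(\phi_j/2)\bigr)^m$$ (the product runs over all $j\in\{1,\dots,d\}$ if $-1$ is not an eigenvalue of $g$). Then $Q_g>0$ on $\mathbb R$. Moreover, for every $|\Psi\rangle\in\mathcal H$ and every Fock state $|\mathbf x\rangle\in\mathcal H$ there is a real polynomial $D$ such that the outcome probability is the rational function $$\mathrm{tr}\bigl(|\mathbf x\rangle\langle\mathbf x|\,\Pi(g_\theta)\,|\Psi\rangle\langle\Psi|\,\Pi(g_\theta)^\dagger\bigr)=\frac{D(\theta)}{Q_g(\theta)}$$ for all $\theta$ as above. The degrees of $D$ and of $Q_g$ are at most $2dm$, that is, $$\text{passive: }(\deg D,\deg Q_g)\le(2dn,2dn),\qquad \text{active: }(\deg D,\deg Q_g)\le(2d^2,2d^2).$$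 If neither $1$ nor $-1$ is an eigenvalue of $g$, then $\deg Q_g=2dm$; if in addition the outcome probability at $\theta=0$ is nonzero, then $\deg D=2dm$. Finally, $Q_g$ can be computed efficiently: there are absolute constants $C,c$ such that for every $d$ (and every $n\le d$ in the passive case) some straight-line program, which uses only real additions, subtractions, multiplications, divisions by quantities that never vanish, and rational constants, computes $Q_g(\theta)$ in at most $C(d+1)^c$ steps from $\theta\in\mathbb R$ and the (real and imaginary parts of the) entries of $g$, for all $\theta$ and all $g$ in the group without the eigenvalue $-1$. -/

import Mathlib

open Matrix

noncomputable section

namespace FLO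

/-- The probability `tr(|x⟩⟨x| V |Ψ⟩⟨Ψ| V†)` of the outcome `x` when `V` acts on the input `Ψ`. -/
def outcomeProb {ι : Type*} [Fintype ι] (x Ψ : ι → ℂ) (V : Matrix ι ι ℂ) : ℂ :=
  (vecMulVec x (star x) * V * vecMulVec Ψ (star Ψ) * Vᴴ).trace

/-- `F_θ(g) = ((1-θ) 1 + (1+θ) g) ((1+θ) 1 + (1-θ) g)⁻¹`. For `g` unitary or orthogonal the second
factor is invertible when `0 < θ ≤ 1`, and also when `θ = 0` if `-1` is not an eigenvalue of `g`. -/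
def cayleyF {m 𝕜 : Type*} [Fintype m] [DecidableEq m] [RCLike 𝕜] (θ : ℝ) (g : Matrix m m 𝕜) :
    Matrix m m 𝕜 :=
  ((1 - θ) • (1 : Matrix m m 𝕜) + (1 + θ) • g) * ((1 + θ) • (1 : Matrix m m 𝕜) + (1 - θ) • g)⁻¹

/-- The polynomial `∏_j (1 + θ² tan²(φ_j / 2))^m` in `θ`, where the factors with `φ_j = π`, for
which the tangent is infinite, are left out. -/
def denominator {d : ℕ} (φ : Fin d → ℝ) (m : ℕ) : Polynomial ℝ :=
  ∏ j, (if φ j = Real.pi then 1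
    else (1 + Polynomial.C (Real.tan (φ j / 2) ^ 2) * Polynomial.X ^ 2) ^ m)

/-! ### Passive fermionic linear optics -/

/-- `φ` lists the phases of the `d` eigenvalues `e^{iφ_j}` of `g`, with multiplicity. -/
def IsPhasesU {d : ℕ} (g : Matrix (Fin d) (Fin d) ℂ) (φ : Fin d → ℝ) : Prop :=
  (∀ j, φ j ∈ Set.Ioc (-Real.pi) Real.pi) ∧
    g.charpoly = ∏ j, (Polynomial.X - Polynomial.C (Complex.exp (φ j * Complex.I)))

/-- The totally antisymmetric subspace `⋀ⁿ(ℂᵈ)` of `(ℂᵈ)^{⊗ n}`; a tensor is given by its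
coordinates in the product basis `|b₁⟩ ⊗ ⋯ ⊗ |bₙ⟩`. -/
def antisymm (d n : ℕ) : Submodule ℂ ((Fin n → Fin d) → ℂ) where
  carrier := {Ψ | ∀ (σ : Equiv.Perm (Fin n)) (b : Fin n → Fin d),
    Ψ (b ∘ σ) = ((Equiv.Perm.sign σ : ℤ) : ℂ) * Ψ b}
  add_mem' := by
    intro Ψ Φ hΨ hΦ σ b
    simp [hΨ σ b, hΦ σ b, mul_add]
  zero_mem' := by
    intro σ b
    simp
  smul_mem' := by
    intro c Ψ hΨ σ b
    simp [hΨ σ b, mul_left_comm]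

/-- The Fock state `|a₁⟩ ∧ ⋯ ∧ |aₙ⟩ = (n!)^{-1/2} ∑_σ sgn(σ) |a_{σ(1)}⟩ ⊗ ⋯ ⊗ |a_{σ(n)}⟩` of the
`n`-element set of occupied modes `a₁ < ⋯ < aₙ`. -/
def fockWedge {d n : ℕ} (a : Fin n ↪o Fin d) : (Fin n → Fin d) → ℂ :=
  fun b => ((1 / Real.sqrt (Nat.factorial n) : ℝ) : ℂ) *
    ∑ σ : Equiv.Perm (Fin n), if b = a ∘ σ then ((Equiv.Perm.sign σ : ℤ) : ℂ) else 0

/-- The operator `U^{⊗ n}` on `(ℂᵈ)^{⊗ n}`. It preserves `antisymm d n`, and its restriction to that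
subspace is the passive representation `Π_pas(U)`. -/
def tensorPow {d : ℕ} (n : ℕ) (U : Matrix (Fin d) (Fin d) ℂ) :
    Matrix (Fin n → Fin d) (Fin n → Fin d) ℂ :=
  Matrix.of fun a b => ∏ k, U (a k) (b k)

/-- `U^{⊗ n}` preserves the antisymmetric subspace. -/
theorem tensorPow_mulVec_mem {d n : ℕ} (U : Matrix (Fin d) (Fin d) ℂ)
    {Ψ : (Fin n → Fin d) → ℂ} (hΨ : Ψ ∈ antisymm d n) : tensorPow n U *ᵥ Ψ ∈ antisymm d n := by
  intro σ a
  simp only [mulVec, dotProduct, tensorPow, Matrix.of_apply, Function.comp, Finset.mul_sum]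
  refine Fintype.sum_equiv (Equiv.arrowCongr σ (Equiv.refl _)) _ _ fun b => ?_
  have h1 : ∏ k, U (a (σ k)) (b k) = ∏ k, U (a k) (b (σ.symm k)) :=
    Fintype.prod_equiv σ _ _ fun k => by simp
  have h2 := hΨ σ (b ∘ σ.symm)
  have h3 : (b ∘ σ.symm) ∘ σ = b := by
    funext k
    simp
  rw [h3] at h2
  have h4 : Equiv.arrowCongr σ (Equiv.refl (Fin d)) b = b ∘ σ.symm := rfl
  rw [h4, h1, h2]
  exact mul_left_comm _ _ _

/-! ### Active fermionic linear optics -/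

/-- `φ` lists the phases of the `2d` eigenvalues `e^{± iφ_j}` of `g`, with multiplicity. -/
def IsPhasesSO {d : ℕ} (g : Matrix (Fin (2 * d)) (Fin (2 * d)) ℝ) (φ : Fin d → ℝ) : Prop :=
  (∀ j, φ j ∈ Set.Ioc (-Real.pi) Real.pi) ∧
    (g.map Complex.ofReal).charpoly =
      ∏ j, ((Polynomial.X - Polynomial.C (Complex.exp (φ j * Complex.I))) *
        (Polynomial.X - Polynomial.C (Complex.exp (-(φ j * Complex.I)))))

/-- Operators on the Fock space of `d` modes, as matrices in the Fock basis `|𝒳⟩`, `𝒳 ⊆ [d]`. -/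
abbrev FockOp (d : ℕ) := Matrix (Finset (Fin d)) (Finset (Fin d)) ℂ

/-- The creation operator `f_j†`, acting by `f_j† |𝒳⟩ = (-1)^{#{i ∈ 𝒳 | i < j}} |𝒳 ∪ {j}⟩` if
`j ∉ 𝒳`, and by `f_j† |𝒳⟩ = 0` otherwise. -/
def creation {d : ℕ} (j : Fin d) : FockOp d :=
  Matrix.of fun Y X =>
    if j ∉ X ∧ Y = insert j X then (-1) ^ (X.filter (fun i => i < j)).card else 0

/-- The Majorana operators `m_{2j-1} = f_j + f_j†`, `m_{2j} = -i (f_j - f_j†)`, indexed from `0`. -/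
def majorana {d : ℕ} (k : Fin (2 * d)) : FockOp d :=
  let j : Fin d := ⟨k.val / 2, by omega⟩
  if k.val % 2 = 0 then (creation j)ᴴ + creation j
  else (-Complex.I) • ((creation j)ᴴ - creation j)

/-- `V` is a value of `Π_act(O) = exp(1/4 ∑_{ij} (log O)_{ij} m_i m_j)`, for some choice of the
real antisymmetric logarithm of `O`. -/
def IsPiAct {d : ℕ} (O : Matrix (Fin (2 * d)) (Fin (2 * d)) ℝ) (V : FockOp d) : Prop :=
  ∃ A : Matrix (Fin (2 * d)) (Fin (2 * d)) ℝ, Aᵀ = -A ∧ NormedSpace.exp A = O ∧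
    V = NormedSpace.exp ((1 / 4 : ℂ) • ∑ i, ∑ j, (A i j : ℂ) • (majorana i * majorana j))

/-- The positive parity subspace, spanned by the Fock states with an even number of particles. -/
def evenFock (d : ℕ) : Submodule ℂ (Finset (Fin d) → ℂ) where
  carrier := {Ψ | ∀ X : Finset (Fin d), ¬ Even X.card → Ψ X = 0}
  add_mem' := by
    intro Ψ Φ hΨ hΦ X hX
    simp [hΨ X hX, hΦ X hX]
  zero_mem' := by
    intro X _
    rfl
  smul_mem' := by
    intro c Ψ hΨ X hX
    simp [hΨ X hX]

/-! ### Counting arithmetic operations -/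

/-- Straight-line arithmetic computations on the domain `S` with inputs `inp`. The list holds, last
step first, the results of the steps as functions of the point of `S`; each step reads an input,
loads a rational constant, or applies `+`, `-`, `*`, `/` to earlier results. The number of steps is
the length of the list. -/
inductive IsStraightLine {S : Type*} (inp : Set (S → ℝ)) : List (S → ℝ) → Prop
  | nil : IsStraightLine inp []
  | input {l} {f : S → ℝ} : IsStraightLine inp l → f ∈ inp → IsStraightLine inp (f :: l)
  | const {l} (q : ℚ) : IsStraightLine inp l → IsStraightLine inp ((fun _ => (q : ℝ)) :: l)
  | add {l} {f g : S → ℝ} : IsStraightLine inp l → f ∈ l → g ∈ l →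
      IsStraightLine inp ((fun s => f s + g s) :: l)
  | sub {l} {f g : S → ℝ} : IsStraightLine inp l → f ∈ l → g ∈ l →
      IsStraightLine inp ((fun s => f s - g s) :: l)
  | mul {l} {f g : S → ℝ} : IsStraightLine inp l → f ∈ l → g ∈ l →
      IsStraightLine inp ((fun s => f s * g s) :: l)
  | div {l} {f g : S → ℝ} : IsStraightLine inp l → f ∈ l → g ∈ l → (∀ s, g s ≠ 0) →
      IsStraightLine inp ((fun s => f s / g s) :: l)

/-- `F` is computed from the inputs `inp` in at most `L` arithmetic steps. -/
def ComputableInSteps {S : Type*} (inp : Set (S → ℝ)) (F : S → ℝ) (L : ℕ) : Prop :=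
  ∃ l : List (S → ℝ), IsStraightLine inp l ∧ l.length ≤ L ∧ F ∈ l

/-- Pairs of a unitary matrix without the eigenvalue `-1` and a parameter `θ`. -/
abbrev DomU (d : ℕ) :=
  {g : Matrix.unitaryGroup (Fin d) ℂ // (-1 : ℂ) ∉ spectrum ℂ (g : Matrix (Fin d) (Fin d) ℂ)} × ℝ

/-- The inputs: real and imaginary parts of the matrix entries, and `θ`. -/
def inputsU (d : ℕ) : Set (DomU d → ℝ) :=
  {f | (∃ i j, f = fun s => ((s.1.1 : Matrix (Fin d) (Fin d) ℂ) i j).re) ∨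
    (∃ i j, f = fun s => ((s.1.1 : Matrix (Fin d) (Fin d) ℂ) i j).im) ∨ f = fun s => s.2}

/-- Pairs of a special orthogonal matrix without the eigenvalue `-1` and a parameter `θ`. -/
abbrev DomSO (d : ℕ) :=
  {g : Matrix.specialOrthogonalGroup (Fin (2 * d)) ℝ //
    (-1 : ℝ) ∉ spectrum ℝ (g : Matrix (Fin (2 * d)) (Fin (2 * d)) ℝ)} × ℝ

/-- The inputs: the matrix entries, and `θ`. -/
def inputsSO (d : ℕ) : Set (DomSO d → ℝ) :=
  {f | (∃ i j, f = fun s => (s.1.1 : Matrix (Fin (2 * d)) (Fin (2 * d)) ℝ) i j) ∨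
    f = fun s => s.2}

end FLO

end

/-! ### Squared amplitudes, phases, and the denominator polynomial. -/

noncomputable section
namespace FLO

/-! On an eigenvalue `z = e^{iφ}` with `z ≠ -1`, the Cayley path is `(1 - θκ) / (1 + θκ)` with `κ =
(1 - z) / (1 + z) = -i tan(φ/2)`. Since `κ` is imaginary, the numerator is the conjugate of the
denominator and `|1 + θκ|² = 1 + θ² tan²(φ/2)`. An eigenvalue `-1` stays at `-1` and contributes no
factor. An outcome probability is the squared modulus of an amplitude, so it suffices to write the
amplitude as a polynomial in `θ` over a factor of known modulus.

Passive case: after unitary diagonalization (`exists_unitary_diagonalization`), multiplying `g_θ` by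
`∏ (1 + θκ_j)` makes every entry a polynomial of degree at most `d`. The amplitude of `U^{⊗ n}` is
homogeneous of degree `n` in the entries, hence becomes a polynomial of degree at most `dn`.

Active case: `g` is brought to planar rotations (`exists_rotation_form`). With `b_j` the product of
the two Majorana operators of the `j`-th plane and `t_j = tan(φ_j/2)`, the operator `∏ (1 + θ t_j
b_j)` implements `F_θ(g)` on the Majorana operators; a plane with eigenvalue `-1` contributes `b_j`
instead. Its amplitude has degree at most `d`, and `W W† = ∏ (1 + θ² t_j²)`. The Majorana operators
act irreducibly, so any value of `Π(g_θ)` equals the normalized operator up to a phase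
(`Intertwines.eq_smul`); this makes the choice of logarithm irrelevant. The resulting fraction has
degrees at most `2d` and is expanded by the `(d - 1)`-st power of its denominator.

The exact degree of `D` reflects that `F_θ(g)` runs from `1` at `θ = 0` to `-1` at `θ = ∞` when `±1`
are not eigenvalues. Passively `-1` acts as a scalar; actively it is implemented by the parity
operator, which fixes even states. So the leading coefficient of the amplitude is a nonzero multiple
of the amplitude at `θ = 0`.

For computability, `∏ (1 + θ² tan²(φ_j/2))` is a ratio of determinants of matrices `(1 + Gᵀ)((1 + θ)
+ (1 - θ)G)` with `G` real orthogonal (the realification of `g` in the passive case). Their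
quadratic forms are positive definite, so Gaussian elimination without pivoting never divides by
zero. -/

/-- The squared modulus of a complex polynomial on the real line is a real polynomial. -/
theorem exists_normSq_polynomial (a : Polynomial ℂ) {k : ℕ} (ha : a.natDegree ≤ k) :
    ∃ D : Polynomial ℝ, D.natDegree ≤ 2 * k ∧ D.coeff (2 * k) = Complex.normSq (a.coeff k) ∧
      ∀ θ : ℝ, D.eval θ = Complex.normSq (a.eval (θ : ℂ)) := by
  set A : Polynomial ℝ := ∑ i ∈ Finset.range (k + 1), Polynomial.monomial i (a.coeff i).re with hA
  set B : Polynomial ℝ := ∑ i ∈ Finset.range (k + 1), Polynomial.monomial i (a.coeff i).im with hB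
  have dA : A.natDegree ≤ k := Polynomial.natDegree_sum_le_of_forall_le _ _ fun i hi =>
    (Polynomial.natDegree_monomial_le _).trans (by simpa [Nat.lt_succ_iff] using hi)
  have dB : B.natDegree ≤ k := Polynomial.natDegree_sum_le_of_forall_le _ _ fun i hi =>
    (Polynomial.natDegree_monomial_le _).trans (by simpa [Nat.lt_succ_iff] using hi)
  have cA : A.coeff k = (a.coeff k).re := by
    simp [hA, Polynomial.finsetSum_coeff, Polynomial.coeff_monomial]
  have cB : B.coeff k = (a.coeff k).im := by
    simp [hB, Polynomial.finsetSum_coeff, Polynomial.coeff_monomial]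
  have hev : ∀ θ : ℝ, a.eval (θ : ℂ) = ∑ i ∈ Finset.range (k + 1), a.coeff i * ((θ ^ i : ℝ) : ℂ) := by
    intro θ
    rw [Polynomial.eval_eq_sum_range' (Nat.lt_succ_of_le ha)]
    simp
  have eA : ∀ θ : ℝ, A.eval θ = (a.eval (θ : ℂ)).re := by
    intro θ
    rw [hev, Complex.re_sum, hA, Polynomial.eval_finsetSum]
    exact Finset.sum_congr rfl fun i _ => by rw [Polynomial.eval_monomial, Complex.re_mul_ofReal]
  have eB : ∀ θ : ℝ, B.eval θ = (a.eval (θ : ℂ)).im := by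
    intro θ
    rw [hev, Complex.im_sum, hB, Polynomial.eval_finsetSum]
    exact Finset.sum_congr rfl fun i _ => by rw [Polynomial.eval_monomial, Complex.im_mul_ofReal]
  refine ⟨A * A + B * B, ?_, ?_, fun θ => ?_⟩
  · rw [two_mul]
    exact Polynomial.natDegree_add_le_of_degree_le
      (Polynomial.natDegree_mul_le_of_le dA dA) (Polynomial.natDegree_mul_le_of_le dB dB)
  · rw [two_mul, Polynomial.coeff_add, Polynomial.coeff_mul_add_eq_of_natDegree_le dA dA,
      Polynomial.coeff_mul_add_eq_of_natDegree_le dB dB, cA, cB, Complex.normSq_apply]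
  · rw [Polynomial.eval_add, Polynomial.eval_mul, Polynomial.eval_mul, eA, eB, Complex.normSq_apply]

/-- The outcome probability is the squared modulus of the amplitude `⟨x|V|Ψ⟩`. -/
theorem outcomeProb_eq_normSq {ι : Type*} [Fintype ι] (x Ψ : ι → ℂ) (V : Matrix ι ι ℂ) :
    outcomeProb x Ψ V = (Complex.normSq (star x ⬝ᵥ V *ᵥ Ψ) : ℂ) := by
  have h : vecMulVec Ψ (star Ψ) * Vᴴ = vecMulVec Ψ (star (V *ᵥ Ψ)) := by
    rw [vecMulVec_mul, star_mulVec]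
  have h' : x ⬝ᵥ star (V *ᵥ Ψ) = (starRingEnd ℂ) (star x ⬝ᵥ V *ᵥ Ψ) := by
    rw [starRingEnd_apply, star_dotProduct, star_star, dotProduct_comm]
  rw [outcomeProb, Matrix.mul_assoc, h, vecMulVec_mul, vecMulVec_mul_vecMulVec,
    trace_vecMulVec, dotProduct_smul, ← dotProduct_mulVec, h', smul_eq_mul, Complex.mul_conj]

/-- The Cayley transform of a number, with the value `0` at `-1`. -/
def kappa (z : ℂ) : ℂ := (1 - z) / (1 + z)

/-- Extracting `w = e^{iφ/2}` gives `1 - w² = -2i sin(φ/2) w` and `1 + w² = 2 cos(φ/2) w`. At `φ =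
π` both sides are `0` by the convention for division by zero, so no case distinction is needed. -/
theorem kappa_exp (φ : ℝ) :
    kappa (Complex.exp (φ * Complex.I)) = -(Complex.I * (Real.tan (φ / 2) : ℝ)) := by
  set w := Complex.exp ((φ / 2 : ℝ) * Complex.I) with hw
  have hz : Complex.exp (φ * Complex.I) = w * w := by
    rw [hw, ← Complex.exp_add]
    push_cast
    ring_nf
  have hw' : w = (Real.cos (φ / 2) : ℂ) + (Real.sin (φ / 2) : ℂ) * Complex.I := by
    rw [hw, Complex.exp_mul_I]
    push_cast
    rfl
  have hne : w ≠ 0 := Complex.exp_ne_zero _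
  have h1 : ((Real.cos (φ / 2) : ℂ)) ^ 2 + (Real.sin (φ / 2) : ℂ) ^ 2 = 1 := by
    exact_mod_cast Real.cos_sq_add_sin_sq (φ / 2)
  have e1 : 1 - w * w = (-(2 * Complex.I * (Real.sin (φ / 2) : ℂ))) * w := by
    rw [hw', ← h1]
    ring_nf
    rw [Complex.I_sq]
    ring
  have e2 : 1 + w * w = (2 * (Real.cos (φ / 2) : ℂ)) * w := by
    rw [hw', ← h1]
    ring_nf
    rw [Complex.I_sq]
    ring
  rw [kappa, hz, e1, e2, mul_div_mul_right _ _ hne, Real.tan_eq_sin_div_cos, Complex.ofReal_div,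
    neg_div, mul_assoc, mul_div_mul_left _ _ two_ne_zero, mul_div_assoc]

theorem tan_half_ne_zero {φ : ℝ} (h : φ ∈ Set.Ioc (-Real.pi) Real.pi) (h0 : φ ≠ 0)
    (hpi : φ ≠ Real.pi) : Real.tan (φ / 2) ≠ 0 := by
  have hlt : φ < Real.pi := lt_of_le_of_ne h.2 hpi
  have hc : 0 < Real.cos (φ / 2) := Real.cos_pos_of_mem_Ioo ⟨by linarith [h.1], by linarith⟩
  rw [Real.tan_eq_sin_div_cos]
  refine div_ne_zero (fun hs => h0 ?_) hc.ne'
  have := (Real.sin_eq_zero_iff_of_lt_of_lt (x := φ / 2) (by linarith [h.1, Real.pi_pos])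
    (by linarith [Real.pi_pos])).1 hs
  linarith

theorem exp_phase_eq_neg_one_iff {φ : ℝ} (h : φ ∈ Set.Ioc (-Real.pi) Real.pi) :
    Complex.exp (φ * Complex.I) = -1 ↔ φ = Real.pi := by
  constructor
  · intro he
    have := congrArg Complex.arg he
    have h' : φ ∈ Set.Ioc (-Real.pi) (-Real.pi + 2 * Real.pi) := ⟨h.1, by linarith [h.2]⟩
    rwa [Complex.arg_exp_mul_I, (toIocMod_eq_self _).2 h', Complex.arg_neg_one] at this
  · rintro rfl
    exact Complex.exp_pi_mul_I

theorem exists_phase {z : ℂ} (hz : ‖z‖ = 1) :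
    ∃ φ ∈ Set.Ioc (-Real.pi) Real.pi, Complex.exp (φ * Complex.I) = z :=
  ⟨z.arg, Complex.arg_mem_Ioc z, by simpa [hz] using Complex.norm_mul_exp_arg_mul_I z⟩

/-- The factor `1 + θ² tan²(φ/2)` as a function of `z = e^{iφ}`. -/
def cayleyWeight (θ : ℝ) (z : ℂ) : ℝ := 1 + θ ^ 2 * Complex.normSq (kappa z)

theorem cayleyWeight_pos (θ : ℝ) (z : ℂ) : 0 < cayleyWeight θ z := by
  have := Complex.normSq_nonneg (kappa z)
  unfold cayleyWeight
  positivity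

theorem cayleyWeight_exp (θ φ : ℝ) :
    cayleyWeight θ (Complex.exp (φ * Complex.I)) = 1 + Real.tan (φ / 2) ^ 2 * θ ^ 2 := by
  rw [cayleyWeight, kappa_exp, Complex.normSq_neg, Complex.normSq_mul, Complex.normSq_I,
    Complex.normSq_ofReal]
  ring

theorem cayleyWeight_conj (θ : ℝ) (z : ℂ) :
    cayleyWeight θ ((starRingEnd ℂ) z) = cayleyWeight θ z := by
  have : kappa ((starRingEnd ℂ) z) = (starRingEnd ℂ) (kappa z) := by simp [kappa]
  rw [cayleyWeight, this, Complex.normSq_conj, cayleyWeight]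

/-- The omitted factors fit the general formula because `Real.tan (π / 2) = 0` by convention. -/
theorem denominator_eq_pow {d : ℕ} (φ : Fin d → ℝ) (m : ℕ) :
    denominator φ m =
      (∏ j, (1 + Polynomial.C (Real.tan (φ j / 2) ^ 2) * Polynomial.X ^ 2)) ^ m := by
  rw [denominator, ← Finset.prod_pow]
  refine Finset.prod_congr rfl fun j _ => ?_
  split_ifs with h
  · simp [h]
  · rfl

theorem denominator_eval {d : ℕ} (φ : Fin d → ℝ) (m : ℕ) (θ : ℝ) :
    (denominator φ m).eval θ =
      (∏ j, cayleyWeight θ (Complex.exp (φ j * Complex.I))) ^ m := by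
  simp [denominator_eq_pow, Polynomial.eval_prod, cayleyWeight_exp]

theorem denominator_eval_pos {d : ℕ} (φ : Fin d → ℝ) (m : ℕ) (θ : ℝ) :
    0 < (denominator φ m).eval θ := by
  rw [denominator_eval]
  exact pow_pos (Finset.prod_pos fun j _ => cayleyWeight_pos _ _) _

theorem natDegree_denominator_le {d : ℕ} (φ : Fin d → ℝ) (m : ℕ) :
    (denominator φ m).natDegree ≤ 2 * d * m := by
  rw [denominator_eq_pow, mul_comm]
  refine Polynomial.natDegree_pow_le_of_le m ((Polynomial.natDegree_prod_le _ _).trans ?_)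
  refine (Finset.sum_le_card_nsmul _ _ 2 fun j _ => ?_).trans (by simp [mul_comm])
  compute_degree

theorem natDegree_denominator {d : ℕ} {φ : Fin d → ℝ} (m : ℕ)
    (hφ : ∀ j, φ j ∈ Set.Ioc (-Real.pi) Real.pi) (h : ∀ j, φ j ≠ 0 ∧ φ j ≠ Real.pi) :
    (denominator φ m).natDegree = 2 * d * m := by
  have hf : ∀ j, (1 + Polynomial.C (Real.tan (φ j / 2) ^ 2) * Polynomial.X ^ 2).natDegree = 2 := by
    intro j
    have := tan_half_ne_zero (hφ j) (h j).1 (h j).2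
    compute_degree!
  have h0 : ∀ j, (1 + Polynomial.C (Real.tan (φ j / 2) ^ 2) * Polynomial.X ^ 2) ≠ 0 := by
    intro j h0
    have := hf j
    rw [h0] at this
    simp at this
  rw [denominator_eq_pow, Polynomial.natDegree_pow, Polynomial.natDegree_prod _ _ fun j _ => h0 j,
    Finset.sum_congr rfl fun j _ => hf j]
  simp
  ring

end FLO
end

noncomputable section
namespace FLO

/-! ### The Cayley path on eigenvalues -/

/-- The limit at `θ → 0` of the Cayley path through `z`. -/
def cayleySign (z : ℂ) : ℂ := if z = -1 then -1 else 1

/-- For `z ≠ -1`, clearing `1 + z` turns `1 ± θκ` into `(1 ± θ) + (1 ∓ θ)z`. For `z = -1`, `kappa`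
is `0` and the sign `-1` accounts for the ratio of the two linear expressions. -/
theorem cayley_cross_mul (θ z : ℂ) :
    cayleySign z * (1 - θ * kappa z) * ((1 + θ) + (1 - θ) * z) =
      (1 + θ * kappa z) * ((1 - θ) + (1 + θ) * z) := by
  by_cases hz : z = -1
  · subst hz
    simp [cayleySign, kappa]
  · have h : (1 + z) ≠ 0 := fun h => hz (by linear_combination h)
    rw [cayleySign, if_neg hz, kappa]
    field_simp
    ring

/-- On the unit circle `kappa z` is purely imaginary, so the cross term vanishes. -/
theorem normSq_one_add_mul_kappa (θ : ℝ) {z : ℂ} (hz : ‖z‖ = 1) :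
    Complex.normSq (1 + θ * kappa z) = cayleyWeight θ z := by
  obtain ⟨φ, -, rfl⟩ := exists_phase hz
  rw [cayleyWeight_exp, kappa_exp]
  generalize Real.tan (φ / 2) = t
  rw [Complex.normSq_apply]
  simp
  ring

theorem one_add_mul_kappa_ne_zero (θ : ℝ) {z : ℂ} (hz : ‖z‖ = 1) : 1 + θ * kappa z ≠ 0 := by
  rw [← Complex.normSq_pos, normSq_one_add_mul_kappa θ hz]
  exact cayleyWeight_pos θ z

theorem cayley_den_ne_zero {θ : ℝ} {z : ℂ} (hz : ‖z‖ = 1) (h : z = -1 → θ ≠ 0) :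
    (1 + θ : ℂ) + (1 - θ) * z ≠ 0 := by
  by_cases h1 : z = -1
  · have h2 : (θ : ℂ) ≠ 0 := by exact_mod_cast h h1
    subst h1
    intro h3
    exact h2 (by linear_combination h3 / 2)
  · have h2 : (1 + z) ≠ 0 := fun h => h1 (by linear_combination h)
    have : (1 + θ : ℂ) + (1 - θ) * z = (1 + z) * (1 + θ * kappa z) := by
      rw [kappa]
      field_simp
      ring
    rw [this]
    exact mul_ne_zero h2 (one_add_mul_kappa_ne_zero θ hz)

/-- The value at `θ` of the Cayley path through a phase `z`. -/
def cayleyPhase (θ : ℝ) (z : ℂ) : ℂ := cayleySign z * (1 - θ * kappa z) / (1 + θ * kappa z)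

theorem cayleyPhase_mul {θ : ℝ} {z : ℂ} (hz : ‖z‖ = 1) :
    cayleyPhase θ z * ((1 + θ) + (1 - θ) * z) = (1 - θ) + (1 + θ) * z := by
  rw [cayleyPhase, div_mul_eq_mul_div, cayley_cross_mul,
    mul_div_cancel_left₀ _ (one_add_mul_kappa_ne_zero θ hz)]

/-- Identifies the Cayley path without computing an inverse: both cases verify the product relation
eigenvalue by eigenvalue. -/
theorem cayleyF_eq_of_mul_eq {m 𝕜 : Type*} [Fintype m] [DecidableEq m] [RCLike 𝕜] {θ : ℝ}
    {g F : Matrix m m 𝕜} (hF : F * ((1 + θ) • (1 : Matrix m m 𝕜) + (1 - θ) • g) =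
      (1 - θ) • (1 : Matrix m m 𝕜) + (1 + θ) • g)
    (hu : IsUnit ((1 + θ) • (1 : Matrix m m 𝕜) + (1 - θ) • g)) : cayleyF θ g = F := by
  rw [cayleyF, ← hF, Matrix.mul_assoc, Matrix.mul_nonsing_inv _ ((isUnit_iff_isUnit_det _).1 hu),
    Matrix.mul_one]

/-! ### Diagonalization of unitary matrices -/

theorem exists_unit_not_root {p : Polynomial ℂ} (hp : p ≠ 0) : ∃ c : ℂ, ‖c‖ = 1 ∧ p.eval c ≠ 0 := by
  have hinj : Set.InjOn (fun φ : ℝ => Complex.exp (φ * Complex.I))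
      (Set.Ioc (-Real.pi) Real.pi) := by
    intro a ha b hb hab
    have h2 := congrArg Complex.arg hab
    simp only at h2
    have h' : ∀ φ ∈ Set.Ioc (-Real.pi) Real.pi,
        φ ∈ Set.Ioc (-Real.pi) (-Real.pi + 2 * Real.pi) := fun φ h => ⟨h.1, by linarith [h.2]⟩
    rwa [Complex.arg_exp_mul_I, Complex.arg_exp_mul_I, (toIocMod_eq_self _).2 (h' a ha),
      (toIocMod_eq_self _).2 (h' b hb)] at h2
  have hinf := (Set.Ioc_infinite (by linarith [Real.pi_pos] : -Real.pi < Real.pi)).image hinj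
  obtain ⟨c, ⟨φ, -, rfl⟩, hc⟩ := hinf.exists_notMem_finset p.roots.toFinset
  refine ⟨_, Complex.norm_exp_ofReal_mul_I φ, fun h => hc ?_⟩
  rw [Multiset.mem_toFinset, Polynomial.mem_roots hp]
  exact h

/-- Reduction to the Hermitian spectral theorem by a Cayley transform based at a unit number `c`
that is not an eigenvalue: `H = i (c + G)(c - G)⁻¹` is Hermitian, and `G` is recovered as `c - 2ic
(H + i)⁻¹`. -/
theorem exists_unitary_diagonalization {ι : Type*} [Fintype ι] [DecidableEq ι]
    (g : Matrix.unitaryGroup ι ℂ) :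
    ∃ (U : Matrix.unitaryGroup ι ℂ) (z : ι → ℂ), (∀ i, ‖z i‖ = 1) ∧
      (g : Matrix ι ι ℂ) = U * diagonal z * (U : Matrix ι ι ℂ)ᴴ := by
  obtain ⟨G, hG⟩ := g
  obtain ⟨c, hc1, hc⟩ := exists_unit_not_root G.charpoly_monic.ne_zero
  rw [eval_charpoly] at hc
  have hGG : Gᴴ * G = 1 := (Unitary.mem_iff.1 hG).1
  set N : Matrix ι ι ℂ := c • 1 - G with hN
  have hNu : IsUnit N := by
    rw [isUnit_iff_isUnit_det, hN, smul_one_eq_diagonal]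
    exact isUnit_iff_ne_zero.2 hc
  have hcc : starRingEnd ℂ c * c = 1 := by
    rw [← Complex.normSq_eq_conj_mul_self, Complex.normSq_eq_norm_sq, hc1]
    simp
  have hc0 : c ≠ 0 := fun h => by simp [h] at hc1
  set H : Matrix ι ι ℂ := Complex.I • ((c • 1 + G) * N⁻¹) with hH
  have hHN : H * N = Complex.I • (c • 1 + G) := by
    rw [hH, smul_mul_assoc, Matrix.mul_assoc,
      Matrix.nonsing_inv_mul _ ((isUnit_iff_isUnit_det _).1 hNu), Matrix.mul_one]
  have hherm : H.IsHermitian := by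
    -- Hermiticity is tested on `Nᴴ H N`, where the inverse has disappeared; `N` is invertible and
    -- can be cancelled afterwards.
    have h1 : Nᴴ * (H * N) = Complex.I • ((starRingEnd ℂ c) • G - c • Gᴴ) := by
      rw [hHN, hN]
      simp only [conjTranspose_sub, conjTranspose_smul, conjTranspose_one, Matrix.mul_smul,
        Matrix.mul_add, Matrix.sub_mul, Matrix.smul_mul, Matrix.mul_one, Matrix.one_mul, hGG,
        ← starRingEnd_apply, smul_sub, smul_smul, smul_add]
      simp only [mul_assoc, hcc, mul_comm c, mul_one]
      abel
    have h2 : (Nᴴ * (H * N))ᴴ = Nᴴ * (H * N) := by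
      rw [h1]
      simp only [conjTranspose_smul, conjTranspose_sub, conjTranspose_conjTranspose,
        ← starRingEnd_apply, Complex.conj_I, Complex.conj_conj]
      module
    rw [conjTranspose_mul, conjTranspose_mul, conjTranspose_conjTranspose, Matrix.mul_assoc] at h2
    exact hNu.mul_right_cancel (hNu.star.mul_left_cancel h2)
  obtain ⟨U, lam, hU⟩ : ∃ (U : Matrix.unitaryGroup ι ℂ) (lam : ι → ℝ),
      H = U * diagonal (fun i => (lam i : ℂ)) * (U : Matrix ι ι ℂ)ᴴ :=
    ⟨hherm.eigenvectorUnitary, hherm.eigenvalues, hherm.spectral_theorem⟩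
  have hUU : (U : Matrix ι ι ℂ) * (U : Matrix ι ι ℂ)ᴴ = 1 := Unitary.coe_mul_star_self U
  have hUU' : (U : Matrix ι ι ℂ)ᴴ * (U : Matrix ι ι ℂ) = 1 := Unitary.coe_star_mul_self U
  have hne : ∀ i, (lam i : ℂ) + Complex.I ≠ 0 := fun i h => by
    simpa using congrArg Complex.im h
  have hI2 : (2 * Complex.I * c) ≠ 0 := by simp [hc0]
  have hK : (H + Complex.I • 1) * N = (2 * Complex.I * c) • 1 := by
    rw [Matrix.add_mul, hHN, hN, Matrix.smul_mul, Matrix.one_mul]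
    module
  have hK' : N * (H + Complex.I • 1) = (2 * Complex.I * c) • 1 := by
    have h1 : (((2 * Complex.I * c)⁻¹ • (H + Complex.I • 1)) * N) = 1 := by
      rw [Matrix.smul_mul, hK, smul_smul, inv_mul_cancel₀ hI2, one_smul]
    have h2 := mul_eq_one_comm.1 h1
    rw [Matrix.mul_smul] at h2
    rw [← smul_right_injective _ (inv_ne_zero hI2) |>.eq_iff, smul_smul, inv_mul_cancel₀ hI2,
      one_smul, h2]
  have hdiag : (H + Complex.I • 1) *
      ((U : Matrix ι ι ℂ) * diagonal (fun i => ((lam i : ℂ) + Complex.I)⁻¹) *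
        (U : Matrix ι ι ℂ)ᴴ) = 1 := by
    have h1 : H + Complex.I • 1 = U * diagonal (fun i => (lam i : ℂ) + Complex.I) *
        (U : Matrix ι ι ℂ)ᴴ := by
      have : diagonal (fun i => (lam i : ℂ) + Complex.I) =
          diagonal (fun i => (lam i : ℂ)) + Complex.I • (1 : Matrix ι ι ℂ) := by
        rw [smul_one_eq_diagonal, diagonal_add]
      rw [this, Matrix.mul_add, Matrix.add_mul, ← hU, Matrix.mul_smul, Matrix.smul_mul,
        Matrix.mul_one, hUU]
    rw [h1]
    calc _ = (U : Matrix ι ι ℂ) * (diagonal (fun i => (lam i : ℂ) + Complex.I) *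
          ((U : Matrix ι ι ℂ)ᴴ * U) * diagonal (fun i => ((lam i : ℂ) + Complex.I)⁻¹)) *
          (U : Matrix ι ι ℂ)ᴴ := by simp only [Matrix.mul_assoc]
      _ = 1 := by
        rw [hUU', Matrix.mul_one, diagonal_mul_diagonal]
        simp [hne, hUU]
  have hNe : N = (2 * Complex.I * c) •
      ((U : Matrix ι ι ℂ) * diagonal (fun i => ((lam i : ℂ) + Complex.I)⁻¹) *
        (U : Matrix ι ι ℂ)ᴴ) := by
    rw [← Matrix.mul_one N, ← hdiag, ← Matrix.mul_assoc, hK', Matrix.smul_mul, Matrix.one_mul]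
  refine ⟨U, fun i => c - 2 * Complex.I * c * ((lam i : ℂ) + Complex.I)⁻¹, fun i => ?_, ?_⟩
  -- The eigenvalue is `c (λ - i) / (λ + i)`, a quotient of conjugates times a unit number.
  · have : c - 2 * Complex.I * c * ((lam i : ℂ) + Complex.I)⁻¹ =
        c * (starRingEnd ℂ ((lam i : ℂ) + Complex.I) / ((lam i : ℂ) + Complex.I)) := by
      have := hne i
      field_simp
      simp
      ring
    simp only [this]
    rw [norm_mul, hc1, norm_div, RCLike.norm_conj, div_self (norm_ne_zero_iff.2 (hne i)),
      one_mul]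
  · have h1 : diagonal (fun i => c - 2 * Complex.I * c * ((lam i : ℂ) + Complex.I)⁻¹) =
        c • (1 : Matrix ι ι ℂ) -
          (2 * Complex.I * c) • diagonal (fun i => ((lam i : ℂ) + Complex.I)⁻¹) := by
      rw [smul_one_eq_diagonal, ← diagonal_smul, diagonal_sub]
      rfl
    rw [h1, Matrix.mul_sub, Matrix.sub_mul, Matrix.mul_smul, Matrix.smul_mul, Matrix.mul_smul,
      Matrix.smul_mul, ← hNe, Matrix.mul_one, hUU, hN]
    abel

/-! ### Families with the same product of linear factors. -/

/-- The prescribed phases and the eigenvalues found by diagonalization agree only up to order.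
Comparing roots of the characteristic polynomial transfers symmetric products and pointwise
properties between the two lists. -/
theorem map_eq_of_prod_X_sub_C_eq {R ι : Type*} [CommRing R] [IsDomain R] [Fintype ι]
    {z w : ι → R} (h : ∏ j, (Polynomial.X - Polynomial.C (z j)) =
      ∏ j, (Polynomial.X - Polynomial.C (w j))) :
    Finset.univ.val.map z = Finset.univ.val.map w := by
  have key : ∀ z : ι → R, (∏ j, (Polynomial.X - Polynomial.C (z j))).roots =
      Finset.univ.val.map z := by
    intro z
    rw [← Polynomial.roots_multiset_prod_X_sub_C (Finset.univ.val.map z), Multiset.map_map]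
    rfl
  rw [← key z, ← key w, h]

theorem prod_eq_of_prod_X_sub_C_eq {R ι M : Type*} [CommRing R] [IsDomain R] [Fintype ι]
    [CommMonoid M] {z w : ι → R} (h : ∏ j, (Polynomial.X - Polynomial.C (z j)) =
      ∏ j, (Polynomial.X - Polynomial.C (w j))) (f : R → M) : ∏ j, f (z j) = ∏ j, f (w j) := by
  have := congrArg (fun s => (Multiset.map f s).prod) (map_eq_of_prod_X_sub_C_eq h)
  simpa [Multiset.map_map] using this

theorem forall_of_prod_X_sub_C_eq {R ι : Type*} [CommRing R] [IsDomain R] [Fintype ι]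
    {z w : ι → R} (h : ∏ j, (Polynomial.X - Polynomial.C (z j)) =
      ∏ j, (Polynomial.X - Polynomial.C (w j))) {p : R → Prop} (hw : ∀ j, p (w j)) (j : ι) :
    p (z j) := by
  have : z j ∈ Finset.univ.val.map w := by
    rw [← map_eq_of_prod_X_sub_C_eq h]
    exact Multiset.mem_map_of_mem z (Finset.mem_univ j)
  obtain ⟨k, -, hk⟩ := Multiset.mem_map.1 this
  exact hk ▸ hw k

end FLO
end

noncomputable section
namespace FLO

/-! ### Amplitudes of passive circuits -/

theorem tensorPow_smul {d : ℕ} (n : ℕ) (c : ℂ) (U : Matrix (Fin d) (Fin d) ℂ) :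
    tensorPow n (c • U) = c ^ n • tensorPow n U := by
  ext a b
  simp [tensorPow, Finset.prod_mul_distrib]

/-- The amplitude `⟨x|U^{⊗ n}|Ψ⟩`, when the entries of `U` are polynomials. -/
def tensorAmplitude {d n : ℕ} (x Ψ : (Fin n → Fin d) → ℂ)
    (M : Matrix (Fin d) (Fin d) (Polynomial ℂ)) : Polynomial ℂ :=
  ∑ a, ∑ b, Polynomial.C (star (x a) * Ψ b) * ∏ k, M (a k) (b k)

theorem tensorAmplitude_eval {d n : ℕ} (x Ψ : (Fin n → Fin d) → ℂ)
    (M : Matrix (Fin d) (Fin d) (Polynomial ℂ)) (θ : ℂ) :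
    (tensorAmplitude x Ψ M).eval θ =
      star x ⬝ᵥ tensorPow n (M.map (Polynomial.eval θ)) *ᵥ Ψ := by
  simp only [tensorAmplitude, Polynomial.eval_finsetSum, Polynomial.eval_mul, Polynomial.eval_C,
    Polynomial.eval_prod, dotProduct, mulVec, tensorPow, Finset.mul_sum, Matrix.of_apply,
    Matrix.map_apply, Pi.star_apply]
  exact Finset.sum_congr rfl fun a _ => Finset.sum_congr rfl fun b _ => by ring

theorem natDegree_tensorAmplitude_le {d n k : ℕ} (x Ψ : (Fin n → Fin d) → ℂ)
    {M : Matrix (Fin d) (Fin d) (Polynomial ℂ)} (hM : ∀ a b, (M a b).natDegree ≤ k) :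
    (tensorAmplitude x Ψ M).natDegree ≤ k * n := by
  refine Polynomial.natDegree_sum_le_of_forall_le _ _ fun a _ =>
    Polynomial.natDegree_sum_le_of_forall_le _ _ fun b _ =>
      (Polynomial.natDegree_C_mul_le _ _).trans ((Polynomial.natDegree_prod_le _ _).trans ?_)
  exact (Finset.sum_le_card_nsmul _ _ k fun i _ => hM _ _).trans (by simp [mul_comm])

/-- The amplitude is homogeneous of degree `n` in the entries, so its coefficient at the maximal
possible degree is the amplitude of the matrix of top coefficients. -/
theorem tensorAmplitude_coeff {d n k : ℕ} (x Ψ : (Fin n → Fin d) → ℂ)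
    {M : Matrix (Fin d) (Fin d) (Polynomial ℂ)} (hM : ∀ a b, (M a b).natDegree ≤ k) :
    (tensorAmplitude x Ψ M).coeff (k * n) =
      star x ⬝ᵥ tensorPow n (M.map fun p => p.coeff k) *ᵥ Ψ := by
  have h : ∀ a b : Fin n → Fin d, (∏ i, M (a i) (b i)).coeff (k * n) =
      ∏ i, (M (a i) (b i)).coeff k := by
    intro a b
    have := Polynomial.coeff_prod_of_natDegree_le Finset.univ (fun i => M (a i) (b i)) k
      fun i _ => hM _ _
    rwa [Finset.card_univ, Fintype.card_fin, mul_comm] at this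
  simp only [tensorAmplitude, Polynomial.finsetSum_coeff, Polynomial.coeff_C_mul, h, dotProduct,
    mulVec, tensorPow, Finset.mul_sum, Matrix.of_apply, Matrix.map_apply, Pi.star_apply]
  exact Finset.sum_congr rfl fun a _ => Finset.sum_congr rfl fun b _ => by ring

/-- The numerator, over the common denominator, of the Cayley path through the phase `z l`. -/
def cayleyNumerator {d : ℕ} (z : Fin d → ℂ) (l : Fin d) : Polynomial ℂ :=
  (Polynomial.C (cayleySign (z l)) * (1 - Polynomial.X * Polynomial.C (kappa (z l)))) *
    ∏ j ∈ Finset.univ.erase l, (1 + Polynomial.X * Polynomial.C (kappa (z j)))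

theorem cayleyNumerator_eval {d : ℕ} {z : Fin d → ℂ} (hz : ∀ j, ‖z j‖ = 1) (l : Fin d) (θ : ℝ) :
    (cayleyNumerator z l).eval (θ : ℂ) =
      (∏ j, (1 + θ * kappa (z j))) * cayleyPhase θ (z l) := by
  rw [cayleyNumerator, ← Finset.mul_prod_erase _ _ (Finset.mem_univ l), cayleyPhase]
  have := one_add_mul_kappa_ne_zero θ (hz l)
  simp only [Polynomial.eval_mul, Polynomial.eval_C, Polynomial.eval_prod, Polynomial.eval_add,
    Polynomial.eval_sub, Polynomial.eval_one, Polynomial.eval_X]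
  field_simp

theorem natDegree_one_add_X_mul_C_le (c : ℂ) :
    (1 + Polynomial.X * Polynomial.C c).natDegree ≤ 1 := by
  compute_degree

theorem natDegree_cayleyNumerator_le {d : ℕ} (z : Fin d → ℂ) (l : Fin d) :
    (cayleyNumerator z l).natDegree ≤ d := by
  have h1 : (Polynomial.C (cayleySign (z l)) *
      (1 - Polynomial.X * Polynomial.C (kappa (z l)))).natDegree ≤ 1 := by
    compute_degree
  have h2 : (∏ j ∈ Finset.univ.erase l,
      (1 + Polynomial.X * Polynomial.C (kappa (z j)))).natDegree ≤ d - 1 :=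
    (Polynomial.natDegree_prod_le _ _).trans ((Finset.sum_le_card_nsmul _ _ 1 fun j _ =>
      natDegree_one_add_X_mul_C_le _).trans (by simp))
  refine (Polynomial.natDegree_mul_le_of_le h1 h2).trans ?_
  have := l.pos
  omega

/-- The value does not depend on `l`: the factor of index `l` contributes `-κ_l` and every other one
`κ_j`. Hence the matrix of leading coefficients is a scalar multiple of `A * B`, the algebraic form
of `F_θ(g) → -1` at infinity. -/
theorem cayleyNumerator_coeff {d : ℕ} {z : Fin d → ℂ} {l : Fin d} (hl : z l ≠ -1) :
    (cayleyNumerator z l).coeff d = -∏ j, kappa (z j) := by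
  have h1 : (Polynomial.C (cayleySign (z l)) *
      (1 - Polynomial.X * Polynomial.C (kappa (z l)))).natDegree ≤ 1 := by
    compute_degree
  have h2 : (∏ j ∈ Finset.univ.erase l,
      (1 + Polynomial.X * Polynomial.C (kappa (z j)))).natDegree ≤ d - 1 :=
    (Polynomial.natDegree_prod_le _ _).trans ((Finset.sum_le_card_nsmul _ _ 1 fun j _ =>
      natDegree_one_add_X_mul_C_le _).trans (by simp))
  have h3 := Polynomial.coeff_prod_of_natDegree_le (Finset.univ.erase l)
    (fun j => 1 + Polynomial.X * Polynomial.C (kappa (z j))) 1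
    fun j _ => natDegree_one_add_X_mul_C_le _
  have hd : 1 + (d - 1) = d := by
    have := l.pos
    omega
  rw [mul_one, Finset.card_erase_of_mem (Finset.mem_univ l), Finset.card_univ,
    Fintype.card_fin] at h3
  have h4 := Polynomial.coeff_mul_add_eq_of_natDegree_le h1 h2
  rw [hd, h3] at h4
  rw [cayleyNumerator, h4, ← Finset.mul_prod_erase _ _ (Finset.mem_univ l)]
  simp [Polynomial.coeff_one, cayleySign, hl]

/-- The entries of `A diag(F_θ(z)) B`, multiplied by the common denominator. -/
def cayleyNumeratorMatrix {d : ℕ} (A B : Matrix (Fin d) (Fin d) ℂ) (z : Fin d → ℂ) :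
    Matrix (Fin d) (Fin d) (Polynomial ℂ) :=
  Matrix.of fun a b => ∑ l, Polynomial.C (A a l * B l b) * cayleyNumerator z l

theorem cayleyNumeratorMatrix_map_eval {d : ℕ} (A B : Matrix (Fin d) (Fin d) ℂ) {z : Fin d → ℂ}
    (hz : ∀ j, ‖z j‖ = 1) (θ : ℝ) :
    (cayleyNumeratorMatrix A B z).map (Polynomial.eval (θ : ℂ)) =
      (∏ j, (1 + θ * kappa (z j))) • (A * diagonal (fun j => cayleyPhase θ (z j)) * B) := by
  ext a b
  simp only [cayleyNumeratorMatrix, Matrix.map_apply, Matrix.of_apply, Polynomial.eval_finsetSum,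
    Polynomial.eval_mul, Polynomial.eval_C, cayleyNumerator_eval hz, Matrix.smul_apply, smul_eq_mul,
    Matrix.mul_apply (N := B), mul_diagonal, Finset.mul_sum]
  exact Finset.sum_congr rfl fun l _ => by ring

theorem natDegree_cayleyNumeratorMatrix_le {d : ℕ} (A B : Matrix (Fin d) (Fin d) ℂ) (z : Fin d → ℂ)
    (a b : Fin d) : (cayleyNumeratorMatrix A B z a b).natDegree ≤ d := by
  rw [cayleyNumeratorMatrix, Matrix.of_apply]
  exact Polynomial.natDegree_sum_le_of_forall_le _ _ fun l _ =>
    (Polynomial.natDegree_C_mul_le _ _).trans (natDegree_cayleyNumerator_le z l)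

theorem cayleyNumeratorMatrix_map_coeff {d : ℕ} (A B : Matrix (Fin d) (Fin d) ℂ) {z : Fin d → ℂ}
    (hz : ∀ j, z j ≠ -1) :
    (cayleyNumeratorMatrix A B z).map (fun p => p.coeff d) =
      (-∏ j, kappa (z j)) • (A * B) := by
  ext a b
  simp only [cayleyNumeratorMatrix, Matrix.map_apply, Matrix.of_apply, Polynomial.finsetSum_coeff,
    Polynomial.coeff_C_mul, cayleyNumerator_coeff (hz _), Matrix.smul_apply, smul_eq_mul,
    Matrix.mul_apply, Finset.mul_sum]
  exact Finset.sum_congr rfl fun l _ => by ring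

theorem smul_one_add_smul_conj_diagonal {d : ℕ} (U : Matrix.unitaryGroup (Fin d) ℂ)
    (z : Fin d → ℂ) (a b : ℝ) : a • (1 : Matrix (Fin d) (Fin d) ℂ) +
      b • ((U : Matrix (Fin d) (Fin d) ℂ) * diagonal z * (U : Matrix (Fin d) (Fin d) ℂ)ᴴ) =
      U * diagonal (fun j => (a : ℂ) + b * z j) * (U : Matrix (Fin d) (Fin d) ℂ)ᴴ := by
  have hUU : (U : Matrix (Fin d) (Fin d) ℂ) * (U : Matrix (Fin d) (Fin d) ℂ)ᴴ = 1 :=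
    Unitary.coe_mul_star_self U
  have : diagonal (fun j => (a : ℂ) + b * z j) =
      a • (1 : Matrix (Fin d) (Fin d) ℂ) + b • diagonal z := by
    ext i j
    by_cases h : i = j <;> simp [h]
  rw [this, Matrix.mul_add, Matrix.add_mul, Matrix.mul_smul, Matrix.mul_smul, Matrix.smul_mul,
    Matrix.smul_mul, Matrix.mul_one, hUU]

theorem cayleyF_unitary {d : ℕ} {U : Matrix.unitaryGroup (Fin d) ℂ} {z : Fin d → ℂ}
    (hz : ∀ j, ‖z j‖ = 1) {θ : ℝ} (hθ : ∀ j, z j = -1 → θ ≠ 0) :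
    cayleyF θ ((U : Matrix (Fin d) (Fin d) ℂ) * diagonal z * (U : Matrix (Fin d) (Fin d) ℂ)ᴴ) =
      U * diagonal (fun j => cayleyPhase θ (z j)) * (U : Matrix (Fin d) (Fin d) ℂ)ᴴ := by
  have hUU : (U : Matrix (Fin d) (Fin d) ℂ) * (U : Matrix (Fin d) (Fin d) ℂ)ᴴ = 1 :=
    Unitary.coe_mul_star_self U
  have hUU' : (U : Matrix (Fin d) (Fin d) ℂ)ᴴ * (U : Matrix (Fin d) (Fin d) ℂ) = 1 :=
    Unitary.coe_star_mul_self U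
  have hlin := smul_one_add_smul_conj_diagonal U z
  have hmul : ∀ v w : Fin d → ℂ,
      ((U : Matrix (Fin d) (Fin d) ℂ) * diagonal v * (U : Matrix (Fin d) (Fin d) ℂ)ᴴ) *
      ((U : Matrix (Fin d) (Fin d) ℂ) * diagonal w * (U : Matrix (Fin d) (Fin d) ℂ)ᴴ) =
      U * diagonal (fun j => v j * w j) * (U : Matrix (Fin d) (Fin d) ℂ)ᴴ := by
    intro v w
    calc _ = (U : Matrix (Fin d) (Fin d) ℂ) * (diagonal v *
          ((U : Matrix (Fin d) (Fin d) ℂ)ᴴ * U) * diagonal w) *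
          (U : Matrix (Fin d) (Fin d) ℂ)ᴴ := by simp only [Matrix.mul_assoc]
      _ = _ := by rw [hUU', Matrix.mul_one, diagonal_mul_diagonal]
  have hne : ∀ j, (1 + θ : ℂ) + (1 - θ) * z j ≠ 0 := fun j => cayley_den_ne_zero (hz j) (hθ j)
  refine cayleyF_eq_of_mul_eq ?_ ?_
  · rw [hlin, hlin, hmul]
    push_cast
    simp only [cayleyPhase_mul (hz _)]
  · rw [hlin]
    refine IsUnit.of_mul_eq_one (U * diagonal (fun j => ((1 + θ : ℂ) + (1 - θ) * z j)⁻¹) *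
      (U : Matrix (Fin d) (Fin d) ℂ)ᴴ) ?_
    rw [hmul]
    push_cast
    simp [hne, hUU]

theorem exists_isPhasesU {d : ℕ} (g : Matrix.unitaryGroup (Fin d) ℂ) :
    ∃ φ : Fin d → ℝ, IsPhasesU (g : Matrix (Fin d) (Fin d) ℂ) φ := by
  obtain ⟨U, z, hz, hg⟩ := exists_unitary_diagonalization g
  choose φ hφ hφz using fun j => exists_phase (hz j)
  refine ⟨φ, hφ, ?_⟩
  have hUU' : (U : Matrix (Fin d) (Fin d) ℂ)ᴴ * (U : Matrix (Fin d) (Fin d) ℂ) = 1 :=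
    Unitary.coe_star_mul_self U
  rw [hg, charpoly_mul_comm, ← Matrix.mul_assoc, hUU', Matrix.one_mul, charpoly_diagonal]
  exact Finset.prod_congr rfl fun j _ => by rw [hφz]

/-- `D` is the squared modulus of the amplitude of `(∏ (1 + θκ_j)) g_θ`; the scalar enters the
probability as `|∏ (1 + θκ_j)|^{2n}`, which is the denominator. -/
theorem exists_polynomial_outcomeProb_passive {d n : ℕ} {g : Matrix.unitaryGroup (Fin d) ℂ}
    {φ : Fin d → ℝ} (hφ : IsPhasesU (g : Matrix (Fin d) (Fin d) ℂ) φ)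
    (g₀ : Matrix (Fin d) (Fin d) ℂ) (x Ψ : (Fin n → Fin d) → ℂ) :
    ∃ D : Polynomial ℝ,
      D.natDegree ≤ 2 * d * n ∧
      ((∀ j, φ j ≠ 0 ∧ φ j ≠ Real.pi) → D.eval 0 ≠ 0 → D.natDegree = 2 * d * n) ∧
      ∀ θ : ℝ, (θ = 0 → ∀ j, φ j ≠ Real.pi) →
        outcomeProb x Ψ (tensorPow n (g₀ * cayleyF θ (g : Matrix (Fin d) (Fin d) ℂ))) =
          ((D.eval θ / (denominator φ n).eval θ : ℝ) : ℂ) := by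
  obtain ⟨U, z, hz, hg⟩ := exists_unitary_diagonalization g
  have hUU : (U : Matrix (Fin d) (Fin d) ℂ) * (U : Matrix (Fin d) (Fin d) ℂ)ᴴ = 1 :=
    Unitary.coe_mul_star_self U
  have hUU' : (U : Matrix (Fin d) (Fin d) ℂ)ᴴ * (U : Matrix (Fin d) (Fin d) ℂ) = 1 :=
    Unitary.coe_star_mul_self U
  have hchar : ∏ j, (Polynomial.X - Polynomial.C (z j)) =
      ∏ j, (Polynomial.X - Polynomial.C (Complex.exp (φ j * Complex.I))) := by
    rw [← hφ.2, hg, charpoly_mul_comm, ← Matrix.mul_assoc, hUU', Matrix.one_mul, charpoly_diagonal]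
  set M := cayleyNumeratorMatrix (g₀ * (U : Matrix (Fin d) (Fin d) ℂ)) (U : Matrix (Fin d) (Fin d) ℂ)ᴴ z with hM
  have hMd : ∀ a b, (M a b).natDegree ≤ d := natDegree_cayleyNumeratorMatrix_le _ _ _
  obtain ⟨D, hD, hDc, hDe⟩ := exists_normSq_polynomial (tensorAmplitude x Ψ M)
    (natDegree_tensorAmplitude_le x Ψ hMd)
  rw [← mul_assoc] at hD hDc
  refine ⟨D, hD, fun h h0 => ?_, fun θ hθ => ?_⟩
  · refine le_antisymm hD (Polynomial.le_natDegree_of_ne_zero ?_)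
    have h1 : ∀ j, z j ≠ -1 := forall_of_prod_X_sub_C_eq hchar (p := fun z => z ≠ -1)
      fun j => (exp_phase_eq_neg_one_iff (hφ.1 j)).not.2 (h j).2
    have h2 : ∀ j, kappa (z j) ≠ 0 := fun j =>
      forall_of_prod_X_sub_C_eq hchar (p := fun z => kappa z ≠ 0) (fun j => by
        rw [kappa_exp]
        exact neg_ne_zero.2 (mul_ne_zero Complex.I_ne_zero
          (Complex.ofReal_ne_zero.2 (tan_half_ne_zero (hφ.1 j) (h j).1 (h j).2)))) j
    -- At `θ = 0` all Cayley phases are `1`, so the path starts at `g₀`.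
    have h3 : tensorPow n (M.map (Polynomial.eval ((0 : ℝ) : ℂ))) = tensorPow n g₀ := by
      rw [hM, cayleyNumeratorMatrix_map_eval _ _ hz]
      simp [cayleyPhase, cayleySign, h1, Matrix.mul_assoc, hUU]
    rw [hDe, tensorAmplitude_eval, h3] at h0
    -- The top coefficient of the amplitude is `(-∏ κ_j)^n` times the amplitude of `g₀`, which is
    -- the amplitude at `θ = 0`.
    rw [hDc, tensorAmplitude_coeff x Ψ hMd, hM, cayleyNumeratorMatrix_map_coeff _ _ h1,
      Matrix.mul_assoc, hUU, Matrix.mul_one, tensorPow_smul, smul_mulVec, dotProduct_smul,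
      smul_eq_mul, Complex.normSq_mul]
    refine mul_ne_zero ?_ h0
    rw [Ne, Complex.normSq_eq_zero]
    exact pow_ne_zero _ (neg_ne_zero.2 (Finset.prod_ne_zero_iff.2 fun j _ => h2 j))
  · have h1 : ∀ j, z j = -1 → θ ≠ 0 := fun j hj hθ0 =>
      forall_of_prod_X_sub_C_eq hchar (p := fun z => z ≠ -1)
        (fun j => (exp_phase_eq_neg_one_iff (hφ.1 j)).not.2 (hθ hθ0 j)) j hj
    have hden : (denominator φ n).eval θ =
        Complex.normSq ((∏ j, (1 + θ * kappa (z j))) ^ n) := by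
      rw [denominator_eval, ← prod_eq_of_prod_X_sub_C_eq hchar (cayleyWeight θ), map_pow, map_prod]
      simp only [normSq_one_add_mul_kappa θ (hz _)]
    have hne : (∏ j, (1 + θ * kappa (z j))) ^ n ≠ 0 :=
      pow_ne_zero _ (Finset.prod_ne_zero_iff.2 fun j _ => one_add_mul_kappa_ne_zero θ (hz j))
    rw [outcomeProb_eq_normSq, hDe, hden, tensorAmplitude_eval, hM,
      cayleyNumeratorMatrix_map_eval _ _ hz, tensorPow_smul, smul_mulVec, dotProduct_smul,
      smul_eq_mul, Complex.normSq_mul,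
      mul_div_cancel_left₀ _ ((Complex.normSq_pos.2 hne).ne'), hg, cayleyF_unitary hz h1]
    simp only [Matrix.mul_assoc]

end FLO
end

noncomputable section
namespace FLO

/-! ### Majorana operators -/

/-- The Jordan–Wigner sign of mode `j` in the Fock state `Y`. -/
def fermionSign {d : ℕ} (j : Fin d) (Y : Finset (Fin d)) : ℂ :=
  (-1) ^ (Y.filter (fun i => i < j)).card

theorem fermionSign_mul_self {d : ℕ} (j : Fin d) (Y : Finset (Fin d)) :
    fermionSign j Y * fermionSign j Y = 1 := by
  rw [fermionSign, ← mul_pow]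
  simp

theorem star_fermionSign {d : ℕ} (j : Fin d) (Y : Finset (Fin d)) :
    star (fermionSign j Y) = fermionSign j Y := by
  simp [fermionSign]

theorem symmDiff_singleton_of_mem {α : Type*} [DecidableEq α] {j : α} {Y : Finset α} (h : j ∈ Y) :
    symmDiff Y {j} = Y.erase j := by
  ext i
  simp only [Finset.mem_symmDiff, Finset.mem_singleton, Finset.mem_erase]
  grind

theorem symmDiff_singleton_of_notMem {α : Type*} [DecidableEq α] {j : α} {Y : Finset α}
    (h : j ∉ Y) : symmDiff Y {j} = insert j Y := by
  ext i
  simp only [Finset.mem_symmDiff, Finset.mem_singleton, Finset.mem_insert]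
  grind

theorem fermionSign_insert {d : ℕ} {j k : Fin d} {Y : Finset (Fin d)} (h : k ∉ Y) :
    fermionSign j (insert k Y) = (if k < j then -1 else 1) * fermionSign j Y := by
  rw [fermionSign, fermionSign, Finset.filter_insert]
  split_ifs with hk
  · rw [Finset.card_insert_of_notMem (by simp [h]), pow_succ]
    ring
  · rw [one_mul]

/-- Only toggling a strictly earlier mode changes the parity of the count. This asymmetry in `j` and
`k` is the source of anticommutation between different modes. -/
theorem fermionSign_symmDiff {d : ℕ} (j k : Fin d) (Y : Finset (Fin d)) :
    fermionSign j (symmDiff Y {k}) = (if k < j then -1 else 1) * fermionSign j Y := by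
  by_cases h : k ∈ Y
  · have h1 := fermionSign_insert (j := j) (Finset.notMem_erase k Y)
    rw [Finset.insert_erase h] at h1
    rw [symmDiff_singleton_of_mem h, h1]
    split_ifs <;> simp
  · rw [symmDiff_singleton_of_notMem h, fermionSign_insert h]

/-- The mode to which a Majorana operator belongs. -/
def mode {d : ℕ} (k : Fin (2 * d)) : Fin d := ⟨k.val / 2, by omega⟩

/-- The nonzero entry in row `Y` of a Majorana operator. -/
def majoranaCoeff {d : ℕ} (k : Fin (2 * d)) (Y : Finset (Fin d)) : ℂ :=
  fermionSign (mode k) Y *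
    (if k.val % 2 = 0 then 1 else if mode k ∈ Y then Complex.I else -Complex.I)

/-- Creation contributes only to rows containing the mode and annihilation only to the others, so a
Majorana operator is a monomial matrix. All later identities in the Fock basis reduce to bookkeeping
of signs. -/
theorem majorana_apply {d : ℕ} (k : Fin (2 * d)) (Y Z : Finset (Fin d)) :
    majorana k Y Z = if Z = symmDiff Y {mode k} then majoranaCoeff k Y else 0 := by
  have hc : creation (mode k) Y Z =
      if mode k ∈ Y ∧ Z = symmDiff Y {mode k} then fermionSign (mode k) Y else 0 := by
    rw [creation, Matrix.of_apply]
    by_cases h : mode k ∈ Y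
    · rw [symmDiff_singleton_of_mem h]
      have : (mode k ∉ Z ∧ Y = insert (mode k) Z) ↔ (mode k ∈ Y ∧ Z = Y.erase (mode k)) := by
        constructor
        · rintro ⟨h1, rfl⟩
          exact ⟨h, (Finset.erase_insert h1).symm⟩
        · rintro ⟨-, rfl⟩
          exact ⟨Finset.notMem_erase _ _, (Finset.insert_erase h).symm⟩
      simp only [this]
      by_cases hZ : Z = Y.erase (mode k)
      · have h1 := fermionSign_symmDiff (mode k) (mode k) Y
        rw [symmDiff_singleton_of_mem h, if_neg (lt_irrefl _), one_mul] at h1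
        rw [if_pos ⟨h, hZ⟩, if_pos ⟨h, hZ⟩, ← h1, hZ]
        rfl
      · rw [if_neg (fun h1 => hZ h1.2), if_neg (fun h1 => hZ h1.2)]
    · rw [if_neg (by rintro ⟨-, rfl⟩; exact h (Finset.mem_insert_self _ _)),
        if_neg (fun h1 => h h1.1)]
  have ha : (creation (mode k))ᴴ Y Z =
      if mode k ∉ Y ∧ Z = symmDiff Y {mode k} then fermionSign (mode k) Y else 0 := by
    rw [conjTranspose_apply, creation, Matrix.of_apply]
    by_cases h : mode k ∈ Y
    · rw [if_neg (fun h1 => h1.1 h), if_neg (fun h1 => h1.1 h), star_zero]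
    · rw [symmDiff_singleton_of_notMem h]
      by_cases hZ : Z = insert (mode k) Y
      · rw [if_pos ⟨h, hZ⟩, if_pos ⟨h, hZ⟩]
        exact star_fermionSign _ _
      · rw [if_neg (fun h1 => hZ h1.2), if_neg (fun h1 => hZ h1.2), star_zero]
  change (if k.val % 2 = 0 then (creation (mode k))ᴴ + creation (mode k)
    else (-Complex.I) • ((creation (mode k))ᴴ - creation (mode k))) Y Z = _
  rw [majoranaCoeff]
  by_cases hk : k.val % 2 = 0
  · rw [if_pos hk, if_pos hk, Matrix.add_apply, ha, hc]
    by_cases hY : mode k ∈ Y <;> simp [hY]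
  · rw [if_neg hk, if_neg hk, Matrix.smul_apply, Matrix.sub_apply, ha, hc]
    by_cases hY : mode k ∈ Y <;> by_cases hZ : Z = symmDiff Y {mode k} <;>
      simp [hY, hZ, mul_comm]

theorem conjTranspose_majorana {d : ℕ} (k : Fin (2 * d)) : (majorana k)ᴴ = majorana k := by
  unfold majorana
  dsimp only
  split_ifs
  · rw [conjTranspose_add, conjTranspose_conjTranspose, add_comm]
  · rw [conjTranspose_smul, conjTranspose_sub, conjTranspose_conjTranspose,
      ← neg_sub ((creation _)ᴴ), smul_neg, ← neg_smul]
    simp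

theorem majorana_mul_apply {d : ℕ} (k : Fin (2 * d)) (M : FockOp d) (Y Z : Finset (Fin d)) :
    (majorana k * M) Y Z = majoranaCoeff k Y * M (symmDiff Y {mode k}) Z := by
  simp [Matrix.mul_apply, majorana_apply]

theorem mul_majorana_apply {d : ℕ} (k : Fin (2 * d)) (M : FockOp d) (Y Z : Finset (Fin d)) :
    (M * majorana k) Y Z = M Y (symmDiff Z {mode k}) * majoranaCoeff k (symmDiff Z {mode k}) := by
  have : ∀ W : Finset (Fin d), Z = symmDiff W {mode k} ↔ W = symmDiff Z {mode k} := by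
    intro W
    constructor <;> rintro rfl <;> simp
  simp [Matrix.mul_apply, majorana_apply, this]

theorem mem_symmDiff_singleton_self {α : Type*} [DecidableEq α] {j : α} {Y : Finset α} :
    j ∈ symmDiff Y {j} ↔ j ∉ Y := by
  simp [Finset.mem_symmDiff]

theorem majoranaCoeff_symmDiff_of_ne {d : ℕ} (k : Fin (2 * d)) {j : Fin d} (h : mode k ≠ j)
    (Y : Finset (Fin d)) :
    majoranaCoeff k (symmDiff Y {j}) = (if j < mode k then -1 else 1) * majoranaCoeff k Y := by
  have : mode k ∈ symmDiff Y {j} ↔ mode k ∈ Y := by simp [Finset.mem_symmDiff, h]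
  rw [majoranaCoeff, majoranaCoeff, fermionSign_symmDiff]
  simp only [this, mul_assoc]

/-- For different modes, exactly one of the two orders of toggling picks up a sign. Within one mode
the Jordan–Wigner signs square to `1`, and the factors `1`, `±i` decide. -/
theorem majorana_anticommute {d : ℕ} (k l : Fin (2 * d)) :
    majorana k * majorana l + majorana l * majorana k =
      if k = l then (2 : ℂ) • (1 : FockOp d) else 0 := by
  ext Y Z
  rw [Matrix.add_apply, majorana_mul_apply, majorana_mul_apply, majorana_apply, majorana_apply]
  by_cases hm : mode k = mode l
  · have hs : majoranaCoeff k Y * majoranaCoeff l (symmDiff Y {mode k}) +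
        majoranaCoeff l Y * majoranaCoeff k (symmDiff Y {mode l}) = if k = l then 2 else 0 := by
      simp only [majoranaCoeff, hm, fermionSign_symmDiff, mem_symmDiff_singleton_self, lt_irrefl,
        if_false, one_mul]
      have hs := fermionSign_mul_self (mode l) Y
      have hkl : k = l ↔ k.val % 2 = l.val % 2 := by
        have hv : k.val / 2 = l.val / 2 := congrArg Fin.val hm
        rw [Fin.ext_iff]
        omega
      have hI := Complex.I_mul_I
      by_cases hk : k.val % 2 = 0 <;> by_cases hl : l.val % 2 = 0
      · have heq : k = l := hkl.2 (by omega)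
        rw [if_pos heq]
        simp only [hk, hl, if_true]
        linear_combination 2 * hs
      · have hne : k ≠ l := fun h => hl (by rw [← hkl.1 h, hk])
        rw [if_neg hne]
        simp only [hk, hl, if_true, if_false]
        split_ifs <;> ring
      · have hne : k ≠ l := fun h => hk (by rw [hkl.1 h, hl])
        rw [if_neg hne]
        simp only [hk, hl, if_true, if_false]
        split_ifs <;> ring
      · have heq : k = l := hkl.2 (by omega)
        rw [if_pos heq]
        simp only [hk, hl, if_false]
        split_ifs <;>
          linear_combination (-2 * Complex.I * Complex.I) * hs - 2 * hI
    have hZ : symmDiff (symmDiff Y {mode l}) {mode l} = Y := by simp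
    rw [hm, hZ]
    rw [hm] at hs
    by_cases hYZ : Z = Y
    · subst hYZ
      rw [if_pos rfl, if_pos rfl, hs]
      split_ifs <;> simp
    · rw [if_neg hYZ, if_neg hYZ]
      split_ifs <;> simp [Ne.symm hYZ]
  · have hkl : k ≠ l := fun h => hm (by rw [h])
    rw [if_neg hkl, symmDiff_right_comm Y {mode l} {mode k},
      majoranaCoeff_symmDiff_of_ne l (Ne.symm hm), majoranaCoeff_symmDiff_of_ne k hm]
    rcases lt_or_gt_of_ne hm with h | h
    · rw [if_pos h, if_neg h.not_gt]
      split_ifs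
      · rw [Matrix.zero_apply]; ring
      · simp
    · rw [if_pos h, if_neg h.not_gt]
      split_ifs
      · rw [Matrix.zero_apply]; ring
      · simp

/-- The operator that is `±1` on the Fock states with an even or odd number of particles. -/
def parity (d : ℕ) : FockOp d := diagonal fun Y => (-1) ^ Y.card

theorem neg_one_pow_card_symmDiff {α : Type*} [DecidableEq α] (j : α) (Y : Finset α) :
    (-1 : ℂ) ^ (symmDiff Y {j}).card = -(-1) ^ Y.card := by
  by_cases h : j ∈ Y
  · rw [symmDiff_singleton_of_mem h, ← Finset.card_erase_add_one h, pow_succ]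
    ring
  · rw [symmDiff_singleton_of_notMem h, Finset.card_insert_of_notMem h, pow_succ]
    ring

theorem parity_mul_majorana {d : ℕ} (k : Fin (2 * d)) :
    parity d * majorana k = -(majorana k * parity d) := by
  ext Y Z
  rw [parity, diagonal_mul, Matrix.neg_apply, mul_diagonal, majorana_apply]
  split_ifs with h
  · rw [h, neg_one_pow_card_symmDiff]
    ring
  · simp

theorem parity_mul_parity (d : ℕ) : parity d * parity d = 1 := by
  rw [parity, diagonal_mul_diagonal]
  simp [← mul_pow]

theorem parity_mulVec {d : ℕ} {Ψ : Finset (Fin d) → ℂ} (h : Ψ ∈ evenFock d) :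
    parity d *ᵥ Ψ = Ψ := by
  ext Y
  rw [parity, mulVec_diagonal]
  by_cases hY : Even Y.card
  · rw [hY.neg_one_pow, one_mul]
  · rw [h Y hY, mul_zero]

/-- The Majorana operators act irreducibly on the Fock space. -/
theorem eq_smul_one_of_commute_majorana {d : ℕ} {T : FockOp d}
    (h : ∀ k, T * majorana k = majorana k * T) : ∃ c : ℂ, T = c • 1 := by
  have hm0 : ∀ j : Fin d, mode (d := d) ⟨2 * j, by omega⟩ = j := fun j => by
    ext; simp [mode]
  have hm1 : ∀ j : Fin d, mode (d := d) ⟨2 * j + 1, by omega⟩ = j := fun j => by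
    ext; simp [mode]; omega
  have hdiag : ∀ Y Z, Y ≠ Z → T Y Z = 0 := by
    intro Y Z hYZ
    obtain ⟨j, hj⟩ : ∃ j, ¬ (j ∈ Y ↔ j ∈ Z) := by
      by_contra! hcon
      exact hYZ (Finset.ext hcon)
    set a : Fin (2 * d) := ⟨2 * j, by omega⟩ with ha
    set b : Fin (2 * d) := ⟨2 * j + 1, by omega⟩ with hb
    have hma : mode a = j := hm0 j
    have hmb : mode b = j := hm1 j
    -- The product of the two Majorana operators of mode `j` is diagonal, with entries `±i`
    -- according to the occupation of `j`. An operator commuting with it has no entry between states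
    -- that differ in this occupation.
    have hcomm : T * (majorana a * majorana b) = (majorana a * majorana b) * T := by
      rw [← Matrix.mul_assoc, h, Matrix.mul_assoc, h, Matrix.mul_assoc]
    have h1 := congrFun (congrFun hcomm Y) Z
    rw [← Matrix.mul_assoc, mul_majorana_apply, mul_majorana_apply, Matrix.mul_assoc,
      majorana_mul_apply, majorana_mul_apply] at h1
    simp only [hma, hmb, symmDiff_symmDiff_cancel_right] at h1
    simp only [majoranaCoeff, hma, hmb, fermionSign_symmDiff, mem_symmDiff_singleton_self,
      lt_irrefl, if_false, one_mul] at h1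
    have ea : a.val % 2 = 0 := by simp [ha]
    have eb : b.val % 2 ≠ 0 := by simp [hb]
    simp only [ea, eb, if_true, if_false, mul_one] at h1
    have sY := fermionSign_mul_self j Y
    have sZ := fermionSign_mul_self j Z
    have hI := Complex.I_mul_I
    by_cases hjY : j ∈ Y
    · have hjZ : j ∉ Z := fun hz => hj ⟨fun _ => hz, fun _ => hjY⟩
      simp only [hjY, hjZ, not_true, not_false_eq_true, if_true, if_false] at h1
      have : 2 * T Y Z = 0 := by
        linear_combination (-Complex.I) * h1 - T Y Z * sY - T Y Z * sZ +
          T Y Z * (fermionSign j Y * fermionSign j Y + fermionSign j Z * fermionSign j Z) * hI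
      simpa using this
    · have hjZ : j ∈ Z := by
        by_contra hz
        exact hj ⟨fun hy => absurd hy hjY, fun hy => absurd hy hz⟩
      simp only [hjY, hjZ, not_true, not_false_eq_true, if_true, if_false] at h1
      have : 2 * T Y Z = 0 := by
        linear_combination (Complex.I) * h1 - T Y Z * sY - T Y Z * sZ +
          T Y Z * (fermionSign j Y * fermionSign j Y + fermionSign j Z * fermionSign j Z) * hI
      simpa using this
  -- The first Majorana operator of mode `j` exchanges `Y` with `Y ∆ {j}`, so commuting with it
  -- equates the two diagonal entries; toggling modes then reaches every state from the vacuum.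
  have hstep : ∀ (j : Fin d) (Y : Finset (Fin d)), T (symmDiff Y {j}) (symmDiff Y {j}) = T Y Y := by
    intro j Y
    have h1 := congrFun (congrFun (h ⟨2 * j, by omega⟩) Y) (symmDiff Y {j})
    rw [mul_majorana_apply, majorana_mul_apply, hm0, symmDiff_symmDiff_cancel_right, mul_comm] at h1
    have hne : majoranaCoeff (d := d) ⟨2 * j, by omega⟩ Y ≠ 0 := by
      simp [majoranaCoeff, fermionSign]
    exact (mul_left_cancel₀ hne h1).symm
  have hconst : ∀ Y, T Y Y = T ∅ ∅ := by
    intro Y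
    induction Y using Finset.induction with
    | empty => rfl
    | insert j Y hj ih => rw [← symmDiff_singleton_of_notMem hj, hstep, ih]
  refine ⟨T ∅ ∅, ?_⟩
  ext Y Z
  by_cases hYZ : Y = Z
  · subst hYZ
    simp [hconst Y]
  · simp [hdiag Y Z hYZ, hYZ]

end FLO
end

noncomputable section
namespace FLO

/-! ### The Clifford map and intertwiners -/

/-- The real linear combinations of the Majorana operators. -/
def clifford (d : ℕ) : (Fin (2 * d) → ℝ) →ₗ[ℝ] FockOp d := Fintype.linearCombination ℝ majorana

theorem clifford_apply {d : ℕ} (v : Fin (2 * d) → ℝ) :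
    clifford d v = ∑ k, (v k : ℂ) • majorana k := rfl

theorem clifford_single {d : ℕ} (k : Fin (2 * d)) : clifford d (Pi.single k 1) = majorana k := by
  rw [clifford, Fintype.linearCombination_apply_single, one_smul]

theorem conjTranspose_clifford {d : ℕ} (v : Fin (2 * d) → ℝ) :
    (clifford d v)ᴴ = clifford d v := by
  simp [clifford_apply, conjTranspose_sum, conjTranspose_majorana]

theorem majorana_mul_clifford {d : ℕ} (k : Fin (2 * d)) (v : Fin (2 * d) → ℝ) :
    majorana k * clifford d v + clifford d v * majorana k = (2 * v k : ℂ) • 1 := by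
  rw [clifford_apply, Finset.mul_sum, Finset.sum_mul, ← Finset.sum_add_distrib]
  have : ∀ l, majorana k * ((v l : ℂ) • majorana l) + ((v l : ℂ) • majorana l) * majorana k =
      if k = l then (2 * v l : ℂ) • (1 : FockOp d) else 0 := by
    intro l
    rw [Matrix.mul_smul, Matrix.smul_mul, ← smul_add, majorana_anticommute]
    split_ifs
    · rw [smul_smul, mul_comm]
    · rw [smul_zero]
  rw [Finset.sum_congr rfl fun l _ => this l]
  simp

theorem clifford_anticommute {d : ℕ} (v w : Fin (2 * d) → ℝ) :
    clifford d v * clifford d w + clifford d w * clifford d v =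
      (2 * (v ⬝ᵥ w : ℝ) : ℂ) • 1 := by
  conv_lhs => rw [clifford_apply v]
  rw [Finset.mul_sum, Finset.sum_mul, ← Finset.sum_add_distrib]
  have : ∀ l, ((v l : ℂ) • majorana l) * clifford d w + clifford d w * ((v l : ℂ) • majorana l) =
      (2 * (v l * w l) : ℂ) • (1 : FockOp d) := by
    intro l
    rw [Matrix.mul_smul, Matrix.smul_mul, ← smul_add, majorana_mul_clifford, smul_smul]
    congr 1
    ring
  rw [Finset.sum_congr rfl fun l _ => this l, ← Finset.sum_smul, ← Finset.mul_sum, dotProduct]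
  push_cast
  rfl

/-- `V` implements the linear transformation `O` of the Majorana operators. -/
def Intertwines {d : ℕ} (V : FockOp d) (O : Matrix (Fin (2 * d)) (Fin (2 * d)) ℝ) : Prop :=
  ∀ v, V * clifford d v = clifford d (O *ᵥ v) * V

theorem Intertwines.one {d : ℕ} : Intertwines (1 : FockOp d) 1 := fun v => by simp

theorem Intertwines.mul {d : ℕ} {V V' : FockOp d} {O O' : Matrix (Fin (2 * d)) (Fin (2 * d)) ℝ}
    (h : Intertwines V O) (h' : Intertwines V' O') : Intertwines (V * V') (O * O') := fun v => by
  rw [Matrix.mul_assoc, h' v, ← Matrix.mul_assoc, h, Matrix.mul_assoc, mulVec_mulVec]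

theorem Intertwines.prod_ofFn {d n : ℕ} {V : Fin n → FockOp d}
    {O : Fin n → Matrix (Fin (2 * d)) (Fin (2 * d)) ℝ} (h : ∀ j, Intertwines (V j) (O j)) :
    Intertwines (List.ofFn V).prod (List.ofFn O).prod := by
  induction n with
  | zero => simpa using Intertwines.one
  | succ n ih =>
    rw [List.ofFn_succ, List.ofFn_succ, List.prod_cons, List.prod_cons]
    exact (h 0).mul (ih fun j => h j.succ)

theorem intertwines_parity (d : ℕ) : Intertwines (parity d) (-1) := fun v => by
  rw [neg_mulVec, one_mulVec, map_neg, clifford_apply, Finset.mul_sum, Matrix.neg_mul,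
    Finset.sum_mul, ← Finset.sum_neg_distrib]
  refine Finset.sum_congr rfl fun k _ => ?_
  rw [Matrix.mul_smul, parity_mul_majorana, Matrix.smul_mul, smul_neg]

/-- Operators that implement the same transformation are proportional. -/
theorem Intertwines.eq_smul {d : ℕ} {V X : FockOp d} {O : Matrix (Fin (2 * d)) (Fin (2 * d)) ℝ}
    (hV : Intertwines V O) (hX : Intertwines X O) {q : ℝ} (hq : 0 < q)
    (hVV : V * Vᴴ = 1) (hXX : X * Xᴴ = (q : ℂ) • 1) :
    ∃ c : ℂ, Complex.normSq c = q⁻¹ ∧ V = c • X := by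
  have hq0 : (q : ℂ) ≠ 0 := by exact_mod_cast hq.ne'
  have hXX' : Xᴴ * X = (q : ℂ) • 1 := by
    have h1 : ((q : ℂ)⁻¹ • Xᴴ) * X = 1 := by
      rw [mul_eq_one_comm, Matrix.mul_smul, hXX, smul_smul, inv_mul_cancel₀ hq0, one_smul]
    rw [← h1, Matrix.smul_mul, smul_smul, mul_inv_cancel₀ hq0, one_smul]
  -- Schur's lemma: up to the factor `q`, `Xᴴ` is the inverse of `X`, so `Xᴴ V` undoes the
  -- transformation and commutes with every Majorana operator.
  obtain ⟨c, hc⟩ := eq_smul_one_of_commute_majorana (T := Xᴴ * V) fun k => by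
    have h1 := hV (Pi.single k 1)
    have h2 := hX (Pi.single k 1)
    rw [clifford_single] at h1 h2
    have h3 : (q : ℂ) • (majorana k * Xᴴ) =
        (q : ℂ) • (Xᴴ * clifford d (O *ᵥ Pi.single k 1)) := by
      calc (q : ℂ) • (majorana k * Xᴴ) = Xᴴ * X * majorana k * Xᴴ := by
            rw [hXX', Matrix.smul_mul, Matrix.one_mul, Matrix.smul_mul]
        _ = Xᴴ * (X * majorana k) * Xᴴ := by simp only [Matrix.mul_assoc]
        _ = Xᴴ * clifford d (O *ᵥ Pi.single k 1) * (X * Xᴴ) := by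
            rw [h2]; simp only [Matrix.mul_assoc]
        _ = _ := by rw [hXX, Matrix.mul_smul, Matrix.mul_one]
    have h4 := smul_right_injective _ hq0 h3
    rw [Matrix.mul_assoc, h1, ← Matrix.mul_assoc, ← h4, Matrix.mul_assoc]
  have hVX : V = ((q : ℂ)⁻¹ * c) • X := by
    rw [mul_smul]
    have : c • X = (q : ℂ) • V := by
      calc c • X = X * (Xᴴ * V) := by rw [hc, Matrix.mul_smul, Matrix.mul_one]
        _ = _ := by rw [← Matrix.mul_assoc, hXX, Matrix.smul_mul, Matrix.one_mul]
    rw [this, smul_smul, inv_mul_cancel₀ hq0, one_smul]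
  refine ⟨_, ?_, hVX⟩
  have h5 := hVV
  rw [hVX, conjTranspose_smul, Matrix.smul_mul, Matrix.mul_smul, hXX, smul_smul, smul_smul] at h5
  -- The vacuum entry turns the operator identity `|c|² q • 1 = 1` into a scalar one.
  have h6 := congrFun (congrFun h5 ∅) ∅
  rw [Matrix.smul_apply, Matrix.one_apply_eq, smul_eq_mul, mul_one, ← starRingEnd_apply,
    Complex.mul_conj, ← Complex.ofReal_mul] at h6
  have h7 : Complex.normSq ((q : ℂ)⁻¹ * c) * q = 1 := by exact_mod_cast h6
  exact eq_inv_of_mul_eq_one_left h7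

theorem prod_ofFn_mul_conjTranspose {ι : Type*} [Fintype ι] [DecidableEq ι] {n : ℕ}
    {f : Fin n → Matrix ι ι ℂ} {q : Fin n → ℝ} (h : ∀ j, f j * (f j)ᴴ = (q j : ℂ) • 1) :
    (List.ofFn f).prod * ((List.ofFn f).prod)ᴴ = ((∏ j, q j : ℝ) : ℂ) • 1 := by
  induction n with
  | zero => simp
  | succ n ih =>
    rw [List.ofFn_succ, List.prod_cons, conjTranspose_mul, Matrix.mul_assoc,
      ← Matrix.mul_assoc (List.prod _), ih fun j => h j.succ, Matrix.smul_mul, Matrix.one_mul,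
      Matrix.mul_smul, h 0, smul_smul, Fin.prod_univ_succ, Complex.ofReal_mul, mul_comm]

/-! ### Exponentials of quadratic Majorana Hamiltonians -/

/-- The operator `1/4 ∑_{ij} A_{ij} m_i m_j`. -/
def quadratic {d : ℕ} (A : Matrix (Fin (2 * d)) (Fin (2 * d)) ℝ) : FockOp d :=
  (1 / 4 : ℂ) • ∑ i, ∑ j, (A i j : ℂ) • (majorana i * majorana j)

theorem conjTranspose_quadratic {d : ℕ} {A : Matrix (Fin (2 * d)) (Fin (2 * d)) ℝ}
    (hA : Aᵀ = -A) : (quadratic A)ᴴ = -quadratic A := by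
  have h : ∀ i j, A j i = -A i j := fun i j => congrFun (congrFun hA i) j
  simp only [quadratic, conjTranspose_smul, conjTranspose_sum, conjTranspose_mul,
    conjTranspose_majorana]
  rw [Finset.sum_comm, ← smul_neg, ← Finset.sum_neg_distrib]
  simp only [← Finset.sum_neg_distrib]
  congr 1
  · simp
  · refine Finset.sum_congr rfl fun i _ => Finset.sum_congr rfl fun j _ => ?_
    rw [h i j]
    simp

/-- Each commutator `[m_i m_j, c(v)]` equals `2 v_j m_i - 2 v_i m_j`. Antisymmetry of `A` makes the
two resulting sums equal, and the factor `1/4` normalizes the total `2 + 2`. -/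
theorem quadratic_mul_clifford {d : ℕ} {A : Matrix (Fin (2 * d)) (Fin (2 * d)) ℝ}
    (hA : Aᵀ = -A) (v : Fin (2 * d) → ℝ) :
    quadratic A * clifford d v - clifford d v * quadratic A = clifford d (A *ᵥ v) := by
  have h : ∀ i j, A j i = -A i j := fun i j => congrFun (congrFun hA i) j
  have h1 : ∀ i j, majorana i * majorana j * clifford d v - clifford d v * (majorana i * majorana j)
      = (2 * v j : ℂ) • majorana i - (2 * v i : ℂ) • majorana j := by
    intro i j
    have e1 := majorana_mul_clifford i v
    have e2 := majorana_mul_clifford j v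
    calc majorana i * majorana j * clifford d v - clifford d v * (majorana i * majorana j)
        = majorana i * (majorana j * clifford d v + clifford d v * majorana j) -
          (majorana i * clifford d v + clifford d v * majorana i) * majorana j := by noncomm_ring
      _ = _ := by rw [e1, e2]; simp
  have h2 : quadratic A * clifford d v - clifford d v * quadratic A =
      (1 / 4 : ℂ) • ∑ i, ∑ j, (A i j : ℂ) •
        ((2 * v j : ℂ) • majorana i - (2 * v i : ℂ) • majorana j) := by
    simp only [quadratic, Matrix.smul_mul, Matrix.mul_smul, ← smul_sub, Finset.sum_mul,
      Finset.mul_sum, ← Finset.sum_sub_distrib, h1]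
  have h3 : ∑ i, ∑ j, (A i j : ℂ) • ((2 * v i : ℂ) • majorana (d := d) j) =
      -∑ i, ∑ j, (A i j : ℂ) • ((2 * v j : ℂ) • majorana (d := d) i) := by
    rw [Finset.sum_comm, ← Finset.sum_neg_distrib]
    simp only [← Finset.sum_neg_distrib]
    refine Finset.sum_congr rfl fun i _ => Finset.sum_congr rfl fun j _ => ?_
    rw [h i j]
    simp
  rw [h2]
  simp only [smul_sub, Finset.sum_sub_distrib, h3, clifford_apply, mulVec, dotProduct]
  rw [smul_neg, sub_neg_eq_add, ← smul_add, ← two_smul ℂ, smul_smul, Finset.smul_sum]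
  refine Finset.sum_congr rfl fun i _ => ?_
  rw [Finset.smul_sum, Complex.ofReal_sum, Finset.sum_smul]
  refine Finset.sum_congr rfl fun j _ => ?_
  rw [smul_smul, smul_smul]
  congr 1
  push_cast
  ring

section Exp

attribute [local instance] Matrix.linftyOpNormedRing Matrix.linftyOpNormedAlgebra

/-- The commutation relation makes the derivative of `e^{-tH} c(e^{tA} v) e^{tH}` vanish; comparing
`t = 0` with `t = 1` gives the claim. -/
theorem intertwines_exp {d : ℕ} {A : Matrix (Fin (2 * d)) (Fin (2 * d)) ℝ} {H : FockOp d}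
    (h : ∀ v, H * clifford d v - clifford d v * H = clifford d (A *ᵥ v)) :
    Intertwines (NormedSpace.exp H) (NormedSpace.exp A) := by
  intro v
  let ℓ : Matrix (Fin (2 * d)) (Fin (2 * d)) ℝ →ₗ[ℝ] FockOp d :=
    { toFun := fun M => clifford d (M *ᵥ v)
      map_add' := fun M N => by rw [add_mulVec, map_add]
      map_smul' := fun c M => by rw [smul_mulVec, map_smul]; rfl }
  let f : ℝ → FockOp d := fun t =>
    NormedSpace.exp (t • (-H)) * ℓ (NormedSpace.exp (t • A)) * NormedSpace.exp (t • H)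
  have hf : ∀ t, HasDerivAt f 0 t := by
    intro t
    have e1 := hasDerivAt_exp_smul_const (𝕂 := ℝ) (-H) t
    have e2 := hasDerivAt_exp_smul_const' (𝕂 := ℝ) A t
    have e3 := hasDerivAt_exp_smul_const' (𝕂 := ℝ) H t
    have e4 := (LinearMap.toContinuousLinearMap ℓ).hasFDerivAt.comp_hasDerivAt t e2
    have e5 := (e1.mul e4).mul e3
    have e6 : ℓ (A * NormedSpace.exp (t • A)) =
        H * ℓ (NormedSpace.exp (t • A)) - ℓ (NormedSpace.exp (t • A)) * H := by
      change clifford d ((A * NormedSpace.exp (t • A)) *ᵥ v) = _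
      rw [← mulVec_mulVec, ← h]
      rfl
    refine e5.congr_deriv ?_
    change (NormedSpace.exp (t • (-H)) * (-H) * ℓ (NormedSpace.exp (t • A)) +
      NormedSpace.exp (t • (-H)) * ℓ (A * NormedSpace.exp (t • A))) * NormedSpace.exp (t • H) +
      NormedSpace.exp (t • (-H)) * ℓ (NormedSpace.exp (t • A)) * (H * NormedSpace.exp (t • H)) = 0
    rw [e6]
    noncomm_ring
  have h01 : f 0 = f 1 := is_const_of_deriv_eq_zero (fun t => (hf t).differentiableAt)
    (fun t => (hf t).deriv) 0 1
  have hinv : NormedSpace.exp H * NormedSpace.exp (-H) = 1 := by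
    rw [Matrix.exp_neg, Matrix.mul_nonsing_inv _
      ((isUnit_iff_isUnit_det _).1 (Matrix.isUnit_exp H))]
  simp only [f, zero_smul, NormedSpace.exp_zero, one_smul, one_mul, mul_one] at h01
  have h02 : clifford d v =
      NormedSpace.exp (-H) * clifford d (NormedSpace.exp A *ᵥ v) * NormedSpace.exp H := by
    rw [← one_mulVec v]
    simpa [ℓ] using h01
  rw [h02, ← Matrix.mul_assoc, ← Matrix.mul_assoc, hinv, Matrix.one_mul]

theorem exp_mul_conjTranspose {ι : Type*} [Fintype ι] [DecidableEq ι] {H : Matrix ι ι ℂ}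
    (h : Hᴴ = -H) : NormedSpace.exp H * (NormedSpace.exp H)ᴴ = 1 := by
  rw [← Matrix.exp_conjTranspose, h, Matrix.exp_neg, Matrix.mul_nonsing_inv _
    ((isUnit_iff_isUnit_det _).1 (Matrix.isUnit_exp H))]

end Exp

theorem IsPiAct.intertwines {d : ℕ} {O : Matrix (Fin (2 * d)) (Fin (2 * d)) ℝ} {V : FockOp d}
    (h : IsPiAct O V) : Intertwines V O := by
  obtain ⟨A, hA, rfl, rfl⟩ := h
  exact intertwines_exp (quadratic_mul_clifford hA)

theorem IsPiAct.mul_conjTranspose {d : ℕ} {O : Matrix (Fin (2 * d)) (Fin (2 * d)) ℝ}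
    {V : FockOp d} (h : IsPiAct O V) : V * Vᴴ = 1 := by
  obtain ⟨A, hA, rfl, rfl⟩ := h
  exact exp_mul_conjTranspose (conjTranspose_quadratic hA)

end FLO
end

noncomputable section
namespace FLO

/-! ### Canonical form of rotations -/

/-- A linear isometry of a real space of dimension at least three rotates some plane. -/
theorem exists_rotated_plane {E : Type*} [NormedAddCommGroup E] [InnerProductSpace ℝ E]
    [FiniteDimensional ℝ E] (hE : 3 ≤ Module.finrank ℝ E) (g : E →ₗᵢ[ℝ] E) :
    ∃ (u : Fin 2 → E) (c s : ℝ), Orthonormal ℝ u ∧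
      g (u 0) = c • u 0 + s • u 1 ∧ g (u 1) = (-s) • u 0 + c • u 1 := by
  set e : E ≃ₗᵢ[ℝ] E := g.toLinearIsometryEquiv rfl with he
  have heg : ∀ x, e x = g x := fun x => rfl
  -- `g + g⁻¹` is symmetric. An eigenvector `v` with eigenvalue `μ` satisfies `g² v = μ g v - v`, so
  -- `v` and `g v` span an invariant subspace.
  set S : E →ₗ[ℝ] E := (e : E →ₗ[ℝ] E) + (e.symm : E →ₗ[ℝ] E) with hS
  have hSx : ∀ x, S x = g x + e.symm x := fun x => rfl
  have hadj : ∀ x y, inner ℝ (g x) y = inner ℝ x (e.symm y) := by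
    intro x y
    rw [← heg, ← e.inner_map_map x (e.symm y), e.apply_symm_apply]
  have hsymm : S.IsSymmetric := by
    intro x y
    rw [hSx, hSx, inner_add_left, inner_add_right, hadj, add_comm]
    congr 1
    rw [real_inner_comm, ← hadj, real_inner_comm]
  set b := hsymm.eigenvectorBasis rfl with hb
  have hbS : ∀ i, S (b i) = hsymm.eigenvalues rfl i • b i := fun i =>
    hsymm.apply_eigenvectorBasis rfl i
  by_cases hcase : ∃ i, g (b i) ≠ b i ∧ g (b i) ≠ -b i
  · obtain ⟨i, hi1, hi2⟩ := hcase
    set v := b i with hv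
    set μ : ℝ := hsymm.eigenvalues rfl i with hμ
    have hv1 : ‖v‖ = 1 := b.norm_eq_one i
    have hvv : inner ℝ v v = (1 : ℝ) := by rw [real_inner_self_eq_norm_sq, hv1]; norm_num
    have hgg : inner ℝ (g v) (g v) = (1 : ℝ) := by rw [g.inner_map_map, hvv]
    set c : ℝ := inner ℝ v (g v) with hc
    have hμc : μ = 2 * c := by
      have h1 : inner ℝ v (S v) = μ := by rw [hbS, inner_smul_right, hvv, mul_one]
      rw [hSx, inner_add_right, ← hadj, real_inner_comm] at h1
      rw [hc, real_inner_comm]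
      linarith
    have hg2 : g (g v) = μ • g v - v := by
      have h1 := congrArg g (hbS i)
      rw [hSx, map_add, ← heg (e.symm _), e.apply_symm_apply, map_smul] at h1
      rw [← hμ, ← hv] at h1
      rw [← h1]
      abel
    set w := g v - c • v with hw
    have hvw : inner ℝ v w = (0 : ℝ) := by
      rw [hw, inner_sub_right, inner_smul_right, hvv, ← hc]
      ring
    have hww : inner ℝ w w = 1 - c ^ 2 := by
      rw [hw, inner_sub_left, inner_sub_right, inner_sub_right, inner_smul_left, inner_smul_right,
        inner_smul_left, inner_smul_right, hgg, hvv, real_inner_comm, ← hc]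
      simp
      ring
    have hw0 : w ≠ 0 := by
      intro h0
      rw [h0, inner_zero_left] at hww
      have h1 : g v = c • v := by rw [← sub_eq_zero, ← hw, h0]
      have h2 : (c - 1) * (c + 1) = 0 := by linarith
      rcases mul_eq_zero.1 h2 with h3 | h3
      · exact hi1 (by rw [h1, show c = 1 by linarith, one_smul])
      · exact hi2 (by rw [h1, show c = -1 by linarith, neg_one_smul])
    set s := ‖w‖ with hs
    have hs0 : s ≠ 0 := norm_ne_zero_iff.2 hw0
    have hs2 : s ^ 2 = 1 - c ^ 2 := by rw [hs, ← real_inner_self_eq_norm_sq, hww]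
    refine ⟨![v, s⁻¹ • w], c, s, ?_, ?_, ?_⟩
    · rw [orthonormal_iff_ite]
      have h1 : inner ℝ (s⁻¹ • w) (s⁻¹ • w) = (1 : ℝ) := by
        rw [inner_smul_left, inner_smul_right, hww, ← hs2]
        simp
        field_simp
      have h2 : inner ℝ v (s⁻¹ • w) = (0 : ℝ) := by rw [inner_smul_right, hvw, mul_zero]
      intro i j
      fin_cases i <;> fin_cases j
      · exact hvv
      · exact h2
      · exact (real_inner_comm _ _).trans h2
      · exact h1
    · change g v = c • v + s • (s⁻¹ • w)
      rw [smul_smul, mul_inv_cancel₀ hs0, one_smul, hw]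
      abel
    · change g (s⁻¹ • w) = (-s) • v + c • (s⁻¹ • w)
      have h1 : g w = c • w - s ^ 2 • v := by
        rw [hw, map_sub, map_smul, hg2, hs2, hμc]
        module
      rw [map_smul, h1, smul_sub, smul_smul, smul_smul, smul_smul,
        show s⁻¹ * s ^ 2 = s by field_simp, mul_comm]
      module
  -- Here `g` is `±1` on every basis vector, and among at least three of them two share the sign.
  -- They span a plane on which `g` is `1` or `-1`.
  · push Not at hcase
    classical
    obtain ⟨i, j, hij, hsame⟩ := Fintype.exists_ne_map_eq_of_card_lt
      (fun i => decide (g (b i) = b i)) (by simpa using (show 2 < Module.finrank ℝ E from hE))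
    have hsame' : (g (b i) = b i) ↔ (g (b j) = b j) := by simpa using hsame
    have horth : Orthonormal ℝ ![b i, b j] := by
      rw [orthonormal_iff_ite]
      have := orthonormal_iff_ite.1 b.orthonormal
      intro k l
      fin_cases k <;> fin_cases l <;> simp [this, hij, hij.symm]
    by_cases h : g (b i) = b i
    · refine ⟨![b i, b j], 1, 0, horth, ?_, ?_⟩
      · simpa using h
      · simpa using hsame'.1 h
    · refine ⟨![b i, b j], -1, 0, horth, ?_, ?_⟩
      · simpa using hcase i h
      · simpa using hcase j (hsame'.not.1 h)

/-- Orthogonal block form of a linear isometry: all blocks but one are rotations. -/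
theorem exists_block_form (d : ℕ) : ∀ {E : Type} [NormedAddCommGroup E] [InnerProductSpace ℝ E]
    [FiniteDimensional ℝ E], Module.finrank ℝ E = 2 * d → ∀ g : E →ₗᵢ[ℝ] E,
    ∃ (v : Fin 2 × Fin d → E) (N : Fin d → Matrix (Fin 2) (Fin 2) ℝ), Orthonormal ℝ v ∧
      (∀ i j, g (v (i, j)) = ∑ k, N j k i • v (k, j)) ∧
      ∀ j, j.val ≠ 0 → ∃ c s : ℝ, N j = !![c, -s; s, c] := by
  induction d with
  | zero =>
    intro E _ _ _ _ g
    exact ⟨fun p => p.2.elim0, fun j => j.elim0, ⟨fun p => p.2.elim0, fun p => p.2.elim0⟩,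
      fun _ j => j.elim0, fun j => j.elim0⟩
  | succ d ih =>
    intro E _ _ _ hE g
    rcases Nat.eq_zero_or_pos d with rfl | hd
    -- In dimension two the isometry may be a reflection, so this block, which keeps index `0`, is
    -- left arbitrary. The induction step appends its rotation at the last index.
    · let b := (stdOrthonormalBasis ℝ E).reindex (finCongr hE)
      refine ⟨fun p => b p.1, fun _ => Matrix.of fun k i => inner ℝ (b k) (g (b i)), ?_, ?_, ?_⟩
      · exact b.orthonormal.comp Prod.fst fun p q h => Prod.ext h (Fin.ext (by omega))
      · intro i j
        exact (b.sum_repr' (g (b i))).symm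
      · intro j hj
        omega
    · obtain ⟨u, c, s, hu, hu0, hu1⟩ := exists_rotated_plane (by omega) g
      have hui := orthonormal_iff_ite.1 hu
      have hcs : c ^ 2 + s ^ 2 = 1 := by
        have h1 : inner ℝ (g (u 0)) (g (u 0)) = (1 : ℝ) := by rw [g.inner_map_map, hui]; simp
        rw [hu0] at h1
        simp only [inner_add_left, inner_add_right, inner_smul_left, inner_smul_right, hui] at h1
        simp at h1
        linarith
      set U := Submodule.span ℝ (Set.range u) with hU
      have hUfin : Module.finrank ℝ U = 2 := by
        rw [hU, finrank_span_eq_card hu.linearIndependent]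
        simp
      have hperp : Module.finrank ℝ Uᗮ = 2 * d := by
        have := U.finrank_add_finrank_orthogonal
        omega
      have hmem : ∀ w, w ∈ Uᗮ ↔ ∀ i, inner ℝ (u i) w = (0 : ℝ) := by
        intro w
        rw [hU, Submodule.mem_orthogonal]
        constructor
        · exact fun h i => h _ (Submodule.subset_span ⟨i, rfl⟩)
        · intro h x hx
          induction hx using Submodule.span_induction with
          | mem x hx => obtain ⟨i, rfl⟩ := hx; exact h i
          | zero => exact inner_zero_left _
          | add x y _ _ hx hy => rw [inner_add_left, hx, hy, add_zero]
          | smul a x _ hx => rw [inner_smul_left, hx, mul_zero]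
      have hinv : ∀ w ∈ Uᗮ, g w ∈ Uᗮ := by
        intro w hw
        rw [hmem] at hw ⊢
        have e0 : u 0 = c • g (u 0) - s • g (u 1) := by
          rw [hu0, hu1]
          have : c • (c • u 0 + s • u 1) - s • ((-s) • u 0 + c • u 1) = (c ^ 2 + s ^ 2) • u 0 := by
            module
          rw [this, hcs, one_smul]
        have e1 : u 1 = s • g (u 0) + c • g (u 1) := by
          rw [hu0, hu1]
          have : s • (c • u 0 + s • u 1) + c • ((-s) • u 0 + c • u 1) = (c ^ 2 + s ^ 2) • u 1 := by
            module
          rw [this, hcs, one_smul]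
        have h0 : inner ℝ (u 0) (g w) = (0 : ℝ) := by
          rw [e0, inner_sub_left, inner_smul_left, inner_smul_left, g.inner_map_map,
            g.inner_map_map, hw, hw]
          simp
        have h1 : inner ℝ (u 1) (g w) = (0 : ℝ) := by
          rw [e1, inner_add_left, inner_smul_left, inner_smul_left, g.inner_map_map,
            g.inner_map_map, hw, hw]
          simp
        intro i
        fin_cases i
        · exact h0
        · exact h1
      let g' : Uᗮ →ₗᵢ[ℝ] Uᗮ :=
        { toLinearMap := g.toLinearMap.restrict hinv
          norm_map' := fun w => g.norm_map w }
      obtain ⟨v', N', hv', hgv', hN'⟩ := ih hperp g'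
      have hvi := orthonormal_iff_ite.1 hv'
      refine ⟨fun p => Fin.lastCases (motive := fun _ => E) (u p.1) (fun j => (v' (p.1, j) : E)) p.2,
        Fin.lastCases (motive := fun _ => Matrix (Fin 2) (Fin 2) ℝ) !![c, -s; s, c] N',
        ?_, ?_, ?_⟩
      · rw [orthonormal_iff_ite]
        rintro ⟨i, j⟩ ⟨k, l⟩
        have hz : ∀ i p, inner ℝ (u i) (v' p : E) = (0 : ℝ) := fun i p =>
          (hmem _).1 (v' p).2 i
        induction j using Fin.lastCases with
        | last =>
          induction l using Fin.lastCases with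
          | last => simp [hui]
          | cast l => simp [hz, (Fin.castSucc_lt_last l).ne']
        | cast j =>
          induction l using Fin.lastCases with
          | last =>
            simp only [Fin.lastCases_castSucc, Fin.lastCases_last]
            rw [real_inner_comm, hz, if_neg (by simp [(Fin.castSucc_lt_last j).ne])]
          | cast l =>
            have := hvi (i, j) (k, l)
            rw [Submodule.coe_inner] at this
            simp [this]
      · intro i j
        induction j using Fin.lastCases with
        | last =>
          simp only [Fin.lastCases_last, Fin.sum_univ_two]
          fin_cases i
          · simpa using hu0
          · simpa using hu1
        | cast j =>
          simp only [Fin.lastCases_castSucc]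
          have := congrArg Subtype.val (hgv' i j)
          simp only [Fin.sum_univ_two, Submodule.coe_add, Submodule.coe_smul] at this ⊢
          exact this
      · intro j
        induction j using Fin.lastCases with
        | last => exact fun _ => ⟨c, s, by simp⟩
        | cast j =>
          intro hj
          obtain ⟨c', s', h⟩ := hN' j (by simpa using hj)
          exact ⟨c', s', by simpa using h⟩

/-- The block diagonal matrix with the `2 × 2` blocks that represent the numbers `z j`. -/
def complexBlocks {d : ℕ} (z : Fin d → ℂ) : Matrix (Fin 2 × Fin d) (Fin 2 × Fin d) ℝ :=
  blockDiagonal fun j => !![(z j).re, -(z j).im; (z j).im, (z j).re]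

/-- In the block form all blocks but one are rotations. Since `det g = 1`, the exceptional
orthogonal block has determinant `1` too, hence is a rotation. -/
theorem exists_rotation_form {d : ℕ} (g : Matrix.specialOrthogonalGroup (Fin (2 * d)) ℝ) :
    ∃ (R : Matrix (Fin (2 * d)) (Fin 2 × Fin d) ℝ) (z : Fin d → ℂ), Rᵀ * R = 1 ∧ R * Rᵀ = 1 ∧
      (∀ j, ‖z j‖ = 1) ∧
      (g : Matrix (Fin (2 * d)) (Fin (2 * d)) ℝ) = R * complexBlocks z * Rᵀ := by
  obtain ⟨G, hG⟩ := g
  obtain ⟨hGo, hGd⟩ := Matrix.mem_specialOrthogonalGroup_iff.1 hG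
  have hGG : Gᵀ * G = 1 := (Matrix.mem_orthogonalGroup_iff' _ _).1 hGo
  have hinner : ∀ x y : EuclideanSpace ℝ (Fin (2 * d)), inner ℝ x y = x.ofLp ⬝ᵥ y.ofLp := by
    intro x y
    rw [PiLp.inner_apply, dotProduct]
    simp [mul_comm]
  let g : EuclideanSpace ℝ (Fin (2 * d)) →ₗᵢ[ℝ] EuclideanSpace ℝ (Fin (2 * d)) :=
    { toLinearMap := Matrix.toEuclideanLin G
      norm_map' := fun x => by
        have : ‖Matrix.toEuclideanLin G x‖ ^ 2 = ‖x‖ ^ 2 := by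
          rw [← real_inner_self_eq_norm_sq, ← real_inner_self_eq_norm_sq, hinner, hinner]
          change (G *ᵥ x.ofLp) ⬝ᵥ (G *ᵥ x.ofLp) = _
          rw [dotProduct_mulVec, ← vecMul_transpose, vecMul_vecMul, hGG, vecMul_one]
        exact (pow_left_inj₀ (norm_nonneg _) (norm_nonneg _) two_ne_zero).1 this }
  obtain ⟨v, N, hv, hgv, hN⟩ := exists_block_form d (by simp) g
  have hvi := orthonormal_iff_ite.1 hv
  set R : Matrix (Fin (2 * d)) (Fin 2 × Fin d) ℝ := Matrix.of fun k p => v p k with hR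
  have hRR : Rᵀ * R = 1 := by
    ext p q
    have := hvi p q
    rw [hinner] at this
    rw [Matrix.one_apply, ← this]
    rfl
  have hRR' : R * Rᵀ = 1 := (mul_eq_one_comm_of_card_eq _ _ _ (by simp)).1 hRR
  have hGR : G * R = R * blockDiagonal N := by
    ext k ⟨i, j⟩
    have h1 := congrArg (fun x : EuclideanSpace ℝ (Fin (2 * d)) => x k) (hgv i j)
    have h2 : (g (v (i, j))) k = (G * R) k (i, j) := rfl
    simp only at h1
    rw [← h2, h1, Matrix.mul_apply, Fintype.sum_prod_type]
    simp [blockDiagonal_apply, hR, mul_comm]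
  have hG' : G = R * blockDiagonal N * Rᵀ := by
    rw [← hGR, Matrix.mul_assoc, hRR', Matrix.mul_one]
  have hNN : ∀ j, (N j)ᵀ * N j = 1 := by
    have h1 : (G * R)ᵀ * (G * R) = 1 := by
      rw [transpose_mul, Matrix.mul_assoc, ← Matrix.mul_assoc Gᵀ, hGG, Matrix.one_mul, hRR]
    rw [hGR, transpose_mul, Matrix.mul_assoc, ← Matrix.mul_assoc Rᵀ, hRR, Matrix.one_mul,
      blockDiagonal_transpose, ← blockDiagonal_mul, ← blockDiagonal_one] at h1
    exact fun j => congrFun (blockDiagonal_injective h1) j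
  have hdetN : ∏ j, (N j).det = 1 := by
    rw [← det_blockDiagonal, ← hGd, hG', det_conj_of_mul_eq_one hRR' hRR]
  have hrot : ∀ j, ∃ c s : ℝ, N j = !![c, -s; s, c] := by
    by_contra! hcon
    obtain ⟨j, hj⟩ := hcon
    have hj0 : j.val = 0 := by
      by_contra h
      obtain ⟨c, s, h⟩ := hN j h
      exact hj c s h
    have hdet : (N j).det = 1 := by
      rw [← hdetN, Finset.prod_eq_single_of_mem j (Finset.mem_univ j) fun k _ hk => ?_]
      obtain ⟨c, s, h⟩ := hN k fun h => hk (Fin.ext (h.trans hj0.symm))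
      have h2 := congrFun (congrFun (hNN k) 0) 0
      rw [h] at h2 ⊢
      simp [Matrix.mul_apply, Fin.sum_univ_two] at h2
      simp [det_fin_two]
      linarith
    -- For an orthogonal block of determinant `1`, both transpose and adjugate are the inverse.
    -- Comparing entries gives the rotation shape.
    have hadj : (N j)ᵀ = (N j).adjugate := by
      calc (N j)ᵀ = (N j)ᵀ * (N j * (N j).adjugate) := by
            rw [mul_adjugate, hdet, one_smul, Matrix.mul_one]
        _ = _ := by rw [← Matrix.mul_assoc, hNN, Matrix.one_mul]
    rw [adjugate_fin_two] at hadj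
    have h1 := congrFun (congrFun hadj 0) 0
    have h2 := congrFun (congrFun hadj 0) 1
    simp at h1 h2
    refine hj (N j 0 0) (N j 1 0) ?_
    ext a b
    fin_cases a <;> fin_cases b
    · rfl
    · change N j 0 1 = -N j 1 0
      linarith
    · rfl
    · exact h1.symm
  choose c s hcs using hrot
  refine ⟨R, fun j => ⟨c j, s j⟩, hRR, hRR', fun j => ?_, ?_⟩
  · have h2 := congrFun (congrFun (hNN j) 0) 0
    rw [hcs] at h2
    simp [Matrix.mul_apply, Fin.sum_univ_two] at h2
    rw [Complex.norm_def, Complex.normSq_mk, h2, Real.sqrt_one]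
  · change G = _
    rw [hG', complexBlocks]
    congr 3
    ext1 j
    exact hcs j

end FLO
end

noncomputable section
namespace FLO

/-! ### Rotations with a fixed set of invariant planes -/

/-- The matrices that act as complex numbers on the planes spanned by the columns of `R`. -/
def rotationHom {d : ℕ} {R : Matrix (Fin (2 * d)) (Fin 2 × Fin d) ℝ} (hR : Rᵀ * R = 1)
    (hR' : R * Rᵀ = 1) : (Fin d → ℂ) →ₐ[ℝ] Matrix (Fin (2 * d)) (Fin (2 * d)) ℝ :=
  AlgHom.ofLinearMap
    { toFun := fun z => R * complexBlocks z * Rᵀ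
      map_add' := fun z w => by
        rw [← Matrix.add_mul, ← Matrix.mul_add]
        congr 2
        rw [complexBlocks, complexBlocks, complexBlocks, ← blockDiagonal_add]
        congr 1
        ext j a b
        fin_cases a <;> fin_cases b <;> simp [add_comm]
      map_smul' := fun c z => by
        rw [RingHom.id_apply, ← Matrix.smul_mul, ← Matrix.mul_smul]
        congr 2
        rw [complexBlocks, complexBlocks, ← blockDiagonal_smul]
        congr 1
        ext j a b
        fin_cases a <;> fin_cases b <;> simp }
    (by
      have : complexBlocks (1 : Fin d → ℂ) = 1 := by
        rw [complexBlocks, ← blockDiagonal_one]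
        congr 1
        ext j a b
        fin_cases a <;> fin_cases b <;> simp
      change R * complexBlocks (1 : Fin d → ℂ) * Rᵀ = (1 : Matrix (Fin (2 * d)) (Fin (2 * d)) ℝ)
      rw [this, Matrix.mul_one, hR'])
    (fun z w => by
      have : complexBlocks (z * w) = complexBlocks z * complexBlocks w := by
        rw [complexBlocks, complexBlocks, complexBlocks, ← blockDiagonal_mul]
        congr 1
        ext j a b
        fin_cases a <;> fin_cases b <;> simp [Matrix.mul_apply, Fin.sum_univ_two] <;> ring
      change R * complexBlocks (z * w) * Rᵀ = R * complexBlocks z * Rᵀ * (R * complexBlocks w * Rᵀ)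
      rw [this]
      calc _ = R * (complexBlocks z * 1 * complexBlocks w) * Rᵀ := by rw [Matrix.mul_one]
        _ = _ := by rw [← hR]; simp only [Matrix.mul_assoc])

variable {d : ℕ} {R : Matrix (Fin (2 * d)) (Fin 2 × Fin d) ℝ}

theorem rotationHom_apply (hR : Rᵀ * R = 1) (hR' : R * Rᵀ = 1) (z : Fin d → ℂ) :
    rotationHom hR hR' z = R * complexBlocks z * Rᵀ := rfl

theorem transpose_rotationHom (hR : Rᵀ * R = 1) (hR' : R * Rᵀ = 1) (z : Fin d → ℂ) :
    (rotationHom hR hR' z)ᵀ = rotationHom hR hR' (star z) := by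
  have : (complexBlocks z)ᵀ = complexBlocks (star z) := by
    rw [complexBlocks, complexBlocks, blockDiagonal_transpose]
    congr 1
    ext j a b
    fin_cases a <;> fin_cases b <;> simp
  rw [rotationHom_apply, rotationHom_apply, transpose_mul, transpose_mul, transpose_transpose,
    this, Matrix.mul_assoc]

theorem det_rotationHom (hR : Rᵀ * R = 1) (hR' : R * Rᵀ = 1) (z : Fin d → ℂ) :
    (rotationHom hR hR' z).det = ∏ j, Complex.normSq (z j) := by
  rw [rotationHom_apply, det_conj_of_mul_eq_one hR' hR, complexBlocks, det_blockDiagonal]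
  refine Finset.prod_congr rfl fun j _ => ?_
  rw [det_fin_two_of, Complex.normSq_apply]
  ring

theorem rotationHom_mem (hR : Rᵀ * R = 1) (hR' : R * Rᵀ = 1) {z : Fin d → ℂ}
    (hz : ∀ j, ‖z j‖ = 1) :
    rotationHom hR hR' z ∈ Matrix.specialOrthogonalGroup (Fin (2 * d)) ℝ := by
  have hn : ∀ j, Complex.normSq (z j) = 1 := fun j => by
    rw [Complex.normSq_eq_norm_sq, hz, one_pow]
  refine Matrix.mem_specialOrthogonalGroup_iff.2 ⟨(Matrix.mem_orthogonalGroup_iff _ _).2 ?_, ?_⟩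
  · rw [transpose_rotationHom, ← map_mul]
    have : z * star z = 1 := by
      ext1 j
      simp [Complex.mul_conj, hn]
    rw [this, map_one]
  · rw [det_rotationHom]
    simp [hn]

section Exp

attribute [local instance] Matrix.linftyOpNormedRing Matrix.linftyOpNormedAlgebra

theorem exp_rotationHom (hR : Rᵀ * R = 1) (hR' : R * Rᵀ = 1) (w : Fin d → ℂ) :
    NormedSpace.exp (rotationHom hR hR' w) = rotationHom hR hR' fun j => Complex.exp (w j) := by
  have hcont : Continuous (rotationHom hR hR') :=
    (rotationHom hR hR').toLinearMap.continuous_of_finiteDimensional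
  refine (NormedSpace.map_exp (rotationHom hR hR') hcont w).symm.trans ?_
  congr 1
  ext1 j
  rw [Pi.coe_exp, Complex.exp_eq_exp_ℂ]

end Exp

/-- At real `t`, `t - rotationHom z = rotationHom (t - z)` has determinant `∏ |t - z_j|²`. This
determines the real polynomial, whose quadratic factors split over `ℂ`. -/
theorem charpoly_rotationHom (hR : Rᵀ * R = 1) (hR' : R * Rᵀ = 1) (z : Fin d → ℂ) :
    ((rotationHom hR hR' z).map Complex.ofReal).charpoly =
      ∏ j, ((Polynomial.X - Polynomial.C (z j)) *
        (Polynomial.X - Polynomial.C ((starRingEnd ℂ) (z j)))) := by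
  have h1 : (rotationHom hR hR' z).charpoly =
      ∏ j, (Polynomial.X ^ 2 - Polynomial.C (2 * (z j).re) * Polynomial.X +
        Polynomial.C (Complex.normSq (z j))) := by
    refine Polynomial.funext fun t => ?_
    have : (scalar (Fin (2 * d))) t - rotationHom hR hR' z =
        rotationHom hR hR' (algebraMap ℝ _ t - z) := by
      rw [map_sub, AlgHom.commutes]
      rfl
    rw [eval_charpoly, this, det_rotationHom, Polynomial.eval_prod]
    refine Finset.prod_congr rfl fun j _ => ?_
    rw [Complex.normSq_apply, Complex.normSq_apply]
    simp
    ring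
  change ((rotationHom hR hR' z).map Complex.ofRealHom).charpoly = _
  rw [charpoly_map, h1, Polynomial.map_prod]
  refine Finset.prod_congr rfl fun j _ => ?_
  have h2 : ((2 * (z j).re : ℝ) : ℂ) = z j + (starRingEnd ℂ) (z j) := (Complex.add_conj _).symm
  simp only [Polynomial.map_add, Polynomial.map_sub, Polynomial.map_mul, Polynomial.map_pow,
    Polynomial.map_X, Polynomial.map_C, Complex.ofRealHom_eq_coe, h2, ← Complex.mul_conj]
  simp only [Polynomial.C_add, Polynomial.C_mul]
  ring

/-- The planar rotations of `O` have the logarithms `iφ_j`; these are sent by `rotationHom` to an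
antisymmetric matrix because conjugation becomes transposition. -/
theorem exists_isPiAct {O : Matrix (Fin (2 * d)) (Fin (2 * d)) ℝ}
    (hO : O ∈ Matrix.specialOrthogonalGroup (Fin (2 * d)) ℝ) : ∃ V : FockOp d, IsPiAct O V := by
  obtain ⟨R, z, hR, hR', hz, hg⟩ := exists_rotation_form ⟨O, hO⟩
  choose φ hφ hφz using fun j => exists_phase (hz j)
  refine ⟨_, rotationHom hR hR' fun j => φ j * Complex.I, ?_, ?_, rfl⟩
  · rw [transpose_rotationHom, ← map_neg]
    congr 1
    ext1 j
    simp
  · rw [exp_rotationHom]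
    simp only [hφz]
    exact hg.symm

theorem exists_isPhasesSO (g : Matrix.specialOrthogonalGroup (Fin (2 * d)) ℝ) :
    ∃ φ : Fin d → ℝ, IsPhasesSO (g : Matrix (Fin (2 * d)) (Fin (2 * d)) ℝ) φ := by
  obtain ⟨R, z, hR, hR', hz, hg⟩ := exists_rotation_form g
  choose φ hφ hφz using fun j => exists_phase (hz j)
  refine ⟨φ, hφ, ?_⟩
  rw [hg, ← rotationHom_apply hR hR', charpoly_rotationHom]
  refine Finset.prod_congr rfl fun j _ => ?_
  rw [← hφz, ← Complex.exp_conj]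
  simp

theorem smul_one_add_smul_rotationHom (hR : Rᵀ * R = 1) (hR' : R * Rᵀ = 1) (z : Fin d → ℂ)
    (a b : ℝ) : a • (1 : Matrix (Fin (2 * d)) (Fin (2 * d)) ℝ) + b • rotationHom hR hR' z =
      rotationHom hR hR' fun j => (a : ℂ) + b * z j := by
  rw [← map_one (rotationHom hR hR'), ← map_smul, ← map_smul, ← map_add]
  congr 1
  ext1 j
  simp

/-- The Cayley path of a rotation. -/
theorem cayleyF_rotationHom (hR : Rᵀ * R = 1) (hR' : R * Rᵀ = 1) {z : Fin d → ℂ}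
    (hz : ∀ j, ‖z j‖ = 1) {θ : ℝ} (hθ : ∀ j, z j = -1 → θ ≠ 0) :
    cayleyF θ (rotationHom hR hR' z) = rotationHom hR hR' fun j => cayleyPhase θ (z j) := by
  have hlin := smul_one_add_smul_rotationHom hR hR' z
  have hne : ∀ j, (1 + θ : ℂ) + (1 - θ) * z j ≠ 0 := fun j => cayley_den_ne_zero (hz j) (hθ j)
  refine cayleyF_eq_of_mul_eq ?_ ?_
  · rw [hlin, hlin, ← map_mul]
    congr 1
    ext1 j
    simpa using cayleyPhase_mul (hz j)
  · rw [hlin]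
    refine IsUnit.map _ (Pi.isUnit_iff.2 fun j => isUnit_iff_ne_zero.2 ?_)
    simpa using hne j

/-- Since `kappa z` is imaginary, `1 - θκ` is the conjugate of `1 + θκ`. Thus `F_θ(g)` stays in the
rotation group and has an antisymmetric logarithm. -/
theorem norm_cayleyPhase (θ : ℝ) {z : ℂ} (hz : ‖z‖ = 1) : ‖cayleyPhase θ z‖ = 1 := by
  obtain ⟨φ, -, rfl⟩ := exists_phase hz
  have h1 := one_add_mul_kappa_ne_zero θ hz
  have h2 : 1 - θ * kappa (Complex.exp (φ * Complex.I)) =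
      (starRingEnd ℂ) (1 + θ * kappa (Complex.exp (φ * Complex.I))) := by
    rw [kappa_exp]
    simp only [map_add, map_mul, map_neg, map_one, Complex.conj_I, Complex.conj_ofReal]
    ring
  have h3 : ‖cayleySign (Complex.exp (φ * Complex.I))‖ = 1 := by
    unfold cayleySign
    split_ifs <;> simp
  rw [cayleyPhase, norm_div, norm_mul, h2, RCLike.norm_conj, h3, one_mul,
    div_self (norm_ne_zero_iff.2 h1)]

/-! ### The Gaussian operators that implement planar rotations -/

theorem intertwines_of_columns (hR' : R * Rᵀ = 1) {V : FockOp d}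
    {O : Matrix (Fin (2 * d)) (Fin (2 * d)) ℝ}
    (h : ∀ p, V * clifford d (Rᵀ p) = clifford d (O *ᵥ Rᵀ p) * V) : Intertwines V O := by
  intro v
  have hv : v = ∑ p, (Rᵀ *ᵥ v) p • Rᵀ p := by
    conv_lhs => rw [← one_mulVec v, ← hR', ← mulVec_mulVec]
    ext k
    simp [mulVec, dotProduct, mul_comm]
  rw [hv, mulVec_sum, map_sum, map_sum, Finset.mul_sum, Finset.sum_mul]
  refine Finset.sum_congr rfl fun p _ => ?_
  rw [mulVec_smul, map_smul, map_smul, Matrix.mul_smul, Matrix.smul_mul, h]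

theorem rotationHom_mulVec_zero (hR : Rᵀ * R = 1) (hR' : R * Rᵀ = 1) (z : Fin d → ℂ) (j : Fin d) :
    rotationHom hR hR' z *ᵥ Rᵀ (0, j) = (z j).re • Rᵀ (0, j) + (z j).im • Rᵀ (1, j) := by
  have h : rotationHom hR hR' z * R = R * complexBlocks z := by
    rw [rotationHom_apply, Matrix.mul_assoc, hR, Matrix.mul_one]
  ext k
  have h1 := congrFun (congrFun h k) (0, j)
  change (rotationHom hR hR' z * R) k (0, j) = _
  rw [h1, Matrix.mul_apply, Fintype.sum_prod_type]
  simp [complexBlocks, blockDiagonal_apply, mul_comm]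

theorem rotationHom_mulVec_one (hR : Rᵀ * R = 1) (hR' : R * Rᵀ = 1) (z : Fin d → ℂ) (j : Fin d) :
    rotationHom hR hR' z *ᵥ Rᵀ (1, j) = (-(z j).im) • Rᵀ (0, j) + (z j).re • Rᵀ (1, j) := by
  have h : rotationHom hR hR' z * R = R * complexBlocks z := by
    rw [rotationHom_apply, Matrix.mul_assoc, hR, Matrix.mul_one]
  ext k
  have h1 := congrFun (congrFun h k) (1, j)
  change (rotationHom hR hR' z * R) k (1, j) = _
  rw [h1, Matrix.mul_apply, Fintype.sum_prod_type]
  simp [complexBlocks, blockDiagonal_apply, mul_comm]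

/-- The product of the two Majorana operators of the `j`-th plane. -/
def bivector (R : Matrix (Fin (2 * d)) (Fin 2 × Fin d) ℝ) (j : Fin d) : FockOp d :=
  clifford d (Rᵀ (1, j)) * clifford d (Rᵀ (0, j))

theorem clifford_column_mul_self (hR : Rᵀ * R = 1) (p : Fin 2 × Fin d) :
    clifford d (Rᵀ p) * clifford d (Rᵀ p) = 1 := by
  have h1 : Rᵀ p ⬝ᵥ Rᵀ p = 1 := by
    have := congrFun (congrFun hR p) p
    rwa [Matrix.one_apply_eq] at this
  have h2 := clifford_anticommute (Rᵀ p) (Rᵀ p)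
  rw [h1, ← two_smul ℂ, Complex.ofReal_one, mul_one] at h2
  exact smul_right_injective _ two_ne_zero h2

theorem clifford_column_mul (hR : Rᵀ * R = 1) {p q : Fin 2 × Fin d} (h : p ≠ q) :
    clifford d (Rᵀ p) * clifford d (Rᵀ q) = -(clifford d (Rᵀ q) * clifford d (Rᵀ p)) := by
  have h1 : Rᵀ p ⬝ᵥ Rᵀ q = 0 := by
    have := congrFun (congrFun hR p) q
    rwa [Matrix.one_apply_ne h] at this
  have h2 := clifford_anticommute (Rᵀ p) (Rᵀ q)
  rw [h1, Complex.ofReal_zero, mul_zero, zero_smul] at h2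
  exact eq_neg_of_add_eq_zero_left h2

theorem conjTranspose_bivector (hR : Rᵀ * R = 1) (j : Fin d) :
    (bivector R j)ᴴ = -bivector R j := by
  rw [bivector, conjTranspose_mul, conjTranspose_clifford, conjTranspose_clifford,
    clifford_column_mul hR (by simp)]

theorem bivector_mul_self (hR : Rᵀ * R = 1) (j : Fin d) : bivector R j * bivector R j = -1 := by
  have h0 := clifford_column_mul_self hR (0, j)
  have h1 := clifford_column_mul_self hR (1, j)
  have h2 := clifford_column_mul hR (p := (0, j)) (q := (1, j)) (by simp)
  calc bivector R j * bivector R j = clifford d (Rᵀ (1, j)) *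
        (clifford d (Rᵀ (0, j)) * clifford d (Rᵀ (1, j))) * clifford d (Rᵀ (0, j)) := by
          simp only [bivector, Matrix.mul_assoc]
    _ = -((clifford d (Rᵀ (1, j)) * clifford d (Rᵀ (1, j))) *
        (clifford d (Rᵀ (0, j)) * clifford d (Rᵀ (0, j)))) := by
          rw [h2]; simp only [Matrix.mul_assoc, Matrix.mul_neg, Matrix.neg_mul]
    _ = -1 := by rw [h0, h1, Matrix.mul_one]

theorem bivector_combination_mul_conjTranspose (hR : Rᵀ * R = 1) (j : Fin d) (α β : ℝ) :
    ((α : ℂ) • 1 + (β : ℂ) • bivector R j) * ((α : ℂ) • 1 + (β : ℂ) • bivector R j)ᴴ =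
      ((α ^ 2 + β ^ 2 : ℝ) : ℂ) • 1 := by
  rw [conjTranspose_add, conjTranspose_smul, conjTranspose_smul, conjTranspose_bivector hR,
    conjTranspose_one, Matrix.add_mul, Matrix.mul_add, Matrix.mul_add]
  simp only [Matrix.smul_mul, Matrix.mul_smul, Matrix.one_mul, Matrix.mul_one, Matrix.mul_neg,
    bivector_mul_self hR, smul_smul, Complex.star_def, Complex.conj_ofReal]
  push_cast
  module

/-- The half-angle rule of the spin representation: when `α + iβ ≠ 0`, the implemented phase is `(α
+ iβ)/(α - iβ)`. Other planes are untouched because the bivector is even and commutes with their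
Majorana operators. -/
theorem intertwines_bivector_combination (hR : Rᵀ * R = 1) (hR' : R * Rᵀ = 1) (j : Fin d)
    {α β : ℝ} {u : ℂ} (hu : u * (α - β * Complex.I) = α + β * Complex.I) :
    Intertwines ((α : ℂ) • 1 + (β : ℂ) • bivector R j)
      (rotationHom hR hR' (Pi.mulSingle j u)) := by
  have h0 := clifford_column_mul_self hR (0, j)
  have h1 := clifford_column_mul_self hR (1, j)
  have h2 := clifford_column_mul hR (p := (0, j)) (q := (1, j)) (by simp)
  set a := clifford d (Rᵀ (0, j)) with ha
  set b := clifford d (Rᵀ (1, j)) with hb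
  have hre := congrArg Complex.re hu
  have him := congrArg Complex.im hu
  simp at hre him
  have hba : b * a * a = b := by rw [Matrix.mul_assoc, h0, Matrix.mul_one]
  have haba : a * (b * a) = -b := by rw [← Matrix.mul_assoc, h2, Matrix.neg_mul, hba]
  have hbba : b * (b * a) = a := by rw [← Matrix.mul_assoc, h1, Matrix.one_mul]
  have hbab : b * a * b = -a := by rw [Matrix.mul_assoc, h2, Matrix.mul_neg, hbba]
  have hbiv : bivector R j = b * a := rfl
  refine intertwines_of_columns hR' ?_
  rintro ⟨i, l⟩
  by_cases hl : l = j
  · subst hl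
    have hcre : (u.re : ℂ) * α + u.im * β = α := by exact_mod_cast hre
    have hcim : -((u.re : ℂ) * β) + u.im * α = β := by exact_mod_cast him
    fin_cases i
    · change _ * a = clifford d (_ *ᵥ Rᵀ (0, l)) * _
      rw [rotationHom_mulVec_zero, map_add, map_smul, map_smul, ← ha, ← hb, hbiv,
        Pi.mulSingle_eq_same, ← Complex.coe_smul, ← Complex.coe_smul]
      simp only [Matrix.add_mul, Matrix.mul_add, Matrix.smul_mul, Matrix.mul_smul, Matrix.one_mul,
        Matrix.mul_one, hba, haba, hbba]
      linear_combination (norm := module) -(hcre • a) - (hcim • b)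
    · change _ * b = clifford d (_ *ᵥ Rᵀ (1, l)) * _
      rw [rotationHom_mulVec_one, map_add, map_smul, map_smul, ← ha, ← hb, hbiv,
        Pi.mulSingle_eq_same, ← Complex.coe_smul, ← Complex.coe_smul]
      simp only [Matrix.add_mul, Matrix.mul_add, Matrix.smul_mul, Matrix.mul_smul, Matrix.one_mul,
        Matrix.mul_one, hbab, haba, hbba]
      linear_combination (norm := module) -(hcre • b) + (hcim • a)
  · have hz : (Pi.mulSingle j u : Fin d → ℂ) l = 1 := Pi.mulSingle_eq_of_ne (M := fun _ => ℂ) hl u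
    have hfix : rotationHom hR hR' (Pi.mulSingle j u) *ᵥ Rᵀ (i, l) = Rᵀ (i, l) := by
      fin_cases i
      · simpa [hz] using rotationHom_mulVec_zero hR hR' (Pi.mulSingle j u) l
      · simpa [hz] using rotationHom_mulVec_one hR hR' (Pi.mulSingle j u) l
    have e0 := clifford_column_mul hR (p := (0, j)) (q := (i, l)) (by simp [Ne.symm hl])
    have e1 := clifford_column_mul hR (p := (1, j)) (q := (i, l)) (by simp [Ne.symm hl])
    rw [← ha] at e0
    rw [← hb] at e1
    have e2 : b * a * clifford d (Rᵀ (i, l)) = clifford d (Rᵀ (i, l)) * (b * a) := by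
      rw [Matrix.mul_assoc, e0, Matrix.mul_neg, ← Matrix.mul_assoc, e1, Matrix.neg_mul, neg_neg,
        Matrix.mul_assoc]
    rw [hfix, hbiv, Matrix.add_mul, Matrix.mul_add, Matrix.smul_mul, Matrix.smul_mul,
      Matrix.mul_smul, Matrix.mul_smul, e2, Matrix.one_mul, Matrix.mul_one]

end FLO
end

noncomputable section
namespace FLO

/-! ### Amplitudes of active circuits -/

/-- Expanding a product of `n` noncommuting linear factors under a linear functional: only the
choice of `Q j` everywhere reaches degree `n`. The functional is generalized so that the first
factor can be absorbed into it by left multiplication. -/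
theorem exists_polynomial_prod_ofFn {A : Type*} [Ring A] [Algebra ℂ A] {n : ℕ} (P Q : Fin n → A)
    (ℓ : A →ₗ[ℂ] ℂ) :
    ∃ p : Polynomial ℂ, p.natDegree ≤ n ∧ p.coeff n = ℓ (List.ofFn Q).prod ∧
      ∀ θ : ℂ, p.eval θ = ℓ (List.ofFn fun j => P j + θ • Q j).prod := by
  induction n generalizing ℓ with
  | zero => exact ⟨Polynomial.C (ℓ 1), by simp, by simp, by simp⟩
  | succ n ih =>
    obtain ⟨p, hp, -, hpe⟩ := ih (fun j => P j.succ) (fun j => Q j.succ)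
      (ℓ ∘ₗ LinearMap.mulLeft ℂ (P 0))
    obtain ⟨q, hq, hqc, hqe⟩ := ih (fun j => P j.succ) (fun j => Q j.succ)
      (ℓ ∘ₗ LinearMap.mulLeft ℂ (Q 0))
    refine ⟨p + q * Polynomial.X, ?_, ?_, fun θ => ?_⟩
    · exact Polynomial.natDegree_add_le_of_degree_le (hp.trans n.le_succ)
        (Polynomial.natDegree_mul_le_of_le hq Polynomial.natDegree_X_le)
    · rw [Polynomial.coeff_add, Polynomial.coeff_mul_X, hqc,
        Polynomial.coeff_eq_zero_of_natDegree_lt (Nat.lt_succ_of_le hp), zero_add, List.ofFn_succ,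
        List.prod_cons]
      rfl
    · rw [Polynomial.eval_add, Polynomial.eval_mul, Polynomial.eval_X, hpe, hqe, List.ofFn_succ,
        List.prod_cons, add_mul, map_add, smul_mul_assoc, map_smul, smul_eq_mul, mul_comm θ]
      rfl

theorem prod_ofFn_smul {A : Type*} [Ring A] [Algebra ℂ A] {n : ℕ} (c : Fin n → ℂ) (Q : Fin n → A) :
    (List.ofFn fun j => c j • Q j).prod = (∏ j, c j) • (List.ofFn Q).prod := by
  induction n with
  | zero => simp
  | succ n ih =>
    rw [List.ofFn_succ, List.prod_cons, ih, Fin.prod_univ_succ, List.ofFn_succ, List.prod_cons,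
      smul_mul_assoc, mul_smul_comm, smul_smul]

variable {d : ℕ} {R : Matrix (Fin (2 * d)) (Fin 2 × Fin d) ℝ}

theorem Intertwines.prod_mulSingle (hR : Rᵀ * R = 1) (hR' : R * Rᵀ = 1) {V : Fin d → FockOp d}
    {u : Fin d → ℂ} (h : ∀ j, Intertwines (V j) (rotationHom hR hR' (Pi.mulSingle j (u j)))) :
    Intertwines (List.ofFn V).prod (rotationHom hR hR' u) := by
  have h1 : (List.ofFn fun j => rotationHom hR hR' (Pi.mulSingle j (u j))).prod =
      rotationHom hR hR' u := by
    have h2 : (List.ofFn fun j => (Pi.mulSingle j (u j) : Fin d → ℂ)).prod = u := by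
      rw [List.prod_ofFn, Finset.univ_prod_mulSingle]
    conv_rhs => rw [← h2, map_list_prod, List.map_ofFn]
    rfl
  rw [← h1]
  exact Intertwines.prod_ofFn h

/-- The product of all bivectors is the parity operator up to a phase. -/
theorem exists_prod_bivector_eq (hR : Rᵀ * R = 1) (hR' : R * Rᵀ = 1) :
    ∃ c : ℂ, c ≠ 0 ∧ (List.ofFn (bivector R)).prod = c • parity d := by
  -- Each bivector implements the half turn of its plane, so the product implements `-1`, just as
  -- the parity operator does; irreducibility then makes the two proportional.
  have h1 : Intertwines (List.ofFn (bivector R)).prod (-1) := by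
    have h2 : rotationHom hR hR' (-1) = -1 := by rw [map_neg, map_one]
    rw [← h2]
    refine Intertwines.prod_mulSingle hR hR' fun j => ?_
    simpa using intertwines_bivector_combination hR hR' j (α := 0) (β := 1) (u := -1) (by simp)
  have h3 : (List.ofFn (bivector R)).prod * ((List.ofFn (bivector R)).prod)ᴴ = 1 := by
    have := prod_ofFn_mul_conjTranspose (f := bivector R) (q := fun _ => 1) fun j => by
      simpa using bivector_combination_mul_conjTranspose hR j 0 1
    simpa using this
  have h4 : parity d * (parity d)ᴴ = ((1 : ℝ) : ℂ) • 1 := by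
    have : (parity d)ᴴ = parity d := by
      rw [parity, diagonal_conjTranspose]
      congr 1
      ext Y
      simp
    rw [this, parity_mul_parity]
    simp
  obtain ⟨c, hc, h⟩ := h1.eq_smul (intertwines_parity d) one_pos h3 h4
  refine ⟨c, fun h0 => ?_, h⟩
  rw [h0] at hc
  simp at hc

theorem kappa_eq_of_norm_eq_one {z : ℂ} (hz : ‖z‖ = 1) :
    kappa z = -(Complex.I * ((-(kappa z).im : ℝ) : ℂ)) := by
  obtain ⟨φ, -, rfl⟩ := exists_phase hz
  rw [kappa_exp]
  generalize Real.tan (φ / 2) = t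
  simp

/-- The Gaussian operator that implements the Cayley path in the `j`-th plane. -/
def planarGaussian (R : Matrix (Fin (2 * d)) (Fin 2 × Fin d) ℝ) (z : Fin d → ℂ) (θ : ℂ)
    (j : Fin d) : FockOp d :=
  (if z j = -1 then bivector R j else 1) +
    θ • (if z j = -1 then 0 else ((-(kappa (z j)).im : ℝ) : ℂ) • bivector R j)

/-- With `κ = -it` the Cayley phase is `(1 + iθt)/(1 - iθt)`, the half-angle form for `1 + θ t b_j`.
A plane with eigenvalue `-1` corresponds to the limiting operator `b_j`, of weight `1`. -/
theorem planarGaussian_spec (hR : Rᵀ * R = 1) (hR' : R * Rᵀ = 1) {z : Fin d → ℂ}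
    (hz : ∀ j, ‖z j‖ = 1) (θ : ℝ) (j : Fin d) :
    Intertwines (planarGaussian R z θ j)
        (rotationHom hR hR' (Pi.mulSingle j (cayleyPhase θ (z j)))) ∧
      planarGaussian R z θ j * (planarGaussian R z θ j)ᴴ =
        (cayleyWeight θ (z j) : ℂ) • 1 := by
  have hk := kappa_eq_of_norm_eq_one (hz j)
  by_cases h : z j = -1
  · have h1 : planarGaussian R z θ j =
        ((0 : ℝ) : ℂ) • 1 + ((1 : ℝ) : ℂ) • bivector R j := by
      simp [planarGaussian, h]
    have hk0 : kappa (z j) = 0 := by simp [kappa, h]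
    rw [h1]
    constructor
    · refine intertwines_bivector_combination hR hR' j ?_
      rw [cayleyPhase, hk0, cayleySign, if_pos h]
      simp
    · rw [bivector_combination_mul_conjTranspose hR]
      simp [cayleyWeight, hk0]
  · set t : ℝ := -(kappa (z j)).im with ht
    have h1 : planarGaussian R z θ j =
        ((1 : ℝ) : ℂ) • 1 + ((θ * t : ℝ) : ℂ) • bivector R j := by
      simp only [planarGaussian, if_neg h, ← ht, smul_smul]
      push_cast
      rw [one_smul]
    have hne := one_add_mul_kappa_ne_zero θ (hz j)
    rw [h1]
    constructor
    · refine intertwines_bivector_combination hR hR' j ?_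
      rw [cayleyPhase, cayleySign, if_neg h, div_mul_eq_mul_div, div_eq_iff hne, hk]
      push_cast
      ring
    · rw [bivector_combination_mul_conjTranspose hR, cayleyWeight, hk, Complex.normSq_neg,
        Complex.normSq_mul, Complex.normSq_I, Complex.normSq_ofReal]
      congr 2
      ring

theorem prod_conj_pairs {φ : Fin d → ℝ} {z : Fin d → ℂ}
    (h : ∏ j, ((Polynomial.X - Polynomial.C (z j)) *
        (Polynomial.X - Polynomial.C ((starRingEnd ℂ) (z j)))) =
      ∏ j, ((Polynomial.X - Polynomial.C (Complex.exp (φ j * Complex.I))) *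
        (Polynomial.X - Polynomial.C (Complex.exp (-(φ j * Complex.I)))))) :
    ∏ j : Fin d ⊕ Fin d, (Polynomial.X - Polynomial.C
        ((Sum.elim z fun j => (starRingEnd ℂ) (z j)) j)) =
      ∏ j : Fin d ⊕ Fin d, (Polynomial.X - Polynomial.C
        ((Sum.elim (fun j => Complex.exp (φ j * Complex.I))
          fun j => (starRingEnd ℂ) (Complex.exp (φ j * Complex.I))) j)) := by
  rw [Fintype.prod_sum_type, Fintype.prod_sum_type]
  simp only [Sum.elim_inl, Sum.elim_inr]
  rw [← Finset.prod_mul_distrib, ← Finset.prod_mul_distrib, h]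
  refine Finset.prod_congr rfl fun j _ => ?_
  rw [← Complex.exp_conj]
  simp

/-- The characteristic polynomial determines only the list of conjugate pairs. The weight is
invariant under conjugation, so comparison of all `2d` roots gives equality of squares, and
positivity removes the square. -/
theorem prod_cayleyWeight_eq_denominator {φ : Fin d → ℝ} {z : Fin d → ℂ}
    (h : ∏ j : Fin d ⊕ Fin d, (Polynomial.X - Polynomial.C
        ((Sum.elim z fun j => (starRingEnd ℂ) (z j)) j)) =
      ∏ j : Fin d ⊕ Fin d, (Polynomial.X - Polynomial.C
        ((Sum.elim (fun j => Complex.exp (φ j * Complex.I))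
          fun j => (starRingEnd ℂ) (Complex.exp (φ j * Complex.I))) j))) (θ : ℝ) :
    ∏ j, cayleyWeight θ (z j) = (denominator φ 1).eval θ := by
  have h1 := prod_eq_of_prod_X_sub_C_eq h (cayleyWeight θ)
  rw [Fintype.prod_sum_type, Fintype.prod_sum_type] at h1
  simp only [Sum.elim_inl, Sum.elim_inr, cayleyWeight_conj] at h1
  rw [denominator_eval, pow_one]
  exact (mul_self_inj (Finset.prod_nonneg fun j _ => (cayleyWeight_pos _ _).le)
    (Finset.prod_nonneg fun j _ => (cayleyWeight_pos _ _).le)).1 h1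

/-- With `V₀` implementing `g₀` and `W` the product of the planar Gaussian operators, the
probability is `|⟨x|V₀ W|Ψ⟩|² / q`, where `q` is the denominator with exponent `1`. -/
theorem exists_polynomial_outcomeProb_active {g : Matrix.specialOrthogonalGroup (Fin (2 * d)) ℝ}
    {φ : Fin d → ℝ} (hφ : IsPhasesSO (g : Matrix (Fin (2 * d)) (Fin (2 * d)) ℝ) φ)
    (g₀ : Matrix.specialOrthogonalGroup (Fin (2 * d)) ℝ) (x : Finset (Fin d) → ℂ)
    {Ψ : Finset (Fin d) → ℂ} (hΨ : Ψ ∈ evenFock d) :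
    ∃ D : Polynomial ℝ,
      D.natDegree ≤ 2 * d ^ 2 ∧
      ((∀ j, φ j ≠ 0 ∧ φ j ≠ Real.pi) → D.eval 0 ≠ 0 → D.natDegree = 2 * d ^ 2) ∧
      ∀ θ : ℝ, (θ = 0 → ∀ j, φ j ≠ Real.pi) →
        (∃ V : FockOp d, IsPiAct ((g₀ : Matrix (Fin (2 * d)) (Fin (2 * d)) ℝ) *
          cayleyF θ (g : Matrix (Fin (2 * d)) (Fin (2 * d)) ℝ)) V) ∧
        ∀ V : FockOp d, IsPiAct ((g₀ : Matrix (Fin (2 * d)) (Fin (2 * d)) ℝ) *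
          cayleyF θ (g : Matrix (Fin (2 * d)) (Fin (2 * d)) ℝ)) V →
          outcomeProb x Ψ V = ((D.eval θ / (denominator φ d).eval θ : ℝ) : ℂ) := by
  obtain ⟨R, z, hR, hR', hz, hg⟩ := exists_rotation_form g
  rw [← rotationHom_apply hR hR'] at hg
  have hchar := hφ.2
  rw [hg, charpoly_rotationHom] at hchar
  have hpairs := prod_conj_pairs hchar
  obtain ⟨V₀, hV₀⟩ := exists_isPiAct g₀.2
  have hconj : ∀ {p : ℂ → Prop}, (∀ j, p (Complex.exp (φ j * Complex.I))) →
      (∀ z, p z → p ((starRingEnd ℂ) z)) → ∀ j, p (z j) := by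
    intro p hp hc j
    exact forall_of_prod_X_sub_C_eq hpairs (p := p) (by rintro (j | j); exacts [hp j, hc _ (hp j)])
      (Sum.inl j)
  have hpi : (∀ j, φ j ≠ Real.pi) → ∀ j, z j ≠ -1 := fun h =>
    hconj (p := fun z => z ≠ -1) (fun j => (exp_phase_eq_neg_one_iff (hφ.1 j)).not.2 (h j))
      fun z hz h => hz (by
        have := congrArg (starRingEnd ℂ) h
        simpa using this)
  have hweight := fun θ => prod_cayleyWeight_eq_denominator hpairs θ
  let ℓ : FockOp d →ₗ[ℂ] ℂ :=
    { toFun := fun M => star x ⬝ᵥ (V₀ * M) *ᵥ Ψ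
      map_add' := fun M N => by rw [Matrix.mul_add, add_mulVec, dotProduct_add]
      map_smul' := fun c M => by
        rw [Matrix.mul_smul, smul_mulVec, dotProduct_smul, RingHom.id_apply] }
  have hℓ : ∀ M, ℓ M = star x ⬝ᵥ (V₀ * M) *ᵥ Ψ := fun M => rfl
  obtain ⟨a, ha, hac, hae⟩ := exists_polynomial_prod_ofFn
    (fun j => if z j = -1 then bivector R j else 1)
    (fun j => if z j = -1 then 0 else ((-(kappa (z j)).im : ℝ) : ℂ) • bivector R j) ℓ
  obtain ⟨N, hN, hNc, hNe⟩ := exists_normSq_polynomial a ha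
  have hQ : ∀ θ, (denominator φ d).eval θ = (denominator φ 1).eval θ ^ d := by
    intro θ
    rw [denominator_eval, denominator_eval, pow_one]
  have hdeg : d ≠ 0 → 2 * d + (d - 1) * (2 * d * 1) = 2 * d ^ 2 := by
    intro h
    obtain ⟨k, rfl⟩ := Nat.exists_eq_succ_of_ne_zero h
    simp only [Nat.succ_sub_one, Nat.succ_eq_add_one]
    ring
  -- Expands the fraction `N / q` to the prescribed denominator `q ^ d`. For `d = 0` the truncated
  -- exponent is harmless, since `q = 1`.
  refine ⟨N * denominator φ 1 ^ (d - 1), ?_, ?_, ?_⟩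
  · rcases eq_or_ne d 0 with rfl | h
    · simpa using hN
    · rw [← hdeg h]
      exact Polynomial.natDegree_mul_le_of_le hN (Polynomial.natDegree_pow_le_of_le _
        (natDegree_denominator_le φ 1))
  · intro hp h0
    have hN0 : N.eval 0 ≠ 0 := fun h => h0 (by rw [Polynomial.eval_mul, h, zero_mul])
    have hz1 := hpi fun j => (hp j).2
    have hk : ∀ j, kappa (z j) ≠ 0 := hconj (p := fun z => kappa z ≠ 0)
      (fun j => by
        rw [kappa_exp]
        exact neg_ne_zero.2 (mul_ne_zero Complex.I_ne_zero
          (Complex.ofReal_ne_zero.2 (tan_half_ne_zero (hφ.1 j) (hp j).1 (hp j).2))))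
      fun z hz h => hz (by
        have : kappa ((starRingEnd ℂ) z) = (starRingEnd ℂ) (kappa z) := by simp [kappa]
        rw [h] at this
        simpa using this.symm)
    have hNdeg : N.natDegree = 2 * d := by
      refine le_antisymm hN (Polynomial.le_natDegree_of_ne_zero ?_)
      obtain ⟨c, hc, hB⟩ := exists_prod_bivector_eq hR hR'
      have h1 : a.eval ((0 : ℝ) : ℂ) = star x ⬝ᵥ V₀ *ᵥ Ψ := by
        rw [hae, hℓ]
        simp [hz1]
      -- The top coefficient contains the product of all bivectors, that is, parity up to the
      -- nonzero factor `c`, and parity fixes the even state `Ψ`.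
      have h2 : a.coeff d = (∏ j, ((-(kappa (z j)).im : ℝ) : ℂ)) * c * a.eval ((0 : ℝ) : ℂ) := by
        rw [hac, h1]
        simp only [if_neg (hz1 _)]
        rw [prod_ofFn_smul, hB, map_smul, map_smul, hℓ, ← mulVec_mulVec, parity_mulVec hΨ,
          smul_eq_mul, smul_eq_mul, mul_assoc]
      rw [hNc, h2, Complex.normSq_mul, ← hNe]
      refine mul_ne_zero (Complex.normSq_pos.2 (mul_ne_zero ?_ hc)).ne' hN0
      refine Finset.prod_ne_zero_iff.2 fun j _ h => hk j ?_
      rw [kappa_eq_of_norm_eq_one (hz j), h, mul_zero, neg_zero]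
    have hden := natDegree_denominator 1 hφ.1 hp
    have hd0 : denominator φ 1 ≠ 0 := fun h => by
      have := denominator_eval_pos φ 1 0
      rw [h, Polynomial.eval_zero] at this
      exact this.ne rfl
    rcases eq_or_ne d 0 with rfl | h
    · simpa using hNdeg
    · have hNne : N ≠ 0 := fun h => hN0 (by rw [h, Polynomial.eval_zero])
      rw [Polynomial.natDegree_mul hNne (pow_ne_zero _ hd0), Polynomial.natDegree_pow, hden, hNdeg,
        hdeg h]
  · intro θ hθ
    have hθz : ∀ j, z j = -1 → θ ≠ 0 := fun j hj h0 => hpi (hθ h0) j hj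
    have hF := cayleyF_rotationHom hR hR' hz hθz
    rw [← hg] at hF
    rw [hF]
    have hmem := rotationHom_mem hR hR' fun j => norm_cayleyPhase θ (hz j)
    refine ⟨exists_isPiAct (mul_mem g₀.2 hmem), fun V hV => ?_⟩
    set q := (denominator φ 1).eval θ with hq
    have hq0 : 0 < q := denominator_eval_pos φ 1 θ
    set W := (List.ofFn (planarGaussian R z θ)).prod with hW
    have hWi : Intertwines W (rotationHom hR hR' fun j => cayleyPhase θ (z j)) :=
      Intertwines.prod_mulSingle hR hR' fun j => (planarGaussian_spec hR hR' hz θ j).1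
    have hWW : W * Wᴴ = (q : ℂ) • 1 := by
      rw [hW, prod_ofFn_mul_conjTranspose fun j => (planarGaussian_spec hR hR' hz θ j).2, hweight]
    have hXX : V₀ * W * (V₀ * W)ᴴ = (q : ℂ) • 1 := by
      rw [conjTranspose_mul, Matrix.mul_assoc, ← Matrix.mul_assoc W, hWW, Matrix.smul_mul,
        Matrix.one_mul, Matrix.mul_smul, hV₀.mul_conjTranspose]
    -- Whatever logarithm defines `V`, it differs from `V₀ W` only by a scalar of squared modulus
    -- `q⁻¹`.
    obtain ⟨c, hc, hVc⟩ := hV.intertwines.eq_smul (hV₀.intertwines.mul hWi) hq0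
      hV.mul_conjTranspose hXX
    have hamp : star x ⬝ᵥ (V₀ * W) *ᵥ Ψ = a.eval (θ : ℂ) := by
      rw [hae, hℓ]
      rfl
    rw [outcomeProb_eq_normSq, hVc, smul_mulVec, dotProduct_smul, smul_eq_mul, Complex.normSq_mul,
      hamp, hc, hQ, Polynomial.eval_mul, Polynomial.eval_pow, ← hq, hNe]
    congr 1
    rcases eq_or_ne d 0 with rfl | h
    · have hq1 : q = 1 := by simp [hq, denominator_eval]
      rw [hq1]
      simp
    · have : q ^ d = q ^ (d - 1) * q := by rw [← pow_succ, Nat.sub_one_add_one h]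
      rw [this]
      field_simp

end FLO
end

noncomputable section
namespace FLO

/-! ### Composition of straight-line computations -/

section StraightLine

variable {S : Type*} {inp : Set (S → ℝ)}

/-- Every straight-line computation that contains the functions in `A` can be extended by at most
`k` steps to one that contains the functions in `B`. -/
def Extends (inp : Set (S → ℝ)) (A B : Set (S → ℝ)) (k : ℕ) : Prop :=
  ∀ l, IsStraightLine inp l → (∀ f ∈ A, f ∈ l) →
    ∃ l', IsStraightLine inp l' ∧ (∀ f ∈ l, f ∈ l') ∧ (∀ f ∈ B, f ∈ l') ∧ l'.length ≤ l.length + k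

theorem Extends.mono {A A' B B' : Set (S → ℝ)} {k k' : ℕ} (h : Extends inp A B k) (hA : A ⊆ A')
    (hB : B' ⊆ B) (hk : k ≤ k') : Extends inp A' B' k' := by
  intro l hl hlA
  obtain ⟨l', h1, h2, h3, h4⟩ := h l hl fun f hf => hlA f (hA hf)
  exact ⟨l', h1, h2, fun f hf => h3 f (hB hf), by omega⟩

theorem Extends.trans {A B C : Set (S → ℝ)} {k m : ℕ} (h : Extends inp A B k)
    (h' : Extends inp (A ∪ B) C m) : Extends inp A (B ∪ C) (k + m) := by
  intro l hl hlA
  obtain ⟨l', h1, h2, h3, h4⟩ := h l hl hlA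
  obtain ⟨l'', g1, g2, g3, g4⟩ := h' l' h1 (by
    rintro f (hf | hf)
    exacts [h2 f (hlA f hf), h3 f hf])
  refine ⟨l'', g1, fun f hf => g2 f (h2 f hf), ?_, by omega⟩
  rintro f (hf | hf)
  exacts [g2 f (h3 f hf), g3 f hf]

theorem Extends.range {ι : Type*} [Fintype ι] {A : Set (S → ℝ)} {f : ι → S → ℝ} {k : ℕ}
    (h : ∀ i, Extends inp A {f i} k) : Extends inp A (Set.range f) (Fintype.card ι * k) := by
  classical
  have key : ∀ t : Finset ι, Extends inp A (f '' t) (t.card * k) := by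
    intro t
    induction t using Finset.induction with
    | empty => exact fun l hl _ => ⟨l, hl, fun _ h => h, by simp, by simp⟩
    | insert i t hi ih =>
      rw [Finset.card_insert_of_notMem hi, add_mul, one_mul]
      refine (ih.trans ((h i).mono Set.subset_union_left subset_rfl le_rfl)).mono subset_rfl ?_
        le_rfl
      rw [Finset.coe_insert, Set.image_insert_eq, Set.insert_eq, Set.union_comm]
  have := key Finset.univ
  rwa [Finset.coe_univ, Set.image_univ, Finset.card_univ] at this

theorem Extends.input {A : Set (S → ℝ)} {f : S → ℝ} (h : f ∈ inp) : Extends inp A {f} 1 :=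
  fun l hl _ => ⟨f :: l, hl.input h, fun _ h => List.mem_cons_of_mem _ h, by simp, by simp⟩

theorem Extends.const {A : Set (S → ℝ)} (q : ℚ) : Extends inp A {fun _ => (q : ℝ)} 1 :=
  fun l hl _ => ⟨_ :: l, hl.const q, fun _ h => List.mem_cons_of_mem _ h, by simp, by simp⟩

theorem Extends.add {A : Set (S → ℝ)} {f g : S → ℝ} {k m : ℕ} (hf : Extends inp A {f} k)
    (hg : Extends inp A {g} m) : Extends inp A {fun s => f s + g s} (k + m + 1) :=
  ((hf.trans (hg.mono Set.subset_union_left subset_rfl le_rfl)).trans (C := {fun s => f s + g s})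
    (m := 1) fun l hl h => ⟨_ :: l, hl.add (h f (by simp)) (h g (by simp)),
      fun _ h => List.mem_cons_of_mem _ h, by simp, by simp⟩).mono subset_rfl
    Set.subset_union_right le_rfl

theorem Extends.sub {A : Set (S → ℝ)} {f g : S → ℝ} {k m : ℕ} (hf : Extends inp A {f} k)
    (hg : Extends inp A {g} m) : Extends inp A {fun s => f s - g s} (k + m + 1) :=
  ((hf.trans (hg.mono Set.subset_union_left subset_rfl le_rfl)).trans (C := {fun s => f s - g s})
    (m := 1) fun l hl h => ⟨_ :: l, hl.sub (h f (by simp)) (h g (by simp)),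
      fun _ h => List.mem_cons_of_mem _ h, by simp, by simp⟩).mono subset_rfl
    Set.subset_union_right le_rfl

theorem Extends.mul {A : Set (S → ℝ)} {f g : S → ℝ} {k m : ℕ} (hf : Extends inp A {f} k)
    (hg : Extends inp A {g} m) : Extends inp A {fun s => f s * g s} (k + m + 1) :=
  ((hf.trans (hg.mono Set.subset_union_left subset_rfl le_rfl)).trans (C := {fun s => f s * g s})
    (m := 1) fun l hl h => ⟨_ :: l, hl.mul (h f (by simp)) (h g (by simp)),
      fun _ h => List.mem_cons_of_mem _ h, by simp, by simp⟩).mono subset_rfl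
    Set.subset_union_right le_rfl

theorem Extends.div {A : Set (S → ℝ)} {f g : S → ℝ} {k m : ℕ} (hf : Extends inp A {f} k)
    (hg : Extends inp A {g} m) (h0 : ∀ s, g s ≠ 0) :
    Extends inp A {fun s => f s / g s} (k + m + 1) :=
  ((hf.trans (hg.mono Set.subset_union_left subset_rfl le_rfl)).trans (C := {fun s => f s / g s})
    (m := 1) fun l hl h => ⟨_ :: l, hl.div (h f (by simp)) (h g (by simp)) h0,
      fun _ h => List.mem_cons_of_mem _ h, by simp, by simp⟩).mono subset_rfl
    Set.subset_union_right le_rfl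

theorem Extends.of_mem {A : Set (S → ℝ)} {f : S → ℝ} (h : f ∈ A) : Extends inp A {f} 0 :=
  fun l hl hA => ⟨l, hl, fun _ h => h, by simpa using hA f h, le_rfl⟩

theorem Extends.pow {A : Set (S → ℝ)} {f : S → ℝ} (h : f ∈ A) (n : ℕ) :
    Extends inp A {fun s => f s ^ n} (n + 1) := by
  induction n with
  | zero => simpa using Extends.const (A := A) (inp := inp) 1
  | succ n ih => simpa [pow_succ] using ih.mul (Extends.of_mem h)

theorem Extends.computableInSteps {f : S → ℝ} {k : ℕ} (h : Extends inp ∅ {f} k) :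
    ComputableInSteps inp f k := by
  obtain ⟨l, h1, -, h3, h4⟩ := h [] .nil (by simp)
  exact ⟨l, h1, by simpa using h4, h3 f rfl⟩

/-! ### Gaussian elimination without pivoting -/

/-- The Schur complement of the top left entry. -/
def schurComplement {n : ℕ} (M : Matrix (Fin (n + 1)) (Fin (n + 1)) ℝ) : Matrix (Fin n) (Fin n) ℝ :=
  Matrix.of fun i j => M i.succ j.succ - M i.succ 0 * M 0 j.succ / M 0 0

/-- One step of elimination: subtracting multiples of row `0` clears column `0` below the pivot
without changing the determinant. -/
theorem det_eq_mul_det_schurComplement {n : ℕ} {M : Matrix (Fin (n + 1)) (Fin (n + 1)) ℝ}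
    (h : M 0 0 ≠ 0) : M.det = M 0 0 * (schurComplement M).det := by
  set c : Fin (n + 1) → ℝ := Fin.cons 0 fun i => M i.succ 0 / M 0 0 with hc
  set B : Matrix (Fin (n + 1)) (Fin (n + 1)) ℝ := Matrix.of fun i j => M i j - c i * M 0 j with hB
  have hc0 : c 0 = 0 := rfl
  have hcs : ∀ i : Fin n, c i.succ = M i.succ 0 / M 0 0 := fun i => rfl
  have h1 : M.det = B.det := by
    refine det_eq_of_forall_row_eq_smul_add_const c 0 hc0 fun i j => ?_
    simp [hB, hc0]
  rw [h1, det_succ_column_zero, Fin.sum_univ_succ, Finset.sum_eq_zero, add_zero]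
  · have h2 : B.submatrix (Fin.succAbove 0) Fin.succ = schurComplement M := by
      ext i j
      simp [hB, hcs, schurComplement]
      ring
    rw [h2]
    simp [hB, hc0]
  · intro i _
    have : B i.succ 0 = 0 := by
      simp [hB, hcs]
      field_simp
      ring
    rw [this]
    ring

/-- Positivity of the quadratic form passes to the Schur complement, also for nonsymmetric `M`. So
every pivot met in the elimination is positive. -/
theorem schurComplement_pos {n : ℕ} {M : Matrix (Fin (n + 1)) (Fin (n + 1)) ℝ}
    (h : ∀ x, x ≠ 0 → 0 < x ⬝ᵥ M *ᵥ x) :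
    0 < M 0 0 ∧ ∀ y, y ≠ 0 → 0 < y ⬝ᵥ schurComplement M *ᵥ y := by
  have h0 : 0 < M 0 0 := by
    simpa using h (Pi.single 0 1) (by simp)
  refine ⟨h0, fun y hy => ?_⟩
  -- The first coordinate is chosen to make the first entry of `M x` vanish; the others then form
  -- the Schur complement applied to `y`.
  set x : Fin (n + 1) → ℝ := Fin.cons (-(∑ j, M 0 (Fin.succ j) * y j) / M 0 0) y with hx
  have hx0 : x ≠ 0 := fun h => hy (funext fun i => by
    have := congrFun h i.succ
    simpa [hx] using this)
  have h1 : (M *ᵥ x) 0 = 0 := by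
    rw [mulVec, dotProduct, Fin.sum_univ_succ]
    simp only [hx, Fin.cons_zero, Fin.cons_succ]
    field_simp
    ring
  have h2 : ∀ i : Fin n, (M *ᵥ x) i.succ = (schurComplement M *ᵥ y) i := by
    intro i
    rw [mulVec, mulVec, dotProduct, dotProduct, Fin.sum_univ_succ]
    simp only [hx, Fin.cons_zero, Fin.cons_succ, schurComplement, Matrix.of_apply, sub_mul,
      Finset.sum_sub_distrib]
    have : ∑ j, M i.succ 0 * M 0 (Fin.succ j) / M 0 0 * y j =
        M i.succ 0 / M 0 0 * ∑ j, M 0 (Fin.succ j) * y j := by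
      rw [Finset.mul_sum]
      exact Finset.sum_congr rfl fun j _ => by ring
    rw [this]
    ring
  have h3 := h x hx0
  rw [dotProduct, Fin.sum_univ_succ, h1, mul_zero, zero_add] at h3
  simp only [h2] at h3
  simp only [hx, Fin.cons_succ] at h3
  exact h3

theorem det_pos_of_pos {n : ℕ} {M : Matrix (Fin n) (Fin n) ℝ}
    (h : ∀ x, x ≠ 0 → 0 < x ⬝ᵥ M *ᵥ x) : 0 < M.det := by
  induction n with
  | zero => simp
  | succ n ih =>
    obtain ⟨h0, h1⟩ := schurComplement_pos h
    rw [det_eq_mul_det_schurComplement h0.ne']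
    exact mul_pos h0 (ih h1)

/-- A Schur complement of size `n` costs `3n²` steps and the product with the pivot one more; summed
over the recursion this stays below the cubic bound. Positivity for every `s` licenses the
divisions. -/
theorem Extends.det {n : ℕ} {A : Set (S → ℝ)} {M : S → Matrix (Fin n) (Fin n) ℝ}
    (hA : ∀ i j, (fun s => M s i j) ∈ A) (h : ∀ s x, x ≠ 0 → 0 < x ⬝ᵥ M s *ᵥ x) :
    Extends inp A {fun s => (M s).det} (3 * (n + 1) ^ 3) := by
  induction n generalizing A with
  | zero =>
    have := Extends.const (A := A) (inp := inp) 1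
    refine this.mono subset_rfl ?_ (by norm_num)
    simp
  | succ n ih =>
    have hent : ∀ p : Fin n × Fin n,
        Extends inp A {fun s => schurComplement (M s) p.1 p.2} 3 := fun p =>
      (Extends.of_mem (hA p.1.succ p.2.succ)).sub
        (((Extends.of_mem (hA p.1.succ 0)).mul (Extends.of_mem (hA 0 p.2.succ))).div
          (Extends.of_mem (hA 0 0)) fun s => (schurComplement_pos (h s)).1.ne')
    have h1 := Extends.range hent
    have h2 := ih (A := A ∪ Set.range fun (p : Fin n × Fin n) s => schurComplement (M s) p.1 p.2)
      (M := fun s => schurComplement (M s)) (fun i j => Or.inr ⟨(i, j), rfl⟩)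
      fun s => (schurComplement_pos (h s)).2
    have h3 := (Extends.of_mem (inp := inp) (hA 0 0)).mul ((h1.trans h2).mono subset_rfl
      Set.subset_union_right le_rfl)
    have h4 : (fun s => (M s).det) = fun s => M s 0 0 * (schurComplement (M s)).det := by
      funext s
      exact det_eq_mul_det_schurComplement (schurComplement_pos (h s)).1.ne'
    rw [h4]
    refine h3.mono subset_rfl subset_rfl ?_
    simp only [Fintype.card_prod, Fintype.card_fin]
    nlinarith

/-! ### The determinants on the Cayley path of an orthogonal matrix -/

/-- The matrix `(1 + Gᵀ) ((1 + θ) + (1 - θ) G)` for an orthogonal matrix `G`. -/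
def cayleyGram {n : ℕ} (G : Matrix (Fin n) (Fin n) ℝ) (θ : ℝ) : Matrix (Fin n) (Fin n) ℝ :=
  Matrix.of fun i j => ((if i = j then 2 else 0) + (G i j + G j i)) + θ * (G j i - G i j)

theorem cayleyGram_eq {n : ℕ} {G : Matrix (Fin n) (Fin n) ℝ} (hG : Gᵀ * G = 1) (θ : ℝ) :
    cayleyGram G θ = (1 + G)ᵀ * ((1 + θ) • (1 : Matrix (Fin n) (Fin n) ℝ) + (1 - θ) • G) := by
  have h : (1 + G)ᵀ * ((1 + θ) • (1 : Matrix (Fin n) (Fin n) ℝ) + (1 - θ) • G) =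
      (2 : ℝ) • 1 + (G + Gᵀ) + θ • (Gᵀ - G) := by
    rw [transpose_add, transpose_one, Matrix.add_mul, Matrix.one_mul, Matrix.mul_add,
      Matrix.mul_smul, Matrix.mul_smul, hG, Matrix.mul_one]
    module
  rw [h]
  ext i j
  simp [cayleyGram, Matrix.one_apply]

/-- The part proportional to `θ` is antisymmetric and drops out of the quadratic form; what remains
is `‖(1 + G)x‖²`. -/
theorem cayleyGram_pos {n : ℕ} {G : Matrix (Fin n) (Fin n) ℝ} (hG : Gᵀ * G = 1)
    (hdet : (1 + G).det ≠ 0) (θ : ℝ) {x : Fin n → ℝ} (hx : x ≠ 0) :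
    0 < x ⬝ᵥ cayleyGram G θ *ᵥ x := by
  have h0 : (1 + G) *ᵥ x ≠ 0 := fun h => hx (eq_zero_of_mulVec_eq_zero hdet h)
  have h1 : 0 < ((1 + G) *ᵥ x) ⬝ᵥ ((1 + G) *ᵥ x) :=
    lt_of_le_of_ne (Finset.sum_nonneg fun i _ => mul_self_nonneg _)
      fun h => h0 (dotProduct_self_eq_zero.1 h.symm)
  have h2 : (G *ᵥ x) ⬝ᵥ (G *ᵥ x) = x ⬝ᵥ x := by
    rw [dotProduct_mulVec, ← vecMul_transpose, vecMul_vecMul, hG, vecMul_one]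
  have h3 : x ⬝ᵥ Gᵀ *ᵥ x = x ⬝ᵥ G *ᵥ x := by
    rw [mulVec_transpose, dotProduct_comm, dotProduct_mulVec]
  have h4 : cayleyGram G θ = (2 : ℝ) • 1 + (G + Gᵀ) + θ • (Gᵀ - G) := by
    ext i j
    simp [cayleyGram, Matrix.one_apply]
  have h5 : x ⬝ᵥ cayleyGram G θ *ᵥ x = ((1 + G) *ᵥ x) ⬝ᵥ ((1 + G) *ᵥ x) := by
    rw [h4]
    simp only [add_mulVec, sub_mulVec, smul_mulVec, one_mulVec, dotProduct_add, add_dotProduct,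
      dotProduct_sub, dotProduct_smul, h2, h3, dotProduct_comm (G *ᵥ x) x, smul_eq_mul]
    ring
  rw [h5]
  exact h1

/-- The factor `(1 + G)ᵀ`, introduced only to obtain positive pivots, cancels in the ratio. -/
theorem det_cayleyGram_div {n : ℕ} {G : Matrix (Fin n) (Fin n) ℝ} (hG : Gᵀ * G = 1)
    (hdet : (1 + G).det ≠ 0) (θ : ℝ) :
    (cayleyGram G θ).det / (cayleyGram G 0).det =
      ((1 + θ) • (1 : Matrix (Fin n) (Fin n) ℝ) + (1 - θ) • G).det / (1 + G).det := by
  rw [cayleyGram_eq hG, cayleyGram_eq hG, det_mul, det_mul, det_transpose,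
    mul_div_mul_left _ _ hdet]
  simp

theorem Extends.cayleyRatio_pow {n : ℕ} {A : Set (S → ℝ)} {G : S → Matrix (Fin n) (Fin n) ℝ}
    {θ : S → ℝ} (hA : ∀ i j, (fun s => G s i j) ∈ A) (hθ : θ ∈ A) (hG : ∀ s, (G s)ᵀ * G s = 1)
    (hdet : ∀ s, (1 + G s).det ≠ 0) (m : ℕ) :
    Extends inp A {fun s => ((cayleyGram (G s) (θ s)).det / (cayleyGram (G s) 0).det) ^ m}
      (9 * n ^ 2 + 6 * (n + 1) ^ 3 + m + 2) := by
  have hsym : ∀ p : Fin n × Fin n, Extends inp A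
      {fun s => (if p.1 = p.2 then 2 else 0) + (G s p.1 p.2 + G s p.2 p.1)} 3 := by
    intro p
    have h1 := (Extends.const (A := A) (inp := inp) (if p.1 = p.2 then 2 else 0)).add
      ((Extends.of_mem (hA p.1 p.2)).add (Extends.of_mem (hA p.2 p.1)))
    refine h1.mono subset_rfl (Set.singleton_subset_singleton.2 ?_) le_rfl
    funext s
    split_ifs <;> simp
  have hent : ∀ p : Fin n × Fin n, Extends inp A {fun s => cayleyGram (G s) (θ s) p.1 p.2} 6 :=
    fun p => (hsym p).add ((Extends.of_mem hθ).mul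
      ((Extends.of_mem (hA p.2 p.1)).sub (Extends.of_mem (hA p.1 p.2))))
  have hent0 : ∀ p : Fin n × Fin n, Extends inp A {fun s => cayleyGram (G s) 0 p.1 p.2} 3 := by
    intro p
    refine (hsym p).mono subset_rfl (Set.singleton_subset_singleton.2 ?_) le_rfl
    funext s
    simp [cayleyGram]
  have hd : ∀ τ : S → ℝ, ∀ B : Set (S → ℝ), (∀ i j, (fun s => cayleyGram (G s) (τ s) i j) ∈ B) →
      Extends inp B {fun s => (cayleyGram (G s) (τ s)).det} (3 * (n + 1) ^ 3) :=
    fun τ B hB => Extends.det hB fun s x hx => cayleyGram_pos (hG s) (hdet s) _ hx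
  have h1 := ((Extends.range hent).trans (hd θ _ fun i j => Or.inr ⟨(i, j), rfl⟩)).mono
    subset_rfl Set.subset_union_right le_rfl
  have h2 := ((Extends.range hent0).trans (hd 0 _ fun i j => Or.inr ⟨(i, j), rfl⟩)).mono
    subset_rfl Set.subset_union_right le_rfl
  have h3 := h1.div h2 fun s => (det_pos_of_pos fun x hx =>
    cayleyGram_pos (hG s) (hdet s) _ hx).ne'
  have h4 := (h3.trans (Extends.pow (Or.inr rfl) m)).mono subset_rfl Set.subset_union_right le_rfl
  refine h4.mono subset_rfl subset_rfl ?_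
  simp only [Fintype.card_prod, Fintype.card_fin]
  nlinarith

end StraightLine

end FLO
end

noncomputable section
namespace FLO

/-! ### Realification -/

/-- A complex matrix as a real matrix of twice the size. -/
def realify {d : ℕ} (g : Matrix (Fin d) (Fin d) ℂ) : Matrix (Fin (d + d)) (Fin (d + d)) ℝ :=
  (fromBlocks (g.map Complex.re) (-g.map Complex.im) (g.map Complex.im)
    (g.map Complex.re)).submatrix finSumFinEquiv.symm finSumFinEquiv.symm

theorem realify_mul {d : ℕ} (g h : Matrix (Fin d) (Fin d) ℂ) :
    realify (g * h) = realify g * realify h := by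
  have hre : (g * h).map Complex.re =
      g.map Complex.re * h.map Complex.re - g.map Complex.im * h.map Complex.im := by
    ext i j
    simp [Matrix.mul_apply, Finset.sum_sub_distrib]
  have him : (g * h).map Complex.im =
      g.map Complex.re * h.map Complex.im + g.map Complex.im * h.map Complex.re := by
    ext i j
    simp [Matrix.mul_apply, Finset.sum_add_distrib]
  rw [realify, realify, realify, submatrix_mul_equiv, fromBlocks_multiply, hre, him]
  congr 1
  simp only [Matrix.mul_neg, Matrix.neg_mul]
  congr 1 <;> abel

theorem realify_one (d : ℕ) : realify (1 : Matrix (Fin d) (Fin d) ℂ) = 1 := by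
  have hre : (1 : Matrix (Fin d) (Fin d) ℂ).map Complex.re = 1 := by
    ext i j
    by_cases h : i = j <;> simp [h, Matrix.one_apply]
  have him : (1 : Matrix (Fin d) (Fin d) ℂ).map Complex.im = 0 := by
    ext i j
    by_cases h : i = j <;> simp [h]
  rw [realify, hre, him, neg_zero, fromBlocks_one, submatrix_one_equiv]

theorem realify_smul_add_smul {d : ℕ} (a b : ℝ) (g h : Matrix (Fin d) (Fin d) ℂ) :
    realify (a • g + b • h) = a • realify g + b • realify h := by
  ext i j
  simp only [realify, submatrix_apply, Matrix.add_apply, Matrix.smul_apply]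
  rcases finSumFinEquiv.symm i with i | i <;> rcases finSumFinEquiv.symm j with j | j <;>
    simp <;> ring

theorem realify_conjTranspose {d : ℕ} (g : Matrix (Fin d) (Fin d) ℂ) :
    realify gᴴ = (realify g)ᵀ := by
  rw [realify, realify, transpose_submatrix, fromBlocks_transpose]
  congr 1
  congr 1
  · ext i j
    simp

/-- Over `ℂ` the real block matrix is conjugate, by unipotent block matrices, to a block triangular
one with diagonal blocks `g` and its entrywise conjugate. -/
theorem det_realify {d : ℕ} (g : Matrix (Fin d) (Fin d) ℂ) :
    (realify g).det = Complex.normSq g.det := by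
  rw [realify, det_submatrix_equiv_self]
  set A : Matrix (Fin d) (Fin d) ℂ := (g.map Complex.re).map Complex.ofRealHom with hA
  set B : Matrix (Fin d) (Fin d) ℂ := (g.map Complex.im).map Complex.ofRealHom with hB
  have hg : A + Complex.I • B = g := by
    ext i j
    simp [hA, hB, mul_comm Complex.I]
  have hg' : A - Complex.I • B = g.map (starRingEnd ℂ) := by
    ext i j
    apply Complex.ext <;> simp [hA, hB]
  have h1 : fromBlocks 1 0 (Complex.I • 1) 1 * fromBlocks A (-B) B A *
      fromBlocks 1 0 (-Complex.I • 1) 1 = fromBlocks g (-B) 0 (g.map (starRingEnd ℂ)) := by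
    rw [← hg', ← hg, fromBlocks_multiply, fromBlocks_multiply]
    congr 1
    · simp
    · simp
    · simp only [Matrix.smul_mul, Matrix.mul_smul, Matrix.one_mul, Matrix.mul_one, Matrix.mul_neg,
        smul_neg, smul_add, neg_smul, smul_smul, Complex.I_mul_I]
      simp
      abel
    · simp
      abel
  have h2 := congrArg Matrix.det h1
  rw [det_mul, det_mul, det_fromBlocks_zero₁₂, det_fromBlocks_zero₁₂, det_fromBlocks_zero₂₁,
    det_one, one_mul, one_mul, mul_one] at h2
  have h3 : (g.map (starRingEnd ℂ)).det = (starRingEnd ℂ) g.det := (RingHom.map_det _ _).symm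
  rw [h3, Complex.mul_conj] at h2
  have h4 : fromBlocks A (-B) B A = (fromBlocks (g.map Complex.re) (-g.map Complex.im)
      (g.map Complex.im) (g.map Complex.re)).map Complex.ofRealHom := by
    rw [fromBlocks_map, hA, hB]
    congr 1
    ext i j
    simp
  have h5 := RingHom.map_det Complex.ofRealHom (fromBlocks (g.map Complex.re)
    (-g.map Complex.im) (g.map Complex.im) (g.map Complex.re))
  rw [RingHom.mapMatrix_apply, ← h4, h2] at h5
  exact Complex.ofReal_injective h5

/-! ### Computing the denominators -/

theorem normSq_cayley_den (θ : ℝ) {z : ℂ} (hz : ‖z‖ = 1) (h : z ≠ -1) :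
    Complex.normSq ((1 + θ : ℝ) + (1 - θ : ℝ) * z) =
      Complex.normSq (1 + z) * cayleyWeight θ z := by
  have h2 : (1 + z) ≠ 0 := fun h' => h (by linear_combination h')
  rw [← normSq_one_add_mul_kappa θ hz, ← Complex.normSq_mul]
  congr 1
  rw [kappa]
  push_cast
  field_simp
  ring

theorem det_one_add_ne_zero {𝕜 n : Type*} [Field 𝕜] [Fintype n] [DecidableEq n]
    {G : Matrix n n 𝕜} (h : (-1 : 𝕜) ∉ spectrum 𝕜 G) : (1 + G).det ≠ 0 := by
  rw [spectrum.notMem_iff] at h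
  have h1 : algebraMap 𝕜 (Matrix n n 𝕜) (-1) - G = -(1 + G) := by
    rw [map_neg, map_one]
    abel
  rw [h1, IsUnit.neg_iff, isUnit_iff_isUnit_det] at h
  exact h.ne_zero

theorem prod_cayley_den_div {d : ℕ} {z : Fin d → ℂ} (hz : ∀ j, ‖z j‖ = 1) (h : ∀ j, 1 + z j ≠ 0)
    (θ : ℝ) : (∏ j, Complex.normSq ((1 + θ : ℝ) + (1 - θ : ℝ) * z j)) /
      (∏ j, Complex.normSq (((1 : ℝ) : ℂ) + (1 : ℝ) * z j)) = ∏ j, cayleyWeight θ (z j) := by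
  have h1 : ∀ j, z j ≠ -1 := fun j h' => h j (by rw [h']; ring)
  have h2 : ∏ j, Complex.normSq (1 + z j) ≠ 0 :=
    Finset.prod_ne_zero_iff.2 fun j _ => (Complex.normSq_pos.2 (h j)).ne'
  simp only [normSq_cayley_den θ (hz _) (h1 _), Finset.prod_mul_distrib, Complex.ofReal_one,
    one_mul]
  rw [mul_div_cancel_left₀ _ h2]

theorem realify_orthogonal {d : ℕ} (g : Matrix.unitaryGroup (Fin d) ℂ) :
    (realify (g : Matrix (Fin d) (Fin d) ℂ))ᵀ * realify (g : Matrix (Fin d) (Fin d) ℂ) = 1 := by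
  have h : (g : Matrix (Fin d) (Fin d) ℂ)ᴴ * (g : Matrix (Fin d) (Fin d) ℂ) = 1 :=
    Unitary.coe_star_mul_self g
  rw [← realify_conjTranspose, ← realify_mul, h, realify_one]

theorem det_smul_one_add_smul_realify {d : ℕ} (g : Matrix (Fin d) (Fin d) ℂ) (a b : ℝ) :
    (a • (1 : Matrix (Fin (d + d)) (Fin (d + d)) ℝ) + b • realify g).det =
      Complex.normSq (a • (1 : Matrix (Fin d) (Fin d) ℂ) + b • g).det := by
  rw [← det_realify, realify_smul_add_smul, realify_one]

theorem det_one_add_realify_ne_zero {d : ℕ} {g : Matrix (Fin d) (Fin d) ℂ}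
    (hg : (1 + g).det ≠ 0) : (1 + realify g).det ≠ 0 := by
  have := det_smul_one_add_smul_realify g 1 1
  rw [one_smul, one_smul, one_smul, one_smul] at this
  rw [this]
  exact (Complex.normSq_pos.2 hg).ne'

/-- Realification turns determinants into squared moduli, and `(1 + θ) + (1 - θ)z = (1 + z)(1 + θκ)`
for each eigenvalue. The ratio is therefore `∏ |1 + θκ_j|²`. -/
theorem denominator_eval_passive {d n : ℕ} {g : Matrix.unitaryGroup (Fin d) ℂ}
    (hg1 : (1 + (g : Matrix (Fin d) (Fin d) ℂ)).det ≠ 0) {φ : Fin d → ℝ}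
    (hφ : IsPhasesU (g : Matrix (Fin d) (Fin d) ℂ) φ) (θ : ℝ) :
    ((cayleyGram (realify (g : Matrix (Fin d) (Fin d) ℂ)) θ).det /
        (cayleyGram (realify (g : Matrix (Fin d) (Fin d) ℂ)) 0).det) ^ n =
      (denominator φ n).eval θ := by
  obtain ⟨U, z, hz, hg⟩ := exists_unitary_diagonalization g
  have hUU : (U : Matrix (Fin d) (Fin d) ℂ) * (U : Matrix (Fin d) (Fin d) ℂ)ᴴ = 1 :=
    Unitary.coe_mul_star_self U
  have hUU' : (U : Matrix (Fin d) (Fin d) ℂ)ᴴ * (U : Matrix (Fin d) (Fin d) ℂ) = 1 :=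
    Unitary.coe_star_mul_self U
  have hchar : ∏ j, (Polynomial.X - Polynomial.C (z j)) =
      ∏ j, (Polynomial.X - Polynomial.C (Complex.exp (φ j * Complex.I))) := by
    rw [← hφ.2, hg, charpoly_mul_comm, ← Matrix.mul_assoc, hUU', Matrix.one_mul, charpoly_diagonal]
  have hdet : ∀ a b : ℝ, (a • (1 : Matrix (Fin d) (Fin d) ℂ) +
      b • (g : Matrix (Fin d) (Fin d) ℂ)).det = ∏ j, ((a : ℂ) + b * z j) := by
    intro a b
    rw [hg, smul_one_add_smul_conj_diagonal, det_conj_of_mul_eq_one hUU hUU', det_diagonal]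
  have h1 := hdet 1 1
  rw [one_smul, one_smul] at h1
  have hz1 : ∀ j, 1 + z j ≠ 0 := by
    rw [h1, Finset.prod_ne_zero_iff] at hg1
    intro j
    simpa using hg1 j (Finset.mem_univ j)
  have h2 := det_smul_one_add_smul_realify (g : Matrix (Fin d) (Fin d) ℂ) 1 1
  rw [one_smul, one_smul, one_smul, one_smul] at h2
  rw [det_cayleyGram_div (realify_orthogonal g) (det_one_add_realify_ne_zero hg1), h2,
    det_smul_one_add_smul_realify, hdet, h1, map_prod, map_prod, prod_cayley_den_div hz hz1,
    denominator_eval, prod_eq_of_prod_X_sub_C_eq hchar (cayleyWeight θ)]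

/-- No realification is needed: the determinant of a real matrix acting by planar rotations and
scalings is already a product of squared moduli, one per conjugate pair. -/
theorem denominator_eval_active {d : ℕ} {g : Matrix.specialOrthogonalGroup (Fin (2 * d)) ℝ}
    (hg1 : (1 + (g : Matrix (Fin (2 * d)) (Fin (2 * d)) ℝ)).det ≠ 0) {φ : Fin d → ℝ}
    (hφ : IsPhasesSO (g : Matrix (Fin (2 * d)) (Fin (2 * d)) ℝ) φ) (θ : ℝ) :
    ((cayleyGram (g : Matrix (Fin (2 * d)) (Fin (2 * d)) ℝ) θ).det /
        (cayleyGram (g : Matrix (Fin (2 * d)) (Fin (2 * d)) ℝ) 0).det) ^ d =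
      (denominator φ d).eval θ := by
  have hGG : (g : Matrix (Fin (2 * d)) (Fin (2 * d)) ℝ)ᵀ * g = 1 :=
    (Matrix.mem_orthogonalGroup_iff' _ _).1 (Matrix.mem_specialOrthogonalGroup_iff.1 g.2).1
  obtain ⟨R, z, hR, hR', hz, hg⟩ := exists_rotation_form g
  rw [← rotationHom_apply hR hR'] at hg
  have hchar := hφ.2
  rw [hg, charpoly_rotationHom] at hchar
  have hdet : ∀ a b : ℝ, (a • (1 : Matrix (Fin (2 * d)) (Fin (2 * d)) ℝ) +
      b • (g : Matrix (Fin (2 * d)) (Fin (2 * d)) ℝ)).det =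
      ∏ j, Complex.normSq ((a : ℂ) + b * z j) := by
    intro a b
    rw [hg, smul_one_add_smul_rotationHom, det_rotationHom]
  have h1 := hdet 1 1
  rw [one_smul, one_smul] at h1
  have hz1 : ∀ j, 1 + z j ≠ 0 := by
    have h2 := hg1
    rw [h1, Finset.prod_ne_zero_iff] at h2
    intro j
    simpa using h2 j (Finset.mem_univ j)
  rw [det_cayleyGram_div hGG hg1, hdet, h1, prod_cayley_den_div hz hz1,
    prod_cayleyWeight_eq_denominator (prod_conj_pairs hchar), denominator_eval, denominator_eval,
    pow_one]

theorem exists_computable_denominator_passive (d n : ℕ) :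
    ∃ F : DomU d → ℝ,
      ComputableInSteps (inputsU d) F (21 * (d + d) ^ 2 + 6 * (d + d + 1) ^ 3 + n + 3) ∧
      ∀ (s : DomU d) (φ : Fin d → ℝ), IsPhasesU (s.1.1 : Matrix (Fin d) (Fin d) ℂ) φ →
        F s = (denominator φ n).eval s.2 := by
  have hdet : ∀ s : DomU d, (1 + (s.1.1 : Matrix (Fin d) (Fin d) ℂ)).det ≠ 0 :=
    fun s => det_one_add_ne_zero s.1.2
  refine ⟨fun s => ((cayleyGram (realify (s.1.1 : Matrix (Fin d) (Fin d) ℂ)) s.2).det /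
    (cayleyGram (realify (s.1.1 : Matrix (Fin d) (Fin d) ℂ)) 0).det) ^ n, ?_,
    fun s φ hφ => denominator_eval_passive (hdet s) hφ s.2⟩
  have hre : ∀ i j, Extends (inputsU d) ∅
      {fun s : DomU d => ((s.1.1 : Matrix (Fin d) (Fin d) ℂ) i j).re} 1 :=
    fun i j => Extends.input (Or.inl ⟨i, j, rfl⟩)
  have him : ∀ i j, Extends (inputsU d) ∅
      {fun s : DomU d => ((s.1.1 : Matrix (Fin d) (Fin d) ℂ) i j).im} 1 :=
    fun i j => Extends.input (Or.inr (Or.inl ⟨i, j, rfl⟩))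
  have hent : ∀ p : Fin (d + d) × Fin (d + d), Extends (inputsU d) ∅
      {fun s : DomU d => realify (s.1.1 : Matrix (Fin d) (Fin d) ℂ) p.1 p.2} 3 := by
    intro p
    simp only [realify, submatrix_apply]
    rcases finSumFinEquiv.symm p.1 with i | i <;> rcases finSumFinEquiv.symm p.2 with j | j
    · exact (hre i j).mono subset_rfl subset_rfl (by norm_num)
    · refine ((Extends.const 0).sub (him i j)).mono subset_rfl
        (Set.singleton_subset_singleton.2 ?_) le_rfl
      funext s
      simp
    · exact (him i j).mono subset_rfl subset_rfl (by norm_num)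
    · exact (hre i j).mono subset_rfl subset_rfl (by norm_num)
  have hθ : Extends (inputsU d) ∅ {fun s : DomU d => s.2} 1 :=
    Extends.input (Or.inr (Or.inr rfl))
  have h1 := (Extends.range hent).trans (hθ.mono (Set.empty_subset _) subset_rfl le_rfl)
  have h2 := h1.trans (Extends.cayleyRatio_pow (n := d + d)
    (G := fun s : DomU d => realify (s.1.1 : Matrix (Fin d) (Fin d) ℂ)) (θ := fun s => s.2)
    (fun i j => Or.inr (Or.inl ⟨(i, j), rfl⟩)) (Or.inr (Or.inr rfl))
    (fun s => realify_orthogonal s.1.1) (fun s => det_one_add_realify_ne_zero (hdet s)) n)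
  refine (h2.mono subset_rfl Set.subset_union_right ?_).computableInSteps
  simp only [Fintype.card_prod, Fintype.card_fin]
  nlinarith

theorem exists_computable_denominator_active (d : ℕ) :
    ∃ F : DomSO d → ℝ,
      ComputableInSteps (inputsSO d) F (10 * (2 * d) ^ 2 + 6 * (2 * d + 1) ^ 3 + d + 3) ∧
      ∀ (s : DomSO d) (φ : Fin d → ℝ),
        IsPhasesSO (s.1.1 : Matrix (Fin (2 * d)) (Fin (2 * d)) ℝ) φ →
        F s = (denominator φ d).eval s.2 := by
  have hdet : ∀ s : DomSO d, (1 + (s.1.1 : Matrix (Fin (2 * d)) (Fin (2 * d)) ℝ)).det ≠ 0 :=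
    fun s => det_one_add_ne_zero s.1.2
  have hGG : ∀ s : DomSO d, (s.1.1 : Matrix (Fin (2 * d)) (Fin (2 * d)) ℝ)ᵀ * s.1.1 = 1 :=
    fun s => (Matrix.mem_orthogonalGroup_iff' _ _).1
      (Matrix.mem_specialOrthogonalGroup_iff.1 s.1.1.2).1
  refine ⟨fun s => ((cayleyGram (s.1.1 : Matrix (Fin (2 * d)) (Fin (2 * d)) ℝ) s.2).det /
    (cayleyGram (s.1.1 : Matrix (Fin (2 * d)) (Fin (2 * d)) ℝ) 0).det) ^ d, ?_,
    fun s φ hφ => denominator_eval_active (hdet s) hφ s.2⟩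
  have hent : ∀ p : Fin (2 * d) × Fin (2 * d), Extends (inputsSO d) ∅
      {fun s : DomSO d => (s.1.1 : Matrix (Fin (2 * d)) (Fin (2 * d)) ℝ) p.1 p.2} 1 :=
    fun p => Extends.input (Or.inl ⟨p.1, p.2, rfl⟩)
  have hθ : Extends (inputsSO d) ∅ {fun s : DomSO d => s.2} 1 := Extends.input (Or.inr rfl)
  have h1 := (Extends.range hent).trans (hθ.mono (Set.empty_subset _) subset_rfl le_rfl)
  have h2 := h1.trans (Extends.cayleyRatio_pow (n := 2 * d)
    (G := fun s : DomSO d => (s.1.1 : Matrix (Fin (2 * d)) (Fin (2 * d)) ℝ)) (θ := fun s => s.2)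
    (fun i j => Or.inr (Or.inl ⟨(i, j), rfl⟩)) (Or.inr (Or.inr rfl)) hGG hdet d)
  refine (h2.mono subset_rfl Set.subset_union_right ?_).computableInSteps
  simp only [Fintype.card_prod, Fintype.card_fin]
  nlinarith

end FLO
end

/-! ### Assembly of the passive, active and computational statements. -/

theorem mainTheorem9 :
    -- passive FLO
    (∀ (d n : ℕ) (g : Matrix.unitaryGroup (Fin d) ℂ),
      (∃ φ : Fin d → ℝ, FLO.IsPhasesU (g : Matrix (Fin d) (Fin d) ℂ) φ) ∧
      ∀ φ : Fin d → ℝ, FLO.IsPhasesU (g : Matrix (Fin d) (Fin d) ℂ) φ →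
        (∀ θ : ℝ, 0 < (FLO.denominator φ n).eval θ) ∧
        (FLO.denominator φ n).natDegree ≤ 2 * d * n ∧
        ((∀ j, φ j ≠ 0 ∧ φ j ≠ Real.pi) → (FLO.denominator φ n).natDegree = 2 * d * n) ∧
        ∀ (g₀ : Matrix.unitaryGroup (Fin d) ℂ) (x : Fin n ↪o Fin d)
          (Ψ : (Fin n → Fin d) → ℂ), Ψ ∈ FLO.antisymm d n →
          ∃ D : Polynomial ℝ,
            D.natDegree ≤ 2 * d * n ∧
            ((∀ j, φ j ≠ 0 ∧ φ j ≠ Real.pi) → D.eval 0 ≠ 0 → D.natDegree = 2 * d * n) ∧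
            ∀ θ ∈ Set.Icc (0 : ℝ) 1, (θ = 0 → ∀ j, φ j ≠ Real.pi) →
              FLO.outcomeProb (FLO.fockWedge x) Ψ
                  (FLO.tensorPow n
                    ((g₀ : Matrix (Fin d) (Fin d) ℂ) *
                      FLO.cayleyF θ (g : Matrix (Fin d) (Fin d) ℂ))) =
                ((D.eval θ / (FLO.denominator φ n).eval θ : ℝ) : ℂ)) ∧
    -- active FLO
    (∀ (d : ℕ) (g : Matrix.specialOrthogonalGroup (Fin (2 * d)) ℝ),
      (∃ φ : Fin d → ℝ, FLO.IsPhasesSO (g : Matrix (Fin (2 * d)) (Fin (2 * d)) ℝ) φ) ∧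
      ∀ φ : Fin d → ℝ, FLO.IsPhasesSO (g : Matrix (Fin (2 * d)) (Fin (2 * d)) ℝ) φ →
        (∀ θ : ℝ, 0 < (FLO.denominator φ d).eval θ) ∧
        (FLO.denominator φ d).natDegree ≤ 2 * d ^ 2 ∧
        ((∀ j, φ j ≠ 0 ∧ φ j ≠ Real.pi) → (FLO.denominator φ d).natDegree = 2 * d ^ 2) ∧
        ∀ (g₀ : Matrix.specialOrthogonalGroup (Fin (2 * d)) ℝ) (x : Finset (Fin d))
          (Ψ : Finset (Fin d) → ℂ), Even x.card → Ψ ∈ FLO.evenFock d →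
          ∃ D : Polynomial ℝ,
            D.natDegree ≤ 2 * d ^ 2 ∧
            ((∀ j, φ j ≠ 0 ∧ φ j ≠ Real.pi) → D.eval 0 ≠ 0 → D.natDegree = 2 * d ^ 2) ∧
            ∀ θ ∈ Set.Icc (0 : ℝ) 1, (θ = 0 → ∀ j, φ j ≠ Real.pi) →
              (∃ V : FLO.FockOp d, FLO.IsPiAct
                ((g₀ : Matrix (Fin (2 * d)) (Fin (2 * d)) ℝ) *
                  FLO.cayleyF θ (g : Matrix (Fin (2 * d)) (Fin (2 * d)) ℝ)) V) ∧
              ∀ V : FLO.FockOp d, FLO.IsPiAct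
                ((g₀ : Matrix (Fin (2 * d)) (Fin (2 * d)) ℝ) *
                  FLO.cayleyF θ (g : Matrix (Fin (2 * d)) (Fin (2 * d)) ℝ)) V →
                FLO.outcomeProb (Pi.single x 1) Ψ V =
                  ((D.eval θ / (FLO.denominator φ d).eval θ : ℝ) : ℂ)) ∧
    -- the denominators are computed from `g` and `θ` in polynomially many arithmetic steps
    (∃ C c : ℕ, ∀ d : ℕ,
      (∀ n ≤ d, ∃ F : FLO.DomU d → ℝ,
        FLO.ComputableInSteps (FLO.inputsU d) F (C * (d + 1) ^ c) ∧
        ∀ (s : FLO.DomU d) (φ : Fin d → ℝ),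
          FLO.IsPhasesU (s.1.1 : Matrix (Fin d) (Fin d) ℂ) φ →
          F s = (FLO.denominator φ n).eval s.2) ∧
      (∃ F : FLO.DomSO d → ℝ,
        FLO.ComputableInSteps (FLO.inputsSO d) F (C * (d + 1) ^ c) ∧
        ∀ (s : FLO.DomSO d) (φ : Fin d → ℝ),
          FLO.IsPhasesSO (s.1.1 : Matrix (Fin (2 * d)) (Fin (2 * d)) ℝ) φ →
          F s = (FLO.denominator φ d).eval s.2)) := by
  refine ⟨fun d n g => ⟨FLO.exists_isPhasesU g, fun φ hφ => ⟨FLO.denominator_eval_pos φ n,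
    FLO.natDegree_denominator_le φ n, FLO.natDegree_denominator n hφ.1, fun g₀ x Ψ _ => ?_⟩⟩,
    fun d g => ⟨FLO.exists_isPhasesSO g, fun φ hφ => ⟨FLO.denominator_eval_pos φ d,
    (FLO.natDegree_denominator_le φ d).trans_eq (by ring),
    fun h => (FLO.natDegree_denominator d hφ.1 h).trans (by ring),
    fun g₀ x Ψ _ hΨ => ?_⟩⟩, 200, 3, fun d => ⟨fun n hn => ?_, ?_⟩⟩
  · obtain ⟨D, h1, h2, h3⟩ := FLO.exists_polynomial_outcomeProb_passive hφ
      (g₀ : Matrix (Fin d) (Fin d) ℂ) (FLO.fockWedge x) Ψ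
    exact ⟨D, h1, h2, fun θ _ => h3 θ⟩
  · obtain ⟨D, h1, h2, h3⟩ := FLO.exists_polynomial_outcomeProb_active hφ g₀ (Pi.single x 1) hΨ
    exact ⟨D, h1, h2, fun θ _ => h3 θ⟩
  -- The bound is cubic in `d` because `n ≤ d`; the constants `200` and `3` are generous and cover
  -- both cases.
  · obtain ⟨F, ⟨l, hl, hlen, hF⟩, h⟩ := FLO.exists_computable_denominator_passive d n
    refine ⟨F, ⟨l, hl, hlen.trans ?_, hF⟩, h⟩
    nlinarith [sq_nonneg d, Nat.zero_le (d ^ 3)]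
  · obtain ⟨F, ⟨l, hl, hlen, hF⟩, h⟩ := FLO.exists_computable_denominator_active d
    refine ⟨F, ⟨l, hl, hlen.trans ?_, hF⟩, h⟩
    nlinarith [sq_nonneg d, Nat.zero_le (d ^ 3)]
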